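/- \textbf{Setting.} Let $(M,\langle\cdot,\cdot\rangle)$ be a smooth oriented Riemannian $3$-manifold with volume form $\mathrm{vol}$, and let $\mathcal C=UM$ be its unit tangent bundle, with points $(x,e)$ and projection $\pi:\mathcal C\to M$. Let $\theta^0_{(x,e)}=\langle e,d\pi\,\cdot\rangle$ be the contact form and $\mathcal I$ the contact ideal generated by $\theta^0$ and $d\theta^0$. Fix $H\in\mathbb R$ and a vector field $\Xi$ on $M$ with $\operatorname{div}\Xi=1$, and put $$\Lambda=\Lambda_0+2H\,\pi^*(\Xi\lrcorner\mathrm{vol}),\qquad (\Lambda_0)_{(x,e)}=\pi^*(e\lrcorner\mathrm{vol}_x).$$ There are $2$-forms $\Psi$ on $\mathcal C$ with $d\Lambda=\theta^0\wedge\Psi$; let $\mathcal E$ be the ideal generated by $\theta^0,d\theta^0,\Psi$. Let $S$ be a Killing field of $M$, extended to $\mathcal C$ as the generator of the lifted flow (and still denoted $S$). A \emph{Noether form} of $S$ is a smooth $1$-form $\mu$ on $\mathcal C$ of the form $$\mu=S\lrcorner\Lambda-\varphi+a\,\theta^0+db,\qquad \mathcal L_S\Lambda\equiv d\varphi \pmod{\mathcal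 I},$$ with $\varphi$ a smooth $1$-form and $a,b$ smooth functions on $\mathcal C$; it is a \emph{Noether form in the wide sense} if the congruence is only required modulo $\mathcal E$. The Noether class $\mu_S$ is the class of the Noether forms modulo exact forms and multiples of $\theta^0$. A vector field $F$ on $M$ is a \emph{potential vector} of $S$ if $\operatorname{rot}F=S$, i.e. $dF^\flat=S\lrcorner\mathrm{vol}$. Let $f:\Sigma\to M$ be a smooth immersion of a smooth surface (without boundary) with unit normal $n$; orient $\Sigma$ so that $(u,v)$ is positive iff $(n,df(u),df(v))$ is. Assume that $f$ has constant mean curvature $H$, i.e. the trace of $(u,v)\mapsto-\langle\nabla_u n,df(v)\rangle$ for the induced metric is $2H$. Let $N=(f,n):\Sigma\to\mathcal C$ be its Legendrian lift, and let $*df$ be given by $*df(e_1)=-df(e_2)$, $*df(e_2)=df(e_1)$ for positive orthonormal bases $(e_1,e_2)$. \textbf{Proposition.} \begin{enumerate} \item For every Noether form $\mu$ of $S$, even in the wide sense, $N^*\mu$ is a closed $1$-form on $\Sigma$. \item If two $1$-forms on $\mathcal C$ differ by $a\,\theta^0+db$ with $a,b$ smooth functions, then their pullbacks by $N$ differ by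 an exact form. \item For every potential vector $F$ of $S$, the form $S\lrcorner\Lambda_0-2H\,\pi^*F^\flat$ is a Noether form of $S$, and $$N^*(S\lrcorner\Lambda_0)=\langle S,*df\rangle,\qquad N^*(\pi^*F^\flat)=\langle F,df\rangle .$$ In particular $\langle S,*df\rangle-2H\langle F,df\rangle$ is closed. \item Suppose that $H^1(\mathcal C)=0$, i.e. that every closed $1$-form on $\mathcal C$ is exact (as is the case, for example, when $M$ is simply connected). Then for every Noether form $\mu$ of $S$ and every potential vector $F$ of $S$, $$[N^*\mu]=[\langle S,*df\rangle-2H\langle F,df\rangle]\quad\text{in }H^1(\Sigma).$$ So $N^*\mu_S$ is well defined in $H^1(\Sigma)$, and it is the minimal part $\langle S,*df\rangle$ minus $2H$ times the CMC part $\langle F,df\rangle$. \end{enumerate} -/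

import Mathlib

open scoped Manifold ContDiff
open Bundle

noncomputable section

namespace CMC

/-! ### Differential forms on a manifold without boundary -/

section Forms

variable {E : Type*} [NormedAddCommGroup E] [NormedSpace ℝ E]
  {H : Type*} [TopologicalSpace H] (I : ModelWithCorners ℝ E H)
  {X : Type*} [TopologicalSpace X] [ChartedSpace H X]
  {E' : Type*} [NormedAddCommGroup E'] [NormedSpace ℝ E']
  {H' : Type*} [TopologicalSpace H'] (I' : ModelWithCorners ℝ E' H')
  {X' : Type*} [TopologicalSpace X'] [ChartedSpace H' X']

/-- (Not necessarily continuous) differential `k`-forms on `X`. Values on tangent vectors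
`v₁, …, v_k` at `x` are written `α x ![v₁, …, v_k]`. -/
abbrev DForm (X : Type*) [TopologicalSpace X] [ChartedSpace H X] (k : ℕ) : Type _ :=
  (x : X) → (TangentSpace I x) [⋀^Fin k]→L[ℝ] ℝ

variable {I I'}

/-- The coordinate expression of the form `α` in the preferred chart at `x₀`, i.e. its pullback by
the inverse of the chart. -/
def DForm.inChart {k : ℕ} (α : DForm I X k) (x₀ : X) : E → E [⋀^Fin k]→L[ℝ] ℝ := fun y =>
  (α ((extChartAt I x₀).symm y)).compContinuousLinearMap
    (mfderiv 𝓘(ℝ, E) I (extChartAt I x₀).symm y)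

/-- Smooth differential forms: all coordinate expressions are `C^∞`. -/
def DForm.IsSmooth {k : ℕ} (α : DForm I X k) : Prop :=
  ∀ x₀ : X, ContDiffOn ℝ ∞ (α.inChart x₀) (extChartAt I x₀).target

/-- The exterior derivative, computed at `x` in the preferred chart at `x` (in Mathlib the space
`T_xX` is the model space `E`, identified by means of this very chart). -/
def DForm.d {k : ℕ} (α : DForm I X k) : DForm I X (k + 1) := fun x =>
  (extDeriv (α.inChart x) (extChartAt I x x) : E [⋀^Fin (k + 1)]→L[ℝ] ℝ)

/-- Closed smooth forms. -/
def DForm.IsClosed {k : ℕ} (α : DForm I X k) : Prop :=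
  α.IsSmooth ∧ ∀ x, α.d x = 0

/-- The interior product `V ⌟ α`. -/
def DForm.contract {k : ℕ} (V : (x : X) → TangentSpace I x) (α : DForm I X (k + 1)) :
    DForm I X k := fun x =>
  ContinuousAlternatingMap.curryLeft (E := E) (α x) (V x)

/-- The Lie derivative `ℒ_V α = d(V ⌟ α) + V ⌟ dα`. -/
def DForm.lieDeriv {k : ℕ} (V : (x : X) → TangentSpace I x) (α : DForm I X (k + 1)) :
    DForm I X (k + 1) := fun x =>
  (DForm.contract V α).d x + DForm.contract V α.d x

/-- The pullback `f^* α`. -/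
def DForm.pullback {k : ℕ} (f : X → X') (α : DForm I' X' k) : DForm I X k := fun x =>
  (α (f x)).compContinuousLinearMap (mfderiv I I' f x)

/-- The `1`-form with prescribed linear forms as values. -/
def DForm.ofLinear (l : (x : X) → TangentSpace I x →L[ℝ] ℝ) : DForm I X 1 := fun x =>
  ContinuousAlternatingMap.ofSubsingleton ℝ (TangentSpace I x) ℝ (0 : Fin 1) (l x)

variable (I) in
/-- Smooth real functions on `X`. -/
def IsSmoothFun (b : X → ℝ) : Prop := ContMDiff I 𝓘(ℝ, ℝ) ∞ b

variable (I) in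
/-- The differential of a real function, as a linear form on `T_xX`. -/
def dFun (b : X → ℝ) (x : X) : TangentSpace I x →L[ℝ] ℝ := mfderiv I 𝓘(ℝ, ℝ) b x

/-- Two `1`-forms differ by an exact form; for closed forms: they have the same class in
`H¹(X)`. -/
def DForm.Cohomologous (α β : DForm I X 1) : Prop :=
  ∃ b : X → ℝ, IsSmoothFun I b ∧ ∀ x (u : TangentSpace I x), α x ![u] - β x ![u] = dFun I b x u

end Forms

/-! ### Riemannian 3-manifolds -/

section Ambient

variable {M : Type*} [TopologicalSpace M] [ChartedSpace (EuclideanSpace ℝ (Fin 3)) M]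
  [IsManifold (𝓡 3) ∞ M]

/-- The tangent space of the 3-manifold `M` at `x`. -/
abbrev T3 {M : Type*} [TopologicalSpace M] [ChartedSpace (EuclideanSpace ℝ (Fin 3)) M]
    (x : M) : Type := TangentSpace (𝓡 3) x

/-- The total space of the tangent bundle of `M`, a smooth 6-manifold. -/
abbrev TM (M : Type*) [TopologicalSpace M] [ChartedSpace (EuclideanSpace ℝ (Fin 3)) M]
    [IsManifold (𝓡 3) ∞ M] : Type _ := TangentBundle (𝓡 3) M

/-- Smooth Riemannian metrics on `M`. -/
abbrev Metric (M : Type*) [TopologicalSpace M] [ChartedSpace (EuclideanSpace ℝ (Fin 3)) M]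
    [IsManifold (𝓡 3) ∞ M] : Type _ :=
  ContMDiffRiemannianMetric (𝓡 3) ∞ (EuclideanSpace ℝ (Fin 3)) (fun x : M => TangentSpace (𝓡 3) x)

/-- Smooth vector fields on `M`. -/
def IsSmoothField (V : (x : M) → T3 x) : Prop :=
  ContMDiff (𝓡 3) (𝓡 3).tangent ∞ (fun x => (⟨x, V x⟩ : TM M))

/-- `vol` is the Riemannian volume form of `g` for some orientation of `M`: a smooth `3`-form with
values `±1` on orthonormal bases. Choosing `vol` amounts to choosing an orientation. -/
def IsVolumeForm (g : Metric M) (vol : DForm (𝓡 3) M 3) : Prop :=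
  vol.IsSmooth ∧ ∀ (x : M) (e : Fin 3 → T3 x),
    (∀ i j, g.inner x (e i) (e j) = if i = j then 1 else 0) → vol x e = 1 ∨ vol x e = -1

/-- The `1`-form `F^♭ = ⟨F, ·⟩`. -/
def flat (g : Metric M) (F : (x : M) → T3 x) : DForm (𝓡 3) M 1 :=
  DForm.ofLinear fun x => g.inner x (F x)

/-- `rot F = S`, that is `dF^♭ = S ⌟ vol`: `F` is a potential vector of `S`. -/
def IsPotentialVector (g : Metric M) (vol : DForm (𝓡 3) M 3) (S F : (x : M) → T3 x) : Prop :=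
  IsSmoothField F ∧ ∀ x, (flat g F).d x = DForm.contract S vol x

/-- `div Ξ = 1`, that is `ℒ_Ξ vol = vol`: `Ξ` is a volume field. -/
def IsVolumeField (vol : DForm (𝓡 3) M 3) (Ξ : (x : M) → T3 x) : Prop :=
  IsSmoothField Ξ ∧ ∀ x, DForm.lieDeriv Ξ vol x = vol x

/-- The extension of a vector field `S` of `M` to `TM`, i.e. the infinitesimal generator of the
flow `(x, e) ↦ (φ_t x, dφ_t e)`, where `φ_t` is the flow of `S`. In the chart of `TM` induced by the
chart at `x`, its value at `(x, e)` is `(S(x), DS(x) e)`; here `DS(x) e` is the second component of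
the derivative of the section `S` in the direction `e`. -/
def extension (S : (x : M) → T3 x) (p : TM M) : TangentSpace (𝓡 3).tangent p :=
  ((S p.1 : EuclideanSpace ℝ (Fin 3)),
    Prod.snd (α := EuclideanSpace ℝ (Fin 3)) (β := EuclideanSpace ℝ (Fin 3))
      (mfderiv (𝓡 3) (𝓡 3).tangent (fun x => (⟨x, S x⟩ : TM M)) p.1 p.2))

/-- The function `(x, e) ↦ ⟨e, e⟩_x` on `TM`. -/
def normSq (g : Metric M) (p : TM M) : ℝ := g.inner p.1 p.2 p.2

/-- `S` is a Killing field: it is smooth and `(ℒ_S g)(e, e) = 0` for all tangent vectors `e`, i.e.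
its lifted flow preserves `⟨e, e⟩` infinitesimally. -/
def IsKilling (g : Metric M) (S : (x : M) → T3 x) : Prop :=
  IsSmoothField S ∧ ∀ p : TM M, dFun (𝓡 3).tangent (normSq g) p (extension S p) = 0

/-! ### The contact manifold of unit tangent vectors

`𝒞 = UM` is the hypersurface `⟨e, e⟩ = 1` of `TM`. Differential forms on `𝒞` are the restrictions of
smooth forms on `TM`; they are represented by the latter and compared on vectors tangent to `𝒞`. -/

/-- The projection `(x, e) ↦ x`. -/
def proj (p : TM M) : M := p.1

/-- The unit tangent bundle `𝒞 = UM`. -/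
def UM (g : Metric M) : Set (TM M) := {p | normSq g p = 1}

/-- The vectors tangent to `𝒞` at the point `p` of `𝒞`. -/
def tangentUM (g : Metric M) (p : TM M) : Set (TangentSpace (𝓡 3).tangent p) :=
  {w | dFun (𝓡 3).tangent (normSq g) p w = 0}

/-- The contact form `θ⁰_{(x, e)} = ⟨e, dπ ·⟩`. -/
def contactForm (g : Metric M) : DForm (𝓡 3).tangent (TM M) 1 :=
  DForm.ofLinear fun p => (g.inner p.1 p.2).comp (mfderiv (𝓡 3).tangent (𝓡 3) (proj (M := M)) p)

/-- The area lagrangian `Λ₀ = e ⌟ vol`. -/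
def lagrangianArea (vol : DForm (𝓡 3) M 3) : DForm (𝓡 3).tangent (TM M) 2 := fun p =>
  ContinuousAlternatingMap.compContinuousLinearMap
    (ContinuousAlternatingMap.curryLeft (E := EuclideanSpace ℝ (Fin 3)) (vol p.1) p.2)
    (mfderiv (𝓡 3).tangent (𝓡 3) (proj (M := M)) p)

/-- The lagrangian `Λ = Λ₀ + 2H Λ'` with `Λ' = Ξ ⌟ vol`. -/
def lagrangian (vol : DForm (𝓡 3) M 3) (Ξ : (x : M) → T3 x) (H : ℝ) :
    DForm (𝓡 3).tangent (TM M) 2 := fun p =>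
  lagrangianArea vol p + (2 * H) • DForm.pullback (proj (M := M)) (DForm.contract Ξ vol) p

/-- The `2`-form `β` lies, on `𝒞`, in the contact ideal generated by `θ⁰` and `dθ⁰`:
`β = α ∧ θ⁰ + b dθ⁰`. -/
def InContactIdeal (g : Metric M) (β : DForm (𝓡 3).tangent (TM M) 2) : Prop :=
  ∃ (α : DForm (𝓡 3).tangent (TM M) 1) (b : TM M → ℝ),
    α.IsSmooth ∧ IsSmoothFun (𝓡 3).tangent b ∧
    ∀ p ∈ UM g, ∀ u ∈ tangentUM g p, ∀ v ∈ tangentUM g p,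
      β p ![u, v] = (α p ![u] * contactForm g p ![v] - α p ![v] * contactForm g p ![u]) +
        b p * (contactForm g).d p ![u, v]

/-- `Ψ` is an Euler-Lagrange operator of the lagrangian `Λ`: it is a smooth `2`-form with
`dΛ = θ⁰ ∧ Ψ` on `𝒞`, which determines `Ψ` modulo `θ⁰`. -/
def IsEulerLagrangeOperator (g : Metric M) (Λ Ψ : DForm (𝓡 3).tangent (TM M) 2) : Prop :=
  Ψ.IsSmooth ∧ ∀ p ∈ UM g, ∀ u ∈ tangentUM g p, ∀ v ∈ tangentUM g p, ∀ w ∈ tangentUM g p,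
    Λ.d p ![u, v, w] = contactForm g p ![u] * Ψ p ![v, w] - contactForm g p ![v] * Ψ p ![u, w] +
      contactForm g p ![w] * Ψ p ![u, v]

/-- The `2`-form `β` lies, on `𝒞`, in the Euler-Lagrange system `ℰ` of `Λ`, the ideal generated by
`θ⁰`, `dθ⁰` and `Ψ`: one has `β = (element of the contact ideal) + c Ψ`. -/
def InEulerLagrangeSystem (g : Metric M) (Λ β : DForm (𝓡 3).tangent (TM M) 2) : Prop :=
  ∃ (Ψ : DForm (𝓡 3).tangent (TM M) 2) (c : TM M → ℝ),
    IsEulerLagrangeOperator g Λ Ψ ∧ IsSmoothFun (𝓡 3).tangent c ∧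
    InContactIdeal g (fun p => β p - c p • Ψ p)

/-- Two `1`-forms have the same class modulo `ℰ` and exact forms: on `𝒞` they differ by
`a θ⁰ + db` (the elements of degree one of `ℰ` are the multiples of `θ⁰`). -/
def SameClass (g : Metric M) (μ ν : DForm (𝓡 3).tangent (TM M) 1) : Prop :=
  ∃ a b : TM M → ℝ, IsSmoothFun (𝓡 3).tangent a ∧ IsSmoothFun (𝓡 3).tangent b ∧
    ∀ p ∈ UM g, ∀ w ∈ tangentUM g p,
      μ p ![w] - ν p ![w] = a p * contactForm g p ![w] + dFun (𝓡 3).tangent b p w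

/-- `μ` represents a Noether form of `S` in the wide sense: `μ = S ⌟ Λ - φ` modulo `ℰ` and exact
forms, where `ℒ_S Λ ≡ dφ` modulo the Euler-Lagrange system `ℰ`. -/
def IsWeakNoetherForm (g : Metric M) (Λ : DForm (𝓡 3).tangent (TM M) 2) (S : (x : M) → T3 x)
    (μ : DForm (𝓡 3).tangent (TM M) 1) : Prop :=
  μ.IsSmooth ∧ ∃ φ : DForm (𝓡 3).tangent (TM M) 1, φ.IsSmooth ∧
    InEulerLagrangeSystem g Λ (fun p => DForm.lieDeriv (extension S) Λ p - φ.d p) ∧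
    SameClass g μ (fun p => DForm.contract (extension S) Λ p - φ p)

/-- `μ` represents the Noether form `μ_S`: `μ = S ⌟ Λ - φ` modulo `ℰ` and exact forms, where
`ℒ_S Λ ≡ dφ` modulo the contact ideal. -/
def IsNoetherForm (g : Metric M) (Λ : DForm (𝓡 3).tangent (TM M) 2) (S : (x : M) → T3 x)
    (μ : DForm (𝓡 3).tangent (TM M) 1) : Prop :=
  μ.IsSmooth ∧ ∃ φ : DForm (𝓡 3).tangent (TM M) 1, φ.IsSmooth ∧
    InContactIdeal g (fun p => DForm.lieDeriv (extension S) Λ p - φ.d p) ∧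
    SameClass g μ (fun p => DForm.contract (extension S) Λ p - φ p)

/-- `H¹(𝒞) = 0`: every closed smooth `1`-form on `𝒞` is exact on `𝒞`. -/
def FirstCohomologyVanishes (g : Metric M) : Prop :=
  ∀ η : DForm (𝓡 3).tangent (TM M) 1, η.IsSmooth →
    (∀ p ∈ UM g, ∀ u ∈ tangentUM g p, ∀ v ∈ tangentUM g p, η.d p ![u, v] = 0) →
    ∃ b : TM M → ℝ, IsSmoothFun (𝓡 3).tangent b ∧
      ∀ p ∈ UM g, ∀ w ∈ tangentUM g p, η p ![w] = dFun (𝓡 3).tangent b p w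

/-- The derivative in the direction `a`, at `x`, of the coefficient `⟨b, c⟩` of the metric in the
chart at `x`. -/
def metricDeriv (g : Metric M) (x : M) (a b c : EuclideanSpace ℝ (Fin 3)) : ℝ :=
  fderiv ℝ (fun y : EuclideanSpace ℝ (Fin 3) =>
    g.inner ((extChartAt (𝓡 3) x).symm y)
      (mfderiv 𝓘(ℝ, EuclideanSpace ℝ (Fin 3)) (𝓡 3) (extChartAt (𝓡 3) x).symm y b)
      (mfderiv 𝓘(ℝ, EuclideanSpace ℝ (Fin 3)) (𝓡 3) (extChartAt (𝓡 3) x).symm y c))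
    (extChartAt (𝓡 3) x x) a

/-- The Christoffel symbol of the first kind `⟨Γ(a, b), c⟩` of the Levi-Civita connection at `x`, in
the chart at `x`. -/
def christoffel (g : Metric M) (x : M) (a b c : EuclideanSpace ℝ (Fin 3)) : ℝ :=
  (metricDeriv g x a b c + metricDeriv g x b a c - metricDeriv g x c a b) / 2

end Ambient

/-! ### Immersed surfaces -/

section Surface

variable {M : Type*} [TopologicalSpace M] [ChartedSpace (EuclideanSpace ℝ (Fin 3)) M]
  [IsManifold (𝓡 3) ∞ M]
  {Sg : Type*} [TopologicalSpace Sg] [ChartedSpace (EuclideanSpace ℝ (Fin 2)) Sg]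

/-- The tangent plane of the surface at `s`. -/
abbrev T2 {Sg : Type*} [TopologicalSpace Sg] [ChartedSpace (EuclideanSpace ℝ (Fin 2)) Sg]
    (s : Sg) : Type := TangentSpace (𝓡 2) s

/-- The differential of `f : Σ → M`. -/
def df (f : Sg → M) (s : Sg) : T2 s →L[ℝ] T3 (f s) := mfderiv (𝓡 2) (𝓡 3) f s

/-- Smooth immersions of the surface in `M`. -/
def IsImmersion (f : Sg → M) : Prop :=
  ContMDiff (𝓡 2) (𝓡 3) ∞ f ∧ ∀ s, Function.Injective (df f s)

/-- The map `N = (f, n) : Σ → TM` of a vector field `n` along `f`. -/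
def lift (f : Sg → M) (n : (s : Sg) → T3 (f s)) (s : Sg) : TM M := ⟨f s, n s⟩

/-- `n` is a smooth unit normal field along `f`; equivalently `N = (f, n)` is a legendrian lift of
`f` to the unit tangent bundle. -/
def IsUnitNormal (g : Metric M) (f : Sg → M) (n : (s : Sg) → T3 (f s)) : Prop :=
  ContMDiff (𝓡 2) (𝓡 3).tangent ∞ (lift f n) ∧ (∀ s, lift f n s ∈ UM g) ∧
    ∀ s (u : T2 s), g.inner (f s) (n s) (df f s u) = 0

/-- The second fundamental form `II(u, v) = -⟨∇_u n, df v⟩`. In the chart at `f s` one has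
`∇_u n = Dn(u) + Γ(df u, n)`, and `Dn(u)` is the second component of the derivative of
`N = (f, n)`. -/
def secondFundamentalForm (g : Metric M) (f : Sg → M) (n : (s : Sg) → T3 (f s)) (s : Sg)
    (u v : T2 s) : ℝ :=
  -(g.inner (f s)
      (Prod.snd (α := EuclideanSpace ℝ (Fin 3)) (β := EuclideanSpace ℝ (Fin 3))
        (mfderiv (𝓡 2) (𝓡 3).tangent (lift f n) s u)) (df f s v) +
    christoffel g (f s) (df f s u) (n s) (df f s v))

/-- `f` has constant mean curvature `H` with respect to the unit normal `n`: the trace of `II` with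
respect to the induced metric is `2H` at every point. -/
def IsCMC (g : Metric M) (f : Sg → M) (n : (s : Sg) → T3 (f s)) (H : ℝ) : Prop :=
  ∀ s (u₁ u₂ : T2 s), g.inner (f s) (df f s u₁) (df f s u₁) = 1 →
    g.inner (f s) (df f s u₂) (df f s u₂) = 1 → g.inner (f s) (df f s u₁) (df f s u₂) = 0 →
    secondFundamentalForm g f n s u₁ u₁ + secondFundamentalForm g f n s u₂ u₂ = 2 * H

/-- The area form of the metric induced by `f`, for the orientation of the surface for which `n` is
the unit normal: `(u, v)` is positive if and only if `(n, df u, df v)` is. -/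
def areaForm (vol : DForm (𝓡 3) M 3) (f : Sg → M) (n : (s : Sg) → T3 (f s)) (s : Sg)
    (u v : T2 s) : ℝ := vol (f s) ![n s, df f s u, df f s v]

/-- The coordinate basis of the tangent plane. -/
def coordVec (s : Sg) (i : Fin 2) : T2 s :=
  (EuclideanSpace.single i (1 : ℝ) : EuclideanSpace ℝ (Fin 2))

/-- The rotation `J` by `+π/2` of the oriented tangent plane for the metric induced by `f`. It is
given by `J u = (⟨b₀, u⟩ b₁ - ⟨b₁, u⟩ b₀) / area(b₀, b₁)` for any basis `(b₀, b₁)`; on a positive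
orthonormal basis `J e₁ = e₂` and `J e₂ = -e₁`. -/
def rotation (g : Metric M) (vol : DForm (𝓡 3) M 3) (f : Sg → M) (n : (s : Sg) → T3 (f s))
    (s : Sg) : T2 s →L[ℝ] T2 s :=
  (areaForm vol f n s (coordVec s 0) (coordVec s 1))⁻¹ •
    ((((g.inner (f s) (df f s (coordVec s 0))).comp (df f s)).smulRight (coordVec s 1)) -
      (((g.inner (f s) (df f s (coordVec s 1))).comp (df f s)).smulRight (coordVec s 0)))

/-- `*df = -df ∘ J`, where `*` is the Hodge operator of the surface: on a positive orthonormal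
basis `*df(e₁) = -df(e₂)` and `*df(e₂) = df(e₁)`. -/
def starDf (g : Metric M) (vol : DForm (𝓡 3) M 3) (f : Sg → M) (n : (s : Sg) → T3 (f s))
    (s : Sg) : T2 s →L[ℝ] T3 (f s) :=
  -((df f s).comp (rotation g vol f n s))

/-- The minimal part `⟨S, *df⟩`. -/
def minimalPart (g : Metric M) (vol : DForm (𝓡 3) M 3) (f : Sg → M) (n : (s : Sg) → T3 (f s))
    (S : (x : M) → T3 x) : DForm (𝓡 2) Sg 1 :=
  DForm.ofLinear fun s => (g.inner (f s) (S (f s))).comp (starDf g vol f n s)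

/-- The CMC part `⟨F, df⟩`. -/
def cmcPart (g : Metric M) (f : Sg → M) (F : (x : M) → T3 x) : DForm (𝓡 2) Sg 1 :=
  DForm.ofLinear fun s => (g.inner (f s) (F (f s))).comp (df f s)

end Surface

end CMC

end

/-! Write θ for the contact form and N = (f, n). Since n is normal to f, N^*θ = 0, hence N^*dθ = 0,
and adding a θ + db to a form changes its pullback by d(b ∘ N). The mean curvature enters only
through `IsCMC.d_lagrangian_eq_zero`: dΛ(W, dN u, dN v) = 0 for every W tangent to 𝒞. As d(Ξ ⌟ vol)
= vol, the second part of Λ contributes 2H vol. In an orthonormal frame (n, df u, df v) the part Λ₀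
contributes minus the trace of II along the normal component of W, and the two cancel. Choosing W
with θ(W) = 1 shows that every Euler-Lagrange operator Ψ satisfies N^*Ψ = 0.

Closedness: by Cartan's formula d(S ⌟ Λ - φ) = (ℒ_S Λ - dφ) - S ⌟ dΛ. The bracket lies in an ideal
whose generators pull back to zero. The last term pulls back to zero by the identity above with W
the extension of S, which is tangent to 𝒞 because S is Killing.

A representative: a Killing field preserves vol, so ℒ_S Λ₀ = 0. Moreover ℒ_S(π^*(Ξ ⌟ vol)) = d π^*(S
⌟ Ξ ⌟ vol) + π^*(S ⌟ vol), and S ⌟ vol = dF^♭. Thus ℒ_S Λ = dφ exactly, with φ = 2H π^*(S ⌟ Ξ ⌟ vol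
+ F^♭), and S ⌟ Λ - φ = S ⌟ Λ₀ - 2H π^*F^♭. Its first part pulls back to vol(n, S, df ·), which is
⟨S, *df⟩ by a Gram determinant.

Uniqueness: two choices of φ differ by a form η with dη = α ∧ θ + b dθ on 𝒞. Then ψ = η - bθ
satisfies dψ = (α - db) ∧ θ. Differentiating once more, (α - db) ∧ dθ = 0 on the contact planes.
These have dimension four and dθ is nondegenerate on them, so α - db is a multiple of θ and dψ = 0
(`d_eq_zero_of_d_eq_wedge`). When H¹(𝒞) = 0, ψ is exact, so η = bθ + dc. Forms on 𝒞 are represented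
on TM and compared only on vectors tangent to 𝒞; identities are therefore differentiated after
pullback by the retraction (x, e) ↦ (x, e/|e|). -/

noncomputable section

namespace CMC

set_option linter.unusedSectionVars false
set_option synthInstance.maxHeartbeats 200000

open Filter Topology Set

/-! ### Smooth families of alternating forms. -/

section Alternating

variable {E : Type*} [NormedAddCommGroup E] [NormedSpace ℝ E]
  {E' : Type*} [NormedAddCommGroup E'] [NormedSpace ℝ E']
  {F : Type*} [NormedAddCommGroup F] [NormedSpace ℝ F]

theorem contDiffAt_clm_of_apply [FiniteDimensional ℝ E] {f : F → E →L[ℝ] E'} {x : F}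
    (h : ∀ v, ContDiffAt ℝ ∞ (fun z => f z v) x) : ContDiffAt ℝ ∞ f x := by
  let d := Module.finrank ℝ E
  have hd : d = Module.finrank ℝ (Fin d → ℝ) := (Module.finrank_fin_fun ℝ).symm
  let e₁ := ContinuousLinearEquiv.ofFinrankEq hd
  let e₂ := (e₁.arrowCongr (1 : E' ≃L[ℝ] E')).trans (ContinuousLinearEquiv.piRing (Fin d))
  rw [← Function.id_comp f, ← e₂.symm_comp_self]
  exact e₂.symm.contDiff.contDiffAt.comp x (contDiffAt_pi.mpr fun i => h _)

theorem contDiffAt_alt_apply {k : ℕ} {w : F → E [⋀^Fin k]→L[ℝ] ℝ} {v : F → Fin k → E} {x : F}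
    (hw : ContDiffAt ℝ ∞ w x) (hv : ∀ i, ContDiffAt ℝ ∞ (fun z => v z i) x) :
    ContDiffAt ℝ ∞ (fun z => w z (v z)) x := by
  induction k with
  | zero =>
    have h := ((ContinuousAlternatingMap.constOfIsEmptyLIE ℝ E ℝ (Fin 0)).symm.contDiff
      (n := ∞)).contDiffAt.comp x hw
    refine h.congr_of_eventuallyEq (Eventually.of_forall fun z => ?_)
    simp only [Function.comp_apply]
    rw [Subsingleton.elim (v z) 0]
    rfl
  | succ k ih =>
    have h0 : ContDiffAt ℝ ∞ (fun z => (w z).curryLeft) x := by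
      let c : (E [⋀^Fin (k + 1)]→L[ℝ] ℝ) →L[ℝ] (E →L[ℝ] E [⋀^Fin k]→L[ℝ] ℝ) :=
        (ContinuousAlternatingMap.curryLeftLI (𝕜 := ℝ) (E := E) (F := ℝ)
          (n := k)).toContinuousLinearMap
      exact (ContinuousLinearMap.contDiff (E := E [⋀^Fin (k + 1)]→L[ℝ] ℝ)
        (F := E →L[ℝ] E [⋀^Fin k]→L[ℝ] ℝ) c).contDiffAt.comp x hw
    have h1 : ContDiffAt ℝ ∞ (fun z => (w z).curryLeft (v z 0)) x := h0.clm_apply (hv 0)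
    refine (ih h1 (fun i => hv i.succ)).congr_of_eventuallyEq (Eventually.of_forall fun z => ?_)
    simp only [ContinuousAlternatingMap.curryLeft_apply_apply]
    congr 1
    exact (Fin.cons_self_tail (v z)).symm

/-- Currying reduces the degree by one, and alternatization recovers the form from its curried
version by a continuous linear map. -/
theorem contDiffAt_alt_of_apply [FiniteDimensional ℝ E] {k : ℕ} {w : F → E [⋀^Fin k]→L[ℝ] ℝ} {x : F}
    (h : ∀ v, ContDiffAt ℝ ∞ (fun z => w z v) x) : ContDiffAt ℝ ∞ w x := by
  induction k with
  | zero =>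
    have h := ((ContinuousAlternatingMap.constOfIsEmptyLIE ℝ E ℝ (Fin 0)).contDiff
      (n := ∞)).contDiffAt.comp x (h 0)
    refine h.congr_of_eventuallyEq (Eventually.of_forall fun z => ?_)
    ext v
    rw [Subsingleton.elim v 0]
    rfl
  | succ k ih =>
    have h1 : ContDiffAt ℝ ∞ (fun z => (w z).curryLeft) x :=
      contDiffAt_clm_of_apply fun v => ih fun u => h (Matrix.vecCons v u)
    have h2 := ((ContinuousAlternatingMap.alternatizeUncurryFinCLM ℝ E ℝ (n := k)).contDiff
      (n := ∞)).contDiffAt.comp x h1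
    -- Alternatizing the curried form of a form of degree k + 1 gives k + 1 times that form.
    refine (h2.const_smul ((k : ℝ) + 1)⁻¹).congr_of_eventuallyEq (Eventually.of_forall fun z => ?_)
    have hk : (k : ℝ) + 1 ≠ 0 := by positivity
    have h3 := ContinuousAlternatingMap.alternatizeUncurryFin_curryLeft (𝕜 := ℝ) (w z)
    simp only [Function.comp_apply, ContinuousAlternatingMap.alternatizeUncurryFinCLM_apply, h3]
    ext u
    simp only [ContinuousAlternatingMap.smul_apply, smul_eq_mul, nsmul_eq_mul]
    push_cast
    field_simp

theorem contDiffAt_compContinuousLinearMap [FiniteDimensional ℝ E] {k : ℕ}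
    {w : F → E' [⋀^Fin k]→L[ℝ] ℝ} {L : F → E →L[ℝ] E'} {y : F}
    (hw : ContDiffAt ℝ ∞ w y) (hL : ContDiffAt ℝ ∞ L y) :
    ContDiffAt ℝ ∞ (fun z => (w z).compContinuousLinearMap (L z)) y :=
  contDiffAt_alt_of_apply fun v => contDiffAt_alt_apply (v := fun z i => L z (v i)) hw
    fun _ => hL.clm_apply contDiffAt_const

end Alternating

/-! ### Differential forms in charts: pullback and exterior derivative. -/

section Forms

variable {E : Type*} [NormedAddCommGroup E] [NormedSpace ℝ E]
  {H : Type*} [TopologicalSpace H] {I : ModelWithCorners ℝ E H}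
  {X : Type*} [TopologicalSpace X] [ChartedSpace H X]
  {E' : Type*} [NormedAddCommGroup E'] [NormedSpace ℝ E']
  {H' : Type*} [TopologicalSpace H'] {I' : ModelWithCorners ℝ E' H'}
  {X' : Type*} [TopologicalSpace X'] [ChartedSpace H' X']

variable (I I') in
/-- The derivative of a map between manifolds, as a linear map between the model spaces. -/
def tmap (f : X → X') (x : X) : E →L[ℝ] E' := mfderiv I I' f x

variable (I) in
/-- The derivative of the inverse of the preferred chart at `x₀`. -/
def chartD (x₀ : X) (y : E) : E →L[ℝ] E := mfderiv 𝓘(ℝ, E) I (extChartAt I x₀).symm y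

/-- The value of a form at a point, as a form on the model space. -/
def DForm.val {k : ℕ} (α : DForm I X k) (x : X) : E [⋀^Fin k]→L[ℝ] ℝ := α x

theorem DForm.inChart_eq {k : ℕ} (α : DForm I X k) (x₀ : X) (y : E) :
    α.inChart x₀ y =
      (α.val ((extChartAt I x₀).symm y)).compContinuousLinearMap (chartD I x₀ y) := rfl

theorem DForm.pullback_val {k : ℕ} (f : X → X') (α : DForm I' X' k) (x : X) :
    (DForm.pullback (I := I) f α).val x =
      (α.val (f x)).compContinuousLinearMap (tmap I I' f x) := rfl

theorem two_le_infty : minSmoothness ℝ 2 ≤ (∞ : WithTop ℕ∞) := by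
  rw [minSmoothness_of_isRCLikeNormedField]
  exact WithTop.coe_le_coe.2 le_top

section Charts

variable [FiniteDimensional ℝ E] [I.Boundaryless] [IsManifold I ∞ X]

theorem mdifferentiableAt_chart_symm {x₀ : X} {y : E} (hy : y ∈ (extChartAt I x₀).target) :
    MDifferentiableAt 𝓘(ℝ, E) I (extChartAt I x₀).symm y := by
  have : IsManifold I 1 X := IsManifold.of_le (n := ∞) (by simp)
  have := mdifferentiableWithinAt_extChartAt_symm (I := I) hy
  rwa [I.range_eq_univ, mdifferentiableWithinAt_univ] at this

theorem contMDiffAt_chart_symm {x₀ : X} {y : E} (hy : y ∈ (extChartAt I x₀).target) :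
    ContMDiffAt 𝓘(ℝ, E) I ∞ (extChartAt I x₀).symm y :=
  (contMDiffOn_extChartAt_symm (n := ∞) x₀).contMDiffAt ((isOpen_extChartAt_target x₀).mem_nhds hy)

theorem contMDiffAt_chart {x₀ x : X} (hx : x ∈ (extChartAt I x₀).source) :
    ContMDiffAt I 𝓘(ℝ, E) ∞ (extChartAt I x₀) x := by
  rw [extChartAt_source] at hx
  exact contMDiffAt_extChartAt' hx

theorem tmap_chart_comp_chartD {x₀ : X} {y : E} (hy : y ∈ (extChartAt I x₀).target) :
    (tmap I 𝓘(ℝ, E) (extChartAt I x₀) ((extChartAt I x₀).symm y)).comp (chartD I x₀ y) =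
      ContinuousLinearMap.id ℝ E := by
  have : IsManifold I 1 X := IsManifold.of_le (n := ∞) (by simp)
  have := mfderiv_extChartAt_comp_mfderivWithin_extChartAt_symm (I := I) hy
  rw [I.range_eq_univ, mfderivWithin_univ] at this
  exact this

theorem chartD_comp_tmap_chart {x₀ x : X} (hx : x ∈ (extChartAt I x₀).source) :
    (chartD I x₀ (extChartAt I x₀ x)).comp (tmap I 𝓘(ℝ, E) (extChartAt I x₀) x) =
      ContinuousLinearMap.id ℝ E := by
  have : IsManifold I 1 X := IsManifold.of_le (n := ∞) (by simp)
  have := mfderivWithin_extChartAt_symm_comp_mfderiv_extChartAt' (I := I) hx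
  rw [I.range_eq_univ, mfderivWithin_univ] at this
  exact this

theorem tmap_chart_self (x : X) :
    tmap I 𝓘(ℝ, E) (extChartAt I x) x = ContinuousLinearMap.id ℝ E := by
  have : IsManifold I 1 X := IsManifold.of_le (n := ∞) (by simp)
  exact mfderiv_extChartAt_self

theorem chartD_self (x : X) : chartD I x (extChartAt I x x) = ContinuousLinearMap.id ℝ E := by
  have := chartD_comp_tmap_chart (I := I) (mem_extChartAt_source (I := I) x)
  rwa [tmap_chart_self, ContinuousLinearMap.comp_id] at this

theorem DForm.inChart_self {k : ℕ} (α : DForm I X k) (x : X) :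
    α.inChart x (extChartAt I x x) = α.val x := by
  rw [DForm.inChart_eq, chartD_self, extChartAt_to_inv]
  rfl

variable [FiniteDimensional ℝ E'] [I'.Boundaryless] [IsManifold I' ∞ X']

/-- The expression of a map in the preferred charts at `x₀` and `x₁`. -/
def coordMap (I : ModelWithCorners ℝ E H) (I' : ModelWithCorners ℝ E' H') (x₀ : X) (x₁ : X')
    (f : X → X') : E → E' :=
  fun y => extChartAt I' x₁ (f ((extChartAt I x₀).symm y))

theorem eventually_coordMap_mem {f : X → X'} {x₀ : X} {x₁ : X'} {y : E}
    (hy : y ∈ (extChartAt I x₀).target) (hf : ContinuousAt f ((extChartAt I x₀).symm y))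
    (hfy : f ((extChartAt I x₀).symm y) ∈ (extChartAt I' x₁).source) :
    ∀ᶠ z in 𝓝 y, z ∈ (extChartAt I x₀).target ∧
      f ((extChartAt I x₀).symm z) ∈ (extChartAt I' x₁).source := by
  refine Eventually.and ((isOpen_extChartAt_target x₀).mem_nhds hy) ?_
  have : ContinuousAt (fun z => f ((extChartAt I x₀).symm z)) y :=
    ContinuousAt.comp (g := f) hf (contMDiffAt_chart_symm hy).continuousAt
  exact this ((isOpen_extChartAt_source x₁).mem_nhds hfy)

theorem contDiffAt_coordMap {f : X → X'} {x₀ : X} {x₁ : X'} {y : E}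
    (hy : y ∈ (extChartAt I x₀).target) (hf : ContMDiffAt I I' ∞ f ((extChartAt I x₀).symm y))
    (hfy : f ((extChartAt I x₀).symm y) ∈ (extChartAt I' x₁).source) :
    ContDiffAt ℝ ∞ (coordMap I I' x₀ x₁ f) y := by
  rw [← contMDiffAt_iff_contDiffAt]
  exact ContMDiffAt.comp (I' := I') y (contMDiffAt_chart hfy)
    (ContMDiffAt.comp (I' := I) y hf (contMDiffAt_chart_symm hy))

/-- Near `y` the map `f ∘ (extChartAt I x₀).symm` equals `(extChartAt I' x₁).symm ∘ coordMap I I' x₀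
x₁ f`; the two sides are its derivative computed by the chain rule along each factorization. -/
theorem tmap_comp_chartD {f : X → X'} {x₀ : X} {x₁ : X'} {y : E}
    (hy : y ∈ (extChartAt I x₀).target)
    (hf : MDifferentiableAt I I' f ((extChartAt I x₀).symm y))
    (hfy : f ((extChartAt I x₀).symm y) ∈ (extChartAt I' x₁).source) :
    (tmap I I' f ((extChartAt I x₀).symm y)).comp (chartD I x₀ y) =
      (chartD I' x₁ (coordMap I I' x₀ x₁ f y)).comp (fderiv ℝ (coordMap I I' x₀ x₁ f) y) := by
  have h1 : HasMFDerivAt 𝓘(ℝ, E) I' (f ∘ (extChartAt I x₀).symm) y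
      (ContinuousLinearMap.comp (M₁ := E) (M₂ := E) (M₃ := E')
        (tmap I I' f ((extChartAt I x₀).symm y)) (chartD I x₀ y)) :=
    hf.hasMFDerivAt.comp y (mdifferentiableAt_chart_symm hy).hasMFDerivAt
  have hc : MDifferentiableAt 𝓘(ℝ, E) 𝓘(ℝ, E') (coordMap I I' x₀ x₁ f) y :=
    MDifferentiableAt.comp (I' := I') y ((contMDiffAt_chart hfy).mdifferentiableAt (by simp))
      (MDifferentiableAt.comp (I' := I) y hf (mdifferentiableAt_chart_symm hy))
  have hmem : coordMap I I' x₀ x₁ f y ∈ (extChartAt I' x₁).target :=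
    (extChartAt I' x₁).map_source hfy
  have h2 : HasMFDerivAt 𝓘(ℝ, E) I' ((extChartAt I' x₁).symm ∘ coordMap I I' x₀ x₁ f) y
      (ContinuousLinearMap.comp (M₁ := E) (M₂ := E') (M₃ := E')
        (chartD I' x₁ (coordMap I I' x₀ x₁ f y)) (fderiv ℝ (coordMap I I' x₀ x₁ f) y)) := by
    have h3 := (mdifferentiableAt_iff_differentiableAt.1 hc).hasFDerivAt.hasMFDerivAt
    exact (mdifferentiableAt_chart_symm hmem).hasMFDerivAt.comp y h3
  have h4 : f ∘ (extChartAt I x₀).symm =ᶠ[𝓝 y]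
      (extChartAt I' x₁).symm ∘ coordMap I I' x₀ x₁ f := by
    filter_upwards [eventually_coordMap_mem hy hf.continuousAt hfy] with z hz
    exact ((extChartAt I' x₁).left_inv hz.2).symm
  exact hasMFDerivAt_unique h1 (h2.congr_of_eventuallyEq h4)

theorem DForm.inChart_pullback {k : ℕ} (α : DForm I' X' k) {f : X → X'} {x₀ : X} {x₁ : X'} {y : E}
    (hy : y ∈ (extChartAt I x₀).target)
    (hf : MDifferentiableAt I I' f ((extChartAt I x₀).symm y))
    (hfy : f ((extChartAt I x₀).symm y) ∈ (extChartAt I' x₁).source) :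
    (DForm.pullback (I := I) f α).inChart x₀ y =
      (α.inChart x₁ (coordMap I I' x₀ x₁ f y)).compContinuousLinearMap
        (fderiv ℝ (coordMap I I' x₀ x₁ f) y) := by
  have h := tmap_comp_chartD hy hf hfy
  have h' : (extChartAt I' x₁).symm (coordMap I I' x₀ x₁ f y) = f ((extChartAt I x₀).symm y) :=
    (extChartAt I' x₁).left_inv hfy
  rw [DForm.inChart_eq, DForm.inChart_eq, DForm.pullback_val, h']
  ext v
  have h5 := fun i => DFunLike.congr_fun h (v i)
  simp only [ContinuousLinearMap.comp_apply] at h5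
  simp only [ContinuousAlternatingMap.compContinuousLinearMap_apply]
  congr 1
  ext i
  exact h5 i

theorem tmap_eq_fderiv {f : X → X'} {x : X} (hf : MDifferentiableAt I I' f x) :
    tmap I I' f x = fderiv ℝ (coordMap I I' x (f x) f) (extChartAt I x x) := by
  have hy : (extChartAt I x).symm (extChartAt I x x) = x := extChartAt_to_inv x
  have h := tmap_comp_chartD (x₁ := f x) (mem_extChartAt_target (I := I) x) (f := f)
    (by rwa [hy]) (by rw [hy]; exact mem_extChartAt_source _)
  rw [hy, chartD_self, ContinuousLinearMap.comp_id] at h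
  rw [h]
  have : coordMap I I' x (f x) f (extChartAt I x x) = extChartAt I' (f x) (f x) := by
    simp [coordMap]
  rw [this, chartD_self, ContinuousLinearMap.id_comp]

/-! ### Exterior derivative -/

theorem DForm.IsSmooth.contDiffAt {k : ℕ} {α : DForm I X k} (hα : α.IsSmooth) {x₀ : X} {y : E}
    (hy : y ∈ (extChartAt I x₀).target) : ContDiffAt ℝ ∞ (α.inChart x₀) y :=
  (hα x₀).contDiffAt ((isOpen_extChartAt_target x₀).mem_nhds hy)

theorem DForm.IsSmooth.differentiableAt {k : ℕ} {α : DForm I X k} (hα : α.IsSmooth) {x₀ : X} {y : E}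
    (hy : y ∈ (extChartAt I x₀).target) : DifferentiableAt ℝ (α.inChart x₀) y :=
  (hα.contDiffAt hy).differentiableAt (by simp)

theorem DForm.isSmooth_of_contDiffAt {k : ℕ} {α : DForm I X k}
    (h : ∀ x₀, ∀ y ∈ (extChartAt I x₀).target, ContDiffAt ℝ ∞ (α.inChart x₀) y) : α.IsSmooth :=
  fun x₀ y hy => (h x₀ y hy).contDiffWithinAt

theorem DForm.IsSmooth.pullback_contDiffAt {k : ℕ} {α : DForm I' X' k} (hα : α.IsSmooth)
    {f : X → X'} {x₀ : X} {y : E} (hy : y ∈ (extChartAt I x₀).target)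
    (hf : ∀ᶠ z in 𝓝 y, MDifferentiableAt I I' f ((extChartAt I x₀).symm z))
    (hf' : ContMDiffAt I I' ∞ f ((extChartAt I x₀).symm y)) :
    ContDiffAt ℝ ∞ ((DForm.pullback (I := I) f α).inChart x₀) y := by
  set x₁ := f ((extChartAt I x₀).symm y) with hx₁
  have hfy : f ((extChartAt I x₀).symm y) ∈ (extChartAt I' x₁).source := mem_extChartAt_source _
  have hc := contDiffAt_coordMap hy hf' hfy
  have h1 : ContDiffAt ℝ ∞ (fun z => (α.inChart x₁ (coordMap I I' x₀ x₁ f z)).compContinuousLinearMap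
        (fderiv ℝ (coordMap I I' x₀ x₁ f) z)) y := by
    refine contDiffAt_compContinuousLinearMap ?_ (hc.fderiv_right (by simp))
    exact ContDiffAt.comp (g := α.inChart x₁) y
      (hα.contDiffAt ((extChartAt I' x₁).map_source hfy)) hc
  refine h1.congr_of_eventuallyEq ?_
  filter_upwards [hf, eventually_coordMap_mem hy hf'.continuousAt hfy] with z hz hz'
  exact DForm.inChart_pullback α hz'.1 hz hz'.2

theorem DForm.IsSmooth.pullback {k : ℕ} {α : DForm I' X' k} (hα : α.IsSmooth) {f : X → X'}
    (hf : ContMDiff I I' ∞ f) : (DForm.pullback (I := I) f α).IsSmooth :=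
  DForm.isSmooth_of_contDiffAt fun _ _ hy => hα.pullback_contDiffAt hy
    (Eventually.of_forall fun _ => hf.contMDiffAt.mdifferentiableAt (by simp)) hf.contMDiffAt

/-- The exterior derivative commutes with pullbacks, in charts. -/
theorem extDeriv_inChart_pullback {k : ℕ} {α : DForm I' X' k} (hα : α.IsSmooth)
    {f : X → X'} (hf : ContMDiff I I' ∞ f) {x₀ : X} {x₁ : X'} {y : E}
    (hy : y ∈ (extChartAt I x₀).target)
    (hfy : f ((extChartAt I x₀).symm y) ∈ (extChartAt I' x₁).source) :
    extDeriv ((DForm.pullback (I := I) f α).inChart x₀) y =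
      (extDeriv (α.inChart x₁) (coordMap I I' x₀ x₁ f y)).compContinuousLinearMap
        (fderiv ℝ (coordMap I I' x₀ x₁ f) y) := by
  have h1 : (DForm.pullback (I := I) f α).inChart x₀ =ᶠ[𝓝 y] fun z =>
      (α.inChart x₁ (coordMap I I' x₀ x₁ f z)).compContinuousLinearMap
        (fderiv ℝ (coordMap I I' x₀ x₁ f) z) := by
    filter_upwards [eventually_coordMap_mem hy hf.continuous.continuousAt hfy] with z hz'
    exact DForm.inChart_pullback α hz'.1 (hf.contMDiffAt.mdifferentiableAt (by simp)) hz'.2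
  rw [h1.extDeriv_eq]
  exact extDeriv_pullback (r := ∞) (hα.differentiableAt ((extChartAt I' x₁).map_source hfy))
    (contDiffAt_coordMap hy hf.contMDiffAt hfy) two_le_infty

theorem DForm.d_val {k : ℕ} (α : DForm I X k) (x : X) :
    α.d.val x = extDeriv (α.inChart x) (extChartAt I x x) := rfl

theorem tmap_id (x : X) : tmap I I (fun x : X => x) x = ContinuousLinearMap.id ℝ E :=
  mfderiv_id

theorem DForm.pullback_id {k : ℕ} (α : DForm I X k) :
    DForm.pullback (I := I) (fun x : X => x) α = α := by
  funext x
  have : mfderiv I I (fun x : X => x) x = ContinuousLinearMap.id ℝ _ := mfderiv_id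
  unfold DForm.pullback
  rw [this]
  rfl

/-- The exterior derivative can be computed in any preferred chart. -/
theorem DForm.IsSmooth.inChart_d {k : ℕ} {α : DForm I X k} (hα : α.IsSmooth) {x₀ : X} {y : E}
    (hy : y ∈ (extChartAt I x₀).target) :
    α.d.inChart x₀ y = extDeriv (α.inChart x₀) y := by
  set q := (extChartAt I x₀).symm y with hq
  have hqs : (fun x : X => x) q ∈ (extChartAt I q).source := mem_extChartAt_source q
  -- Naturality of the exterior derivative is applied to the identity map, read from the chart at
  -- `x₀` to the chart at `q`: it becomes invariance under a change of charts.
  have h := extDeriv_inChart_pullback (I := I) (I' := I) hα (contMDiff_id (M := X)) hy hqs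
  have h0 : DForm.pullback (I := I) id α = α := DForm.pullback_id α
  rw [h0] at h
  have h2 := tmap_comp_chartD (f := fun x : X => x) (I' := I) hy mdifferentiableAt_id hqs
  have h3 : coordMap I I x₀ q (fun x : X => x) y = extChartAt I q q := rfl
  rw [tmap_id, ContinuousLinearMap.id_comp, h3, chartD_self, ContinuousLinearMap.id_comp] at h2
  rw [h, DForm.inChart_eq, h2]
  rfl

theorem DForm.IsSmooth.d_pullback {k : ℕ} {α : DForm I' X' k} (hα : α.IsSmooth) {f : X → X'}
    (hf : ContMDiff I I' ∞ f) (x : X) :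
    (DForm.pullback (I := I) f α).d x = DForm.pullback (I := I) f α.d x := by
  have hx : (extChartAt I x).symm (extChartAt I x x) = x := extChartAt_to_inv x
  have h := extDeriv_inChart_pullback (I := I) hα hf (mem_extChartAt_target (I := I) x) (x₁ := f x)
    (by rw [hx]; exact mem_extChartAt_source _)
  have h' := tmap_eq_fderiv (I := I) (I' := I') (hf.contMDiffAt.mdifferentiableAt (by simp) (x := x))
  rw [← h'] at h
  have : coordMap I I' x (f x) f (extChartAt I x x) = extChartAt I' (f x) (f x) := by
    simp [coordMap]
  rw [this] at h
  exact h

theorem DForm.IsSmooth.d {k : ℕ} {α : DForm I X k} (hα : α.IsSmooth) : α.d.IsSmooth := by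
  refine DForm.isSmooth_of_contDiffAt fun x₀ y hy => ?_
  have h1 : ContDiffAt ℝ ∞ (extDeriv (α.inChart x₀)) y := by
    have := (hα.contDiffAt hy).fderiv_right (m := ∞) (by simp)
    exact (ContinuousAlternatingMap.alternatizeUncurryFinCLM ℝ E ℝ).contDiff.contDiffAt.comp y this
  refine h1.congr_of_eventuallyEq ?_
  filter_upwards [(isOpen_extChartAt_target (I := I) x₀).mem_nhds hy] with z hz
  exact hα.inChart_d hz

theorem DForm.IsSmooth.d_d {k : ℕ} {α : DForm I X k} (hα : α.IsSmooth) (x : X) : α.d.d x = 0 := by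
  have h : α.d.inChart x =ᶠ[𝓝 (extChartAt I x x)] extDeriv (α.inChart x) := by
    filter_upwards [extChartAt_target_mem_nhds (I := I) x] with z hz
    exact hα.inChart_d hz
  change extDeriv (α.d.inChart x) (extChartAt I x x) = 0
  rw [h.extDeriv_eq]
  exact extDeriv_extDeriv_apply (r := ∞) (hα.contDiffAt (mem_extChartAt_target x))
    two_le_infty

end Charts

end Forms

/-! ### Functions, pointwise operations, low-degree formulas for d, and interior products. -/

section FormAlgebra

variable {E : Type*} [NormedAddCommGroup E] [NormedSpace ℝ E]
  {H : Type*} [TopologicalSpace H] {I : ModelWithCorners ℝ E H}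
  {X : Type*} [TopologicalSpace X] [ChartedSpace H X]
  {E' : Type*} [NormedAddCommGroup E'] [NormedSpace ℝ E']
  {H' : Type*} [TopologicalSpace H'] {I' : ModelWithCorners ℝ E' H'}
  {X' : Type*} [TopologicalSpace X'] [ChartedSpace H' X']

variable [FiniteDimensional ℝ E] [I.Boundaryless] [IsManifold I ∞ X]
  [FiniteDimensional ℝ E'] [I'.Boundaryless] [IsManifold I' ∞ X']

theorem chart_mem_target (x : X) : extChartAt I x x ∈ (extChartAt I x).target :=
  mem_extChartAt_target x

/-! ### Functions -/

theorem IsSmoothFun.contDiffAt {b : X → ℝ} (hb : IsSmoothFun I b) {x₀ : X} {y : E}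
    (hy : y ∈ (extChartAt I x₀).target) :
    ContDiffAt ℝ ∞ (fun z => b ((extChartAt I x₀).symm z)) y := by
  rw [← contMDiffAt_iff_contDiffAt]
  exact ContMDiffAt.comp (I' := I) y hb.contMDiffAt (contMDiffAt_chart_symm hy)

theorem IsSmoothFun.differentiableAt {b : X → ℝ} (hb : IsSmoothFun I b) {x₀ : X} {y : E}
    (hy : y ∈ (extChartAt I x₀).target) :
    DifferentiableAt ℝ (fun z => b ((extChartAt I x₀).symm z)) y :=
  (hb.contDiffAt hy).differentiableAt (by simp)

theorem isSmoothFun_of_contDiffAt {b : X → ℝ}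
    (h : ∀ x : X, ContDiffAt ℝ ∞ (fun z => b ((extChartAt I x).symm z)) (extChartAt I x x)) :
    IsSmoothFun I b := by
  intro x
  have h1 : ContMDiffAt I 𝓘(ℝ, ℝ) ∞ ((fun z => b ((extChartAt I x).symm z)) ∘ extChartAt I x) x :=
    ContMDiffAt.comp (I' := 𝓘(ℝ, E)) x (contMDiffAt_iff_contDiffAt.2 (h x))
      (contMDiffAt_chart (mem_extChartAt_source x))
  refine h1.congr_of_eventuallyEq ?_
  filter_upwards [extChartAt_source_mem_nhds (I := I) x] with z hz
  simp only [Function.comp_apply]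
  rw [(extChartAt I x).left_inv hz]

theorem dFun_eq_fderiv {b : X → ℝ} {x : X} (hb : MDifferentiableAt I 𝓘(ℝ, ℝ) b x) (u : E) :
    dFun I b x u = fderiv ℝ (fun z => b ((extChartAt I x).symm z)) (extChartAt I x x) u := by
  have h := tmap_eq_fderiv (I := I) (I' := 𝓘(ℝ, ℝ)) hb
  exact DFunLike.congr_fun h u

theorem IsSmoothFun.dFun_comp {b : X' → ℝ} (hb : IsSmoothFun I' b) {f : X → X'}
    (hf : ContMDiff I I' ∞ f) (x : X) (u : E) :
    dFun I (fun z => b (f z)) x u = dFun I' b (f x) (tmap I I' f x u) := by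
  have h := mfderiv_comp (I := I) (I' := I') (I'' := 𝓘(ℝ, ℝ)) x
    (hb.mdifferentiableAt (by simp) (x := f x)) (hf.mdifferentiableAt (by simp) (x := x))
  exact DFunLike.congr_fun h u

theorem IsSmoothFun.comp {b : X' → ℝ} (hb : IsSmoothFun I' b) {f : X → X'}
    (hf : ContMDiff I I' ∞ f) : IsSmoothFun I (fun z => b (f z)) :=
  ContMDiff.comp (I' := I') hb hf

/-- A function as a form of degree zero. -/
def DForm.ofFun (I : ModelWithCorners ℝ E H) (b : X → ℝ) : DForm I X 0 := fun x =>
  (ContinuousAlternatingMap.constOfIsEmpty ℝ E (Fin 0) (b x) : E [⋀^Fin 0]→L[ℝ] ℝ)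

theorem IsSmoothFun.ofFun {b : X → ℝ} (hb : IsSmoothFun I b) : (DForm.ofFun I b).IsSmooth :=
  DForm.isSmooth_of_contDiffAt fun _ _ hy => contDiffAt_alt_of_apply fun _ => hb.contDiffAt hy

theorem IsSmoothFun.d_ofFun {b : X → ℝ} (hb : IsSmoothFun I b) (x : X) (u : E) :
    (DForm.ofFun I b).d.val x ![u] = dFun I b x u := by
  rw [DForm.d_val, dFun_eq_fderiv (hb.mdifferentiableAt (by simp))]
  have : (DForm.ofFun I b).inChart x = fun y =>
      ContinuousAlternatingMap.constOfIsEmpty ℝ E (Fin 0) (b ((extChartAt I x).symm y)) := rfl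
  rw [this, extDeriv_constOfIsEmpty]
  rfl

/-! ### Pointwise operations -/

theorem DForm.IsSmooth.add {k : ℕ} {α β : DForm I X k} (hα : α.IsSmooth) (hβ : β.IsSmooth) :
    DForm.IsSmooth (I := I) (fun x => α x + β x) :=
  fun x₀ => (hα x₀).add (hβ x₀)

theorem DForm.IsSmooth.sub {k : ℕ} {α β : DForm I X k} (hα : α.IsSmooth) (hβ : β.IsSmooth) :
    DForm.IsSmooth (I := I) (fun x => α x - β x) :=
  fun x₀ => (hα x₀).sub (hβ x₀)

theorem DForm.IsSmooth.const_smul {k : ℕ} {α : DForm I X k} (hα : α.IsSmooth) (c : ℝ) :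
    DForm.IsSmooth (I := I) (fun x => c • α x) :=
  fun x₀ => (hα x₀).const_smul c

theorem DForm.IsSmooth.fun_smul {k : ℕ} {α : DForm I X k} (hα : α.IsSmooth) {b : X → ℝ}
    (hb : IsSmoothFun I b) : DForm.IsSmooth (I := I) (fun x => b x • α x) :=
  DForm.isSmooth_of_contDiffAt fun _ _ hy => (hb.contDiffAt hy).smul (hα.contDiffAt hy)

theorem DForm.IsSmooth.d_add {k : ℕ} {α β : DForm I X k} (hα : α.IsSmooth) (hβ : β.IsSmooth)
    (x : X) : DForm.d (I := I) (fun x => α x + β x) x = α.d x + β.d x :=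
  extDeriv_add (hα.differentiableAt (chart_mem_target x)) (hβ.differentiableAt (chart_mem_target x))

theorem DForm.d_const_smul {k : ℕ} (α : DForm I X k) (c : ℝ) (x : X) :
    DForm.d (I := I) (fun x => c • α x) x = c • α.d x :=
  extDeriv_smul (x := extChartAt I x x) c (α.inChart x)

theorem DForm.IsSmooth.d_sub {k : ℕ} {α β : DForm I X k} (hα : α.IsSmooth) (hβ : β.IsSmooth)
    (x : X) : DForm.d (I := I) (fun x => α x - β x) x = α.d x - β.d x := by
  have h0 : ∀ {l : ℕ} (A B : E [⋀^Fin l]→L[ℝ] ℝ), A - B = A + (-1 : ℝ) • B := by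
    intro l A B
    ext v
    simp [sub_eq_add_neg]
  have h : (fun x => α x - β x) = fun x => α x + (fun x => (-1 : ℝ) • β x : DForm I X k) x := by
    funext x
    exact h0 (α.val x) (β.val x)
  rw [h, hα.d_add (hβ.const_smul _), DForm.d_const_smul]
  exact (h0 (α.d.val x) (β.d.val x)).symm

/-! ### Formulas for the exterior derivative in low degree -/

theorem extDeriv_one_apply {w : E → E [⋀^Fin 1]→L[ℝ] ℝ} {x : E} (h : DifferentiableAt ℝ w x)
    (u v : E) : extDeriv w x ![u, v] =
      fderiv ℝ (fun y => w y ![v]) x u - fderiv ℝ (fun y => w y ![u]) x v := by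
  rw [extDeriv_apply h]
  have h0 : Fin.removeNth 0 ![u, v] = ![v] := by
    ext1 i; fin_cases i; rfl
  have h1 : Fin.removeNth 1 ![u, v] = ![u] := by
    ext1 i; fin_cases i; rfl
  have key := Fin.sum_univ_two fun i : Fin 2 =>
    (-1 : ℤ) ^ i.val • fderiv ℝ (fun y => w y (i.removeNth ![u, v])) x (![u, v] i)
  simp only [h0, h1] at key
  refine key.trans ?_
  simp [sub_eq_add_neg]

theorem extDeriv_two_apply {w : E → E [⋀^Fin 2]→L[ℝ] ℝ} {x : E} (h : DifferentiableAt ℝ w x)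
    (u v t : E) : extDeriv w x ![u, v, t] =
      fderiv ℝ (fun y => w y ![v, t]) x u - fderiv ℝ (fun y => w y ![u, t]) x v +
        fderiv ℝ (fun y => w y ![u, v]) x t := by
  rw [extDeriv_apply h]
  have h0 : Fin.removeNth 0 ![u, v, t] = ![v, t] := by
    ext1 i; fin_cases i <;> rfl
  have h1 : Fin.removeNth 1 ![u, v, t] = ![u, t] := by
    ext1 i; fin_cases i <;> rfl
  have h2 : Fin.removeNth 2 ![u, v, t] = ![u, v] := by
    ext1 i; fin_cases i <;> rfl
  have key := Fin.sum_univ_three fun i : Fin 3 =>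
    (-1 : ℤ) ^ i.val • fderiv ℝ (fun y => w y (i.removeNth ![u, v, t])) x (![u, v, t] i)
  simp only [h0, h1, h2] at key
  refine key.trans ?_
  simp [sub_eq_add_neg]

theorem extDeriv_three_apply {w : E → E [⋀^Fin 3]→L[ℝ] ℝ} {x : E} (h : DifferentiableAt ℝ w x)
    (s u v t : E) : extDeriv w x ![s, u, v, t] =
      fderiv ℝ (fun y => w y ![u, v, t]) x s - fderiv ℝ (fun y => w y ![s, v, t]) x u +
        fderiv ℝ (fun y => w y ![s, u, t]) x v - fderiv ℝ (fun y => w y ![s, u, v]) x t := by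
  rw [extDeriv_apply h]
  have h0 : Fin.removeNth 0 ![s, u, v, t] = ![u, v, t] := by
    ext1 i; fin_cases i <;> rfl
  have h1 : Fin.removeNth 1 ![s, u, v, t] = ![s, v, t] := by
    ext1 i; fin_cases i <;> rfl
  have h2 : Fin.removeNth 2 ![s, u, v, t] = ![s, u, t] := by
    ext1 i; fin_cases i <;> rfl
  have h3 : Fin.removeNth 3 ![s, u, v, t] = ![s, u, v] := by
    ext1 i; fin_cases i <;> rfl
  have key := Fin.sum_univ_four fun i : Fin 4 =>
    (-1 : ℤ) ^ i.val • fderiv ℝ (fun y => w y (i.removeNth ![s, u, v, t])) x (![s, u, v, t] i)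
  simp only [h0, h1, h2, h3] at key
  refine key.trans ?_
  simp [sub_eq_add_neg]

theorem DForm.IsSmooth.d_fun_smul_one {α : DForm I X 1} (hα : α.IsSmooth) {b : X → ℝ}
    (hb : IsSmoothFun I b) (x : X) (u v : E) :
    DForm.val (DForm.d (I := I) (fun x => b x • α x)) x ![u, v] =
      dFun I b x u * α.val x ![v] - dFun I b x v * α.val x ![u] + b x * α.d.val x ![u, v] := by
  have hx : (extChartAt I x).symm (extChartAt I x x) = x := extChartAt_to_inv x
  rw [DForm.d_val, DForm.d_val, extDeriv_one_apply ((hα.fun_smul hb).differentiableAt (chart_mem_target x)),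
    extDeriv_one_apply (hα.differentiableAt (chart_mem_target x)),
    dFun_eq_fderiv (hb.mdifferentiableAt (by simp)), dFun_eq_fderiv (hb.mdifferentiableAt (by simp)),
    ← DForm.inChart_self]
  have h1 := hb.differentiableAt (chart_mem_target (I := I) x)
  have h2 : ∀ w : Fin 1 → E, DifferentiableAt ℝ (fun y => α.inChart x y w) (extChartAt I x x) := fun w =>
    (contDiffAt_alt_apply (v := fun _ => w) (hα.contDiffAt (chart_mem_target x)) fun _ =>
      contDiffAt_const).differentiableAt (by simp)
  have h3 : ∀ w : Fin 1 → E, (fun y => DForm.inChart (I := I) (fun x => b x • α x) x y w) =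
      fun y => b ((extChartAt I x).symm y) * α.inChart x y w := fun w => rfl
  rw [h3, h3, fderiv_fun_mul h1 (h2 _), fderiv_fun_mul h1 (h2 _)]
  simp only [hx, add_apply, smul_apply, smul_eq_mul]
  ring

/-! ### Interior products -/

/-- The value of a vector field, as a vector of the model space. -/
def fieldAt (V : (x : X) → TangentSpace I x) (x : X) : E := V x

/-- The expression of a vector field in the preferred chart at `x₀`. -/
def fieldCoord (V : (x : X) → TangentSpace I x) (x₀ : X) (y : E) : E :=
  tmap I 𝓘(ℝ, E) (extChartAt I x₀) ((extChartAt I x₀).symm y) (V ((extChartAt I x₀).symm y))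

theorem chartD_fieldCoord (V : (x : X) → TangentSpace I x) {x₀ : X} {y : E}
    (hy : y ∈ (extChartAt I x₀).target) :
    chartD I x₀ y (fieldCoord V x₀ y) = fieldAt V ((extChartAt I x₀).symm y) := by
  have h := chartD_comp_tmap_chart (I := I) ((extChartAt I x₀).map_target hy)
  rw [(extChartAt I x₀).right_inv hy] at h
  exact DFunLike.congr_fun h _

theorem fieldCoord_self (V : (x : X) → TangentSpace I x) (x : X) :
    fieldCoord V x (extChartAt I x x) = fieldAt V x := by
  unfold fieldCoord
  rw [extChartAt_to_inv, tmap_chart_self]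
  rfl

theorem DForm.inChart_contract {k : ℕ} (V : (x : X) → TangentSpace I x) (α : DForm I X (k + 1))
    {x₀ : X} {y : E} (hy : y ∈ (extChartAt I x₀).target) :
    (DForm.contract V α).inChart x₀ y = (α.inChart x₀ y).curryLeft (fieldCoord V x₀ y) := by
  rw [DForm.inChart_eq, DForm.inChart_eq, ContinuousAlternatingMap.curryLeft_compContinuousLinearMap,
    chartD_fieldCoord V hy]
  rfl

theorem DForm.IsSmooth.contract {k : ℕ} {V : (x : X) → TangentSpace I x} {α : DForm I X (k + 1)}
    (hα : α.IsSmooth)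
    (hV : ∀ x₀, ∀ y ∈ (extChartAt I x₀).target, ContDiffAt ℝ ∞ (fieldCoord V x₀) y) :
    (DForm.contract V α).IsSmooth := by
  refine DForm.isSmooth_of_contDiffAt fun x₀ y hy => ?_
  have h1 : ContDiffAt ℝ ∞ (fun z => (α.inChart x₀ z).curryLeft (fieldCoord V x₀ z)) y := by
    refine contDiffAt_alt_of_apply fun v => ?_
    refine contDiffAt_alt_apply (v := fun z => Matrix.vecCons (fieldCoord V x₀ z) v)
      (hα.contDiffAt hy) fun i => ?_
    refine Fin.cases ?_ (fun i => ?_) i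
    · exact hV x₀ y hy
    · exact contDiffAt_const
  refine h1.congr_of_eventuallyEq ?_
  filter_upwards [(isOpen_extChartAt_target (I := I) x₀).mem_nhds hy] with z hz
  exact DForm.inChart_contract V α hz

end FormAlgebra

/-! ### Linear algebra of orthonormal frames and volume forms. -/

section Frames

variable {V : Type*} [NormedAddCommGroup V] [NormedSpace ℝ V] [FiniteDimensional ℝ V]

/-- Symmetric positive definite bilinear forms. -/
structure IsInner (B : V →L[ℝ] V →L[ℝ] ℝ) : Prop where
  symm : ∀ v w, B v w = B w v
  pos : ∀ v, v ≠ 0 → 0 < B v v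

/-- Orthonormal families for the bilinear form `B`. -/
def IsOrthonormal (B : V →L[ℝ] V →L[ℝ] ℝ) {m : ℕ} (e : Fin m → V) : Prop :=
  ∀ i j, B (e i) (e j) = if i = j then 1 else 0

variable {B : V →L[ℝ] V →L[ℝ] ℝ}

theorem IsInner.exists_isOrthonormal (hB : IsInner B) {m : ℕ} (hm : Module.finrank ℝ V = m) :
    ∃ e : Fin m → V, IsOrthonormal B e := by
  subst hm
  let B' : LinearMap.BilinForm ℝ V := LinearMap.mk₂ ℝ (fun v w => B v w) (by simp) (by simp)
    (by simp) (by simp)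
  have hs : LinearMap.IsSymm B' := ⟨fun v w => hB.symm v w⟩
  obtain ⟨b, hb⟩ := LinearMap.BilinForm.exists_orthogonal_basis (B := B') hs
  refine ⟨fun i => (Real.sqrt (B (b i) (b i)))⁻¹ • b i, fun i j => ?_⟩
  have hp := hB.pos (b i) (b.ne_zero i)
  have hi : (B (b i) (b i)) ≠ 0 := hp.ne'
  split_ifs with h
  · subst h
    simp only [map_smul, smul_apply, smul_eq_mul]
    have := Real.mul_self_sqrt hp.le
    have h0 := (Real.sqrt_pos.2 hp).ne'
    field_simp
    rw [sq, this]
  · have h1 : B (b i) (b j) = 0 := by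
      have := hb h
      exact this
    simp [h1]

theorem IsOrthonormal.linearIndependent {m : ℕ} {e : Fin m → V} (he : IsOrthonormal B e) :
    LinearIndependent ℝ e := by
  rw [Fintype.linearIndependent_iff]
  intro c hc i
  have h : B (∑ j, c j • e j) (e i) = 0 := by rw [hc]; simp
  simpa [he _ i] using h

/-- The basis given by an orthonormal family of maximal length. -/
def IsOrthonormal.basis {m : ℕ} {e : Fin m → V} (he : IsOrthonormal B e)
    (hm : Module.finrank ℝ V = m) : Module.Basis (Fin m) ℝ V :=
  basisOfLinearIndependentOfCardEqFinrank' e he.linearIndependent (by simp [hm])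

theorem IsOrthonormal.coe_basis {m : ℕ} {e : Fin m → V} (he : IsOrthonormal B e)
    (hm : Module.finrank ℝ V = m) : ⇑(he.basis hm) = e := by
  simp [IsOrthonormal.basis]

theorem IsOrthonormal.basis_repr {m : ℕ} {e : Fin m → V} (he : IsOrthonormal B e)
    (hm : Module.finrank ℝ V = m) (v : V) (i : Fin m) : (he.basis hm).repr v i = B v (e i) := by
  have h := (he.basis hm).sum_repr v
  rw [he.coe_basis hm] at h
  conv_rhs => rw [← h]
  simp [he _ i]

theorem IsOrthonormal.sum_eq {m : ℕ} {e : Fin m → V} (he : IsOrthonormal B e)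
    (hm : Module.finrank ℝ V = m) (v : V) : v = ∑ i, B v (e i) • e i := by
  have h := (he.basis hm).sum_repr v
  simp only [he.basis_repr hm, he.coe_basis hm] at h
  exact h.symm

/-- A form of top degree is a multiple of the determinant in any basis, and coordinates in an
orthonormal basis are inner products. -/
theorem IsOrthonormal.alt_apply {m : ℕ} {e : Fin m → V} (he : IsOrthonormal B e)
    (hm : Module.finrank ℝ V = m) (w : V [⋀^Fin m]→L[ℝ] ℝ) (v : Fin m → V) :
    w v = w e * (Matrix.of fun i j => B (v i) (e j)).det := by
  have h := AlternatingMap.eq_smul_basis_det (he.basis hm) w.toAlternatingMap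
  have h1 := DFunLike.congr_fun h v
  rw [AlternatingMap.smul_apply, Module.Basis.det_apply, ← Matrix.det_transpose, he.coe_basis hm] at h1
  refine h1.trans ?_
  rw [smul_eq_mul]
  have h2 : ((he.basis hm).toMatrix v).transpose = Matrix.of fun i j => B (v i) (e j) := by
    ext i j
    simp [Module.Basis.toMatrix_apply, he.basis_repr hm]
  rw [h2]
  rfl

theorem IsOrthonormal.alt_eq_zero {m : ℕ} {e : Fin m → V} (he : IsOrthonormal B e)
    (hm : Module.finrank ℝ V = m) (w : V [⋀^Fin m]→L[ℝ] ℝ) (h : w e = 0) : w = 0 := by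
  ext v
  rw [he.alt_apply hm, h, zero_mul]
  rfl

theorem alt_eq_zero_of_finrank_lt {m : ℕ} (hm : Module.finrank ℝ V < m)
    (w : V [⋀^Fin m]→L[ℝ] ℝ) : w = 0 := by
  ext v
  refine w.toAlternatingMap.map_linearDependent v fun h => ?_
  have := h.fintype_card_le_finrank
  simp only [Fintype.card_fin] at this
  omega

/-- The product of two values of a volume form is a Gram determinant. -/
theorem IsOrthonormal.alt_mul {m : ℕ} {e : Fin m → V}
    (he : IsOrthonormal B e) (hm : Module.finrank ℝ V = m) (w : V [⋀^Fin m]→L[ℝ] ℝ)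
    (hw : w e = 1 ∨ w e = -1) (v v' : Fin m → V) :
    w v * w v' = (Matrix.of fun i j => B (v i) (v' j)).det := by
  rw [he.alt_apply hm w v, he.alt_apply hm w v']
  -- The Gram matrix factors through the coordinates of the two families in the frame; the remaining
  -- factor is the square of `w e = ±1`.
  have h1 : (Matrix.of fun i j => B (v i) (v' j)) = (Matrix.of fun i j => B (v i) (e j)) *
      (Matrix.of fun i j => B (v' i) (e j)).transpose := by
    ext i j
    rw [Matrix.mul_apply]
    conv_lhs => rw [Matrix.of_apply, he.sum_eq hm (v' j), map_sum]
    refine Finset.sum_congr rfl fun k _ => ?_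
    rw [map_smul, smul_eq_mul, mul_comm]
    rfl
  rw [h1, Matrix.det_mul, Matrix.det_transpose]
  have h2 : w e * w e = 1 := by rcases hw with h | h <;> rw [h] <;> norm_num
  linear_combination ((Matrix.of fun i j => B (v i) (e j)).det *
    (Matrix.of fun i j => B (v' i) (e j)).det) * h2

/-- The value of a volume form on three vectors, squared. -/
theorem alt_sq_three (hB : IsInner B) (hm : Module.finrank ℝ V = 3) (w : V [⋀^Fin 3]→L[ℝ] ℝ)
    (hw : ∀ e : Fin 3 → V, IsOrthonormal B e → w e = 1 ∨ w e = -1) (a b c : V) :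
    w ![a, b, c] ^ 2 = B a a * B b b * B c c - B a a * B b c * B c b - B a b * B b a * B c c
      + B a b * B b c * B c a + B a c * B b a * B c b - B a c * B b b * B c a := by
  obtain ⟨e, he⟩ := hB.exists_isOrthonormal hm
  rw [sq, he.alt_mul hm w (hw e he), Matrix.det_fin_three]
  simp

theorem IsOrthonormal.three {a b c : V} (hB : IsInner B) (haa : B a a = 1) (hbb : B b b = 1)
    (hcc : B c c = 1) (hab : B a b = 0) (hac : B a c = 0) (hbc : B b c = 0) :
    IsOrthonormal B ![a, b, c] := by
  have h1 := hB.symm a b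
  have h2 := hB.symm a c
  have h3 := hB.symm b c
  intro i j
  fin_cases i <;> fin_cases j <;> simp <;> linarith

/-- In the matrix of coordinates the two unchanged rows are rows of the identity, so only the
component along the replaced vector survives. -/
theorem IsOrthonormal.alt_first {a b c : V} (he : IsOrthonormal B ![a, b, c])
    (hm : Module.finrank ℝ V = 3) (w : V [⋀^Fin 3]→L[ℝ] ℝ) (v : V) :
    w ![v, b, c] = B v a * w ![a, b, c] := by
  rw [he.alt_apply hm w ![v, b, c], Matrix.det_fin_three]
  have h := fun i j => he i j
  have h10 := h 1 0
  have h11 := h 1 1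
  have h12 := h 1 2
  have h20 := h 2 0
  have h21 := h 2 1
  have h22 := h 2 2
  simp at h10 h11 h12 h20 h21 h22 ⊢
  rw [h10, h11, h12, h20, h21, h22]
  ring

theorem IsOrthonormal.alt_second {a b c : V} (he : IsOrthonormal B ![a, b, c])
    (hm : Module.finrank ℝ V = 3) (w : V [⋀^Fin 3]→L[ℝ] ℝ) (v : V) :
    w ![a, v, c] = B v b * w ![a, b, c] := by
  rw [he.alt_apply hm w ![a, v, c], Matrix.det_fin_three]
  have h := fun i j => he i j
  have h10 := h 0 0
  have h11 := h 0 1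
  have h12 := h 0 2
  have h20 := h 2 0
  have h21 := h 2 1
  have h22 := h 2 2
  simp at h10 h11 h12 h20 h21 h22 ⊢
  rw [h10, h11, h12, h20, h21, h22]
  ring

theorem IsOrthonormal.alt_third {a b c : V} (he : IsOrthonormal B ![a, b, c])
    (hm : Module.finrank ℝ V = 3) (w : V [⋀^Fin 3]→L[ℝ] ℝ) (v : V) :
    w ![a, b, v] = B v c * w ![a, b, c] := by
  rw [he.alt_apply hm w ![a, b, v], Matrix.det_fin_three]
  have h := fun i j => he i j
  have h10 := h 0 0
  have h11 := h 0 1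
  have h12 := h 0 2
  have h20 := h 1 0
  have h21 := h 1 1
  have h22 := h 1 2
  simp at h10 h11 h12 h20 h21 h22 ⊢
  rw [h10, h11, h12, h20, h21, h22]
  ring

section Alternating

variable {W : Type*} [NormedAddCommGroup W] [NormedSpace ℝ W]

theorem alt_three_swap₀₁ (w : W [⋀^Fin 3]→L[ℝ] ℝ) (a b c : W) : w ![a, b, c] = -w ![b, a, c] := by
  have h := w.toAlternatingMap.map_swap ![b, a, c] (i := 0) (j := 1) (by decide)
  have h1 : ![b, a, c] ∘ Equiv.swap (0 : Fin 3) 1 = ![a, b, c] := by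
    funext i; fin_cases i <;> rfl
  rw [h1] at h
  exact h

theorem alt_three_swap₁₂ (w : W [⋀^Fin 3]→L[ℝ] ℝ) (a b c : W) : w ![a, b, c] = -w ![a, c, b] := by
  have h := w.toAlternatingMap.map_swap ![a, c, b] (i := 1) (j := 2) (by decide)
  have h1 : ![a, c, b] ∘ Equiv.swap (1 : Fin 3) 2 = ![a, b, c] := by
    funext i; fin_cases i <;> rfl
  rw [h1] at h
  exact h

theorem alt_two_swap (w : W [⋀^Fin 2]→L[ℝ] ℝ) (a b : W) : w ![a, b] = -w ![b, a] := by
  have h := w.toAlternatingMap.map_swap ![b, a] (i := 0) (j := 1) (by decide)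
  have h1 : ![b, a] ∘ Equiv.swap (0 : Fin 2) 1 = ![a, b] := by
    funext i; fin_cases i <;> rfl
  rw [h1] at h
  exact h

theorem alt_three_self₀₁ (w : W [⋀^Fin 3]→L[ℝ] ℝ) (a c : W) : w ![a, a, c] = 0 := by
  have := alt_three_swap₀₁ w a a c
  linarith

theorem alt_three_self₁₂ (w : W [⋀^Fin 3]→L[ℝ] ℝ) (a c : W) : w ![a, c, c] = 0 := by
  have := alt_three_swap₁₂ w a c c
  linarith

theorem alt_three_self₀₂ (w : W [⋀^Fin 3]→L[ℝ] ℝ) (a c : W) : w ![a, c, a] = 0 := by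
  rw [alt_three_swap₁₂, alt_three_self₀₁, neg_zero]

theorem alt_three_comb₀ (w : W [⋀^Fin 3]→L[ℝ] ℝ) (r s t : ℝ) (a b c y z : W) :
    w ![r • a + s • b + t • c, y, z] =
      r * w ![a, y, z] + s * w ![b, y, z] + t * w ![c, y, z] := by
  have h : ∀ x, w ![x, y, z] = w.curryLeft x ![y, z] := fun x => rfl
  simp only [h, map_add, map_smul, ContinuousAlternatingMap.add_apply,
    ContinuousAlternatingMap.smul_apply, smul_eq_mul]

theorem alt_three_comb₁ (w : W [⋀^Fin 3]→L[ℝ] ℝ) (r s t : ℝ) (a b c y z : W) :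
    w ![y, r • a + s • b + t • c, z] =
      r * w ![y, a, z] + s * w ![y, b, z] + t * w ![y, c, z] := by
  rw [alt_three_swap₀₁, alt_three_comb₀, alt_three_swap₀₁ w y a, alt_three_swap₀₁ w y b,
    alt_three_swap₀₁ w y c]
  ring

end Alternating

end Frames

/-- The model space of 3-manifolds. -/
abbrev E3 : Type := EuclideanSpace ℝ (Fin 3)

/-! ### Charts of the tangent bundle; the metric and vector fields in charts. -/

section TangentCharts

variable {M : Type*} [TopologicalSpace M] [ChartedSpace (EuclideanSpace ℝ (Fin 3)) M]
  [IsManifold (𝓡 3) ∞ M]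

theorem tangent_chart_apply (p q : TM M) (hq : q.1 ∈ (extChartAt (𝓡 3) p.1).source) :
    extChartAt (𝓡 3).tangent p q =
      (extChartAt (𝓡 3) p.1 q.1, tmap (𝓡 3) 𝓘(ℝ, E3) (extChartAt (𝓡 3) p.1) q.1 q.2) := by
  have h1 : extChartAt (𝓡 3).tangent p q = (extChartAt (𝓡 3) p.1 q.1,
      (trivializationAt E3 (TangentSpace (𝓡 3)) p.1 q).2) := rfl
  have h2 := tmap_eq_fderiv (I := 𝓡 3) (I' := 𝓘(ℝ, E3))
    ((contMDiffAt_chart (I := 𝓡 3) hq).mdifferentiableAt (by simp))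
  rw [h1, TangentBundle.trivializationAt_apply, h2, ModelWithCorners.range_eq_univ,
    fderivWithin_univ]
  rfl

theorem tangent_chart_source (p q : TM M) :
    q ∈ (extChartAt (𝓡 3).tangent p).source ↔ q.1 ∈ (extChartAt (𝓡 3) p.1).source := by
  rw [extChartAt_source, extChartAt_source, TangentBundle.mem_chart_source_iff]

theorem tangent_chart_target (p : TM M) (y : E3 × E3) :
    y ∈ (extChartAt (𝓡 3).tangent p).target ↔ y.1 ∈ (extChartAt (𝓡 3) p.1).target := by
  rw [FiberBundle.extChartAt_target]
  simp only [mem_prod, mem_inter_iff, mem_preimage, mem_univ, and_true,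
    TangentBundle.trivializationAt_baseSet, and_iff_left_iff_imp]
  intro h
  have := (extChartAt (𝓡 3) p.1).map_target h
  rwa [extChartAt_source] at this

/-- The chart maps the proposed point to `y`, and it is injective on its source. -/
theorem tangent_chart_symm (p : TM M) (y : E3 × E3) (hy : y.1 ∈ (extChartAt (𝓡 3) p.1).target) :
    (extChartAt (𝓡 3).tangent p).symm y =
      ⟨(extChartAt (𝓡 3) p.1).symm y.1, chartD (𝓡 3) p.1 y.1 y.2⟩ := by
  set q : TM M := ⟨(extChartAt (𝓡 3) p.1).symm y.1, chartD (𝓡 3) p.1 y.1 y.2⟩ with hq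
  have h1 : q.1 ∈ (extChartAt (𝓡 3) p.1).source := (extChartAt (𝓡 3) p.1).map_target hy
  have h2 : extChartAt (𝓡 3).tangent p q = y := by
    rw [tangent_chart_apply p q h1]
    refine Prod.ext ((extChartAt (𝓡 3) p.1).right_inv hy) ?_
    exact DFunLike.congr_fun (tmap_chart_comp_chartD hy) y.2
  rw [← h2]
  exact (extChartAt (𝓡 3).tangent p).left_inv ((tangent_chart_source p q).2 h1)

theorem tangent_chart_symm_fst (p : TM M) (y : E3 × E3)
    (hy : y.1 ∈ (extChartAt (𝓡 3) p.1).target) :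
    ((extChartAt (𝓡 3).tangent p).symm y).1 = (extChartAt (𝓡 3) p.1).symm y.1 := by
  rw [tangent_chart_symm p y hy]

/-- The fibre component of a point of the tangent bundle, as a vector of the model space. -/
def fib (p : TM M) : E3 := p.2

/-- The coordinates of a point of the tangent bundle in its preferred chart. -/
def ctr (p : TM M) : E3 × E3 := (extChartAt (𝓡 3) p.1 p.1, fib p)

theorem ctr_fst (p : TM M) : (ctr p).1 = extChartAt (𝓡 3) p.1 p.1 := rfl

theorem ctr_snd (p : TM M) : (ctr p).2 = fib p := rfl

theorem tangent_chart_self (p : TM M) : extChartAt (𝓡 3).tangent p p = ctr p := by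
  rw [tangent_chart_apply p p (mem_extChartAt_source _), tmap_chart_self]
  rfl

theorem contMDiff_tangent_proj : ContMDiff (𝓡 3).tangent (𝓡 3) ∞ (proj (M := M)) :=
  contMDiff_proj _

theorem coordMap_proj (p : TM M) (y : E3 × E3) (hy : y.1 ∈ (extChartAt (𝓡 3) p.1).target) :
    coordMap (𝓡 3).tangent (𝓡 3) p p.1 (proj (M := M)) y = y.1 := by
  unfold coordMap proj
  rw [tangent_chart_symm_fst p y hy, (extChartAt (𝓡 3) p.1).right_inv hy]

theorem eventually_fst_mem (p : TM M) (y : E3 × E3) (hy : y.1 ∈ (extChartAt (𝓡 3) p.1).target) :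
    ∀ᶠ z : E3 × E3 in 𝓝 y, z.1 ∈ (extChartAt (𝓡 3) p.1).target :=
  continuous_fst.continuousAt ((isOpen_extChartAt_target (I := 𝓡 3) p.1).mem_nhds hy)

theorem fderiv_coordMap_proj (p : TM M) (y : E3 × E3)
    (hy : y.1 ∈ (extChartAt (𝓡 3) p.1).target) :
    fderiv ℝ (coordMap (𝓡 3).tangent (𝓡 3) p p.1 (proj (M := M))) y =
      ContinuousLinearMap.fst ℝ E3 E3 := by
  have h : coordMap (𝓡 3).tangent (𝓡 3) p p.1 (proj (M := M)) =ᶠ[𝓝 y] Prod.fst := by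
    filter_upwards [eventually_fst_mem p y hy] with z hz
    exact coordMap_proj p z hz
  rw [h.fderiv_eq, fderiv_fst]

theorem proj_symm_mem (p : TM M) (y : E3 × E3) (hy : y.1 ∈ (extChartAt (𝓡 3) p.1).target) :
    proj ((extChartAt (𝓡 3).tangent p).symm y) ∈ (extChartAt (𝓡 3) p.1).source := by
  unfold proj
  rw [tangent_chart_symm_fst p y hy]
  exact (extChartAt (𝓡 3) p.1).map_target hy

theorem tmap_proj_chartD (p : TM M) (y : E3 × E3) (hy : y.1 ∈ (extChartAt (𝓡 3) p.1).target)
    (v : E3 × E3) :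
    tmap (𝓡 3).tangent (𝓡 3) (proj (M := M)) ((extChartAt (𝓡 3).tangent p).symm y)
      (chartD (𝓡 3).tangent p y v) = chartD (𝓡 3) p.1 y.1 v.1 := by
  have h := tmap_comp_chartD (I := (𝓡 3).tangent) (I' := 𝓡 3) (f := proj (M := M)) (x₁ := p.1)
    ((tangent_chart_target p y).2 hy)
    (contMDiff_tangent_proj.contMDiffAt.mdifferentiableAt (by simp)) (proj_symm_mem p y hy)
  rw [fderiv_coordMap_proj p y hy, coordMap_proj p y hy] at h
  exact DFunLike.congr_fun h v

theorem tmap_proj (p : TM M) (v : E3 × E3) :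
    tmap (𝓡 3).tangent (𝓡 3) (proj (M := M)) p v = v.1 := by
  rw [tmap_eq_fderiv (contMDiff_tangent_proj.contMDiffAt.mdifferentiableAt (by simp))]
  have h := fderiv_coordMap_proj p (extChartAt (𝓡 3).tangent p p)
    (by rw [tangent_chart_self]; exact mem_extChartAt_target _)
  exact DFunLike.congr_fun h v

theorem pullback_proj_val {k : ℕ} (β : DForm (𝓡 3) M k) (p : TM M) (v : Fin k → E3 × E3) :
    (DForm.pullback (I := (𝓡 3).tangent) (proj (M := M)) β).val p v =
      β.val p.1 (fun i => (v i).1) := by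
  rw [DForm.pullback_val, ContinuousAlternatingMap.compContinuousLinearMap_apply]
  congr 1
  funext i
  exact tmap_proj p (v i)

/-! ### The metric in charts -/

/-- The metric in the preferred chart at `x₀`. -/
def metricCoord (g : Metric M) (x₀ : M) (z : E3) : E3 →L[ℝ] E3 →L[ℝ] ℝ :=
  ContinuousLinearMap.bilinearComp (E := E3) (F := E3) (G := ℝ) (E' := E3) (F' := E3)
    (g.inner ((extChartAt (𝓡 3) x₀).symm z)) (chartD (𝓡 3) x₀ z) (chartD (𝓡 3) x₀ z)

/-- The metric at a point, as a bilinear form on the model space. -/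
def metricAt (g : Metric M) (x : M) : E3 →L[ℝ] E3 →L[ℝ] ℝ := g.inner x

theorem isInner_metricAt (g : Metric M) (x : M) : IsInner (metricAt g x) :=
  ⟨fun v w => g.symm x v w, fun v hv => g.pos x v hv⟩

theorem metricCoord_apply (g : Metric M) (x₀ : M) (z b c : E3) :
    metricCoord g x₀ z b c = metricAt g ((extChartAt (𝓡 3) x₀).symm z)
      (chartD (𝓡 3) x₀ z b) (chartD (𝓡 3) x₀ z c) := rfl

theorem metricCoord_self (g : Metric M) (x : M) :
    metricCoord g x (extChartAt (𝓡 3) x x) = metricAt g x := by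
  ext b c
  rw [metricCoord_apply, chartD_self, extChartAt_to_inv]
  rfl

theorem isInner_metricCoord (g : Metric M) (x₀ : M) {z : E3}
    (hz : z ∈ (extChartAt (𝓡 3) x₀).target) : IsInner (metricCoord g x₀ z) := by
  refine ⟨fun v w => (isInner_metricAt g _).symm _ _, fun v hv => (isInner_metricAt g _).pos _ ?_⟩
  intro h
  apply hv
  have h1 := DFunLike.congr_fun (tmap_chart_comp_chartD (I := 𝓡 3) hz) v
  have h2 : chartD (𝓡 3) x₀ z v = 0 := h
  rw [ContinuousLinearMap.comp_apply, h2, map_zero] at h1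
  exact h1.symm

/-- The constant field `b` of a chart is the inverse chart of TM applied to `(y, b)`. Evaluating the
metric on two such fields gives smoothness of its coefficients. -/
theorem contMDiffAt_coordinate_field (x₀ : M) {z : E3} (hz : z ∈ (extChartAt (𝓡 3) x₀).target)
    (b : E3) : ContMDiffAt 𝓘(ℝ, E3) (𝓡 3).tangent ∞
      (fun y => (⟨(extChartAt (𝓡 3) x₀).symm y, chartD (𝓡 3) x₀ y b⟩ : TM M)) z := by
  -- Any point over `x₀` would do: the chart of TM depends only on the base point.
  let p : TM M := ⟨x₀, 0⟩
  have h1 : ContMDiffAt 𝓘(ℝ, E3) 𝓘(ℝ, E3 × E3) ∞ (fun y : E3 => (y, b)) z :=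
    contMDiffAt_iff_contDiffAt.2 (contDiffAt_id.prodMk contDiffAt_const)
  have h2 : ContMDiffAt 𝓘(ℝ, E3 × E3) (𝓡 3).tangent ∞ (extChartAt (𝓡 3).tangent p).symm (z, b) :=
    contMDiffAt_chart_symm ((tangent_chart_target p (z, b)).2 hz)
  refine (ContMDiffAt.comp (I' := 𝓘(ℝ, E3 × E3)) z h2 h1).congr_of_eventuallyEq ?_
  filter_upwards [(isOpen_extChartAt_target (I := 𝓡 3) x₀).mem_nhds hz] with y hy
  exact (tangent_chart_symm p (y, b) hy).symm

theorem contDiffAt_metricCoord (g : Metric M) (x₀ : M) {z : E3}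
    (hz : z ∈ (extChartAt (𝓡 3) x₀).target) : ContDiffAt ℝ ∞ (metricCoord g x₀) z := by
  refine contDiffAt_clm_of_apply fun b => contDiffAt_clm_of_apply fun c => ?_
  rw [← contMDiffAt_iff_contDiffAt]
  have h0 := ContMDiffAt.comp (I' := 𝓡 3) z g.contMDiff.contMDiffAt (contMDiffAt_chart_symm hz)
  have h := ContMDiffAt.clm_bundle_apply₂ (F₁ := E3) (F₂ := E3) (F₃ := ℝ)
    (E₃ := Bundle.Trivial M ℝ) h0
    (contMDiffAt_coordinate_field x₀ hz b) (contMDiffAt_coordinate_field x₀ hz c)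
  simp only [contMDiffAt_totalSpace] at h
  exact h.2

theorem metricDeriv_eq (g : Metric M) (x : M) (a b c : E3) :
    metricDeriv g x a b c =
      fderiv ℝ (fun z => metricCoord g x z b c) (extChartAt (𝓡 3) x x) a := rfl

/-! ### Vector fields in charts -/

theorem IsSmoothField.contDiffAt_fieldCoord {S : (x : M) → T3 x} (hS : IsSmoothField S) (x₀ : M)
    {z : E3} (hz : z ∈ (extChartAt (𝓡 3) x₀).target) : ContDiffAt ℝ ∞ (fieldCoord S x₀) z := by
  let p : TM M := ⟨x₀, 0⟩
  rw [← contMDiffAt_iff_contDiffAt]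
  have hsrc : ((extChartAt (𝓡 3) x₀).symm z) ∈ (extChartAt (𝓡 3) x₀).source :=
    (extChartAt (𝓡 3) x₀).map_target hz
  have h1 : ContMDiffAt 𝓘(ℝ, E3) 𝓘(ℝ, E3 × E3) ∞
      (coordMap (𝓡 3) (𝓡 3).tangent x₀ p (fun x => (⟨x, S x⟩ : TM M))) z :=
    contMDiffAt_iff_contDiffAt.2 (contDiffAt_coordMap hz hS.contMDiffAt
      ((tangent_chart_source p _).2 hsrc))
  have h2 := contDiffAt_snd.comp z (contMDiffAt_iff_contDiffAt.1 h1)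
  rw [contMDiffAt_iff_contDiffAt]
  refine h2.congr_of_eventuallyEq ?_
  filter_upwards [(isOpen_extChartAt_target (I := 𝓡 3) x₀).mem_nhds hz] with y hy
  simp only [Function.comp_apply, coordMap]
  rw [tangent_chart_apply p _ ((extChartAt (𝓡 3) x₀).map_target hy)]
  rfl

/-- The extension of a vector field, as a vector of the model space. -/
def extensionVec (S : (x : M) → T3 x) (p : TM M) : E3 × E3 := extension S p

theorem extension_fst (S : (x : M) → T3 x) (p : TM M) :
    (extensionVec S p).1 = fieldAt S p.1 := rfl

/-- In charts the section S is `z ↦ (z, fieldCoord S p.1 z)`, so the fibre component of its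
derivative is the ordinary derivative of its coordinate expression. -/
theorem extension_snd {S : (x : M) → T3 x} (hS : IsSmoothField S) (p : TM M) :
    (extensionVec S p).2 =
      fderiv ℝ (fieldCoord S p.1) (extChartAt (𝓡 3) p.1 p.1) (fib p) := by
  have h1 := tmap_eq_fderiv (I := 𝓡 3) (I' := (𝓡 3).tangent)
    (hS.contMDiffAt.mdifferentiableAt (by simp) (x := p.1))
  have h2 : coordMap (𝓡 3) (𝓡 3).tangent p.1 (⟨p.1, S p.1⟩ : TM M) (fun x => (⟨x, S x⟩ : TM M))
      =ᶠ[𝓝 (extChartAt (𝓡 3) p.1 p.1)] fun z => (z, fieldCoord S p.1 z) := by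
    filter_upwards [extChartAt_target_mem_nhds (I := 𝓡 3) p.1] with y hy
    unfold coordMap
    rw [tangent_chart_apply _ _ ((extChartAt (𝓡 3) p.1).map_target hy)]
    exact Prod.ext ((extChartAt (𝓡 3) p.1).right_inv hy) rfl
  rw [h2.fderiv_eq, DifferentiableAt.fderiv_prodMk differentiableAt_fun_id
    ((hS.contDiffAt_fieldCoord p.1 (mem_extChartAt_target _)).differentiableAt (by simp))] at h1
  have h3 : (extensionVec S p).2 = (tmap (𝓡 3) (𝓡 3).tangent
    (fun x => (⟨x, S x⟩ : TM M)) p.1 p.2).2 := rfl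
  rw [h3, h1]
  rfl

end TangentCharts

/-! ### Coordinate expressions and smoothness of the forms on TM. -/

section Coordinates

variable {M : Type*} [TopologicalSpace M] [ChartedSpace (EuclideanSpace ℝ (Fin 3)) M]
  [IsManifold (𝓡 3) ∞ M]

/-! ### Coordinate expressions on the tangent bundle -/

theorem contactForm_inChart (g : Metric M) (p : TM M) (y : E3 × E3)
    (hy : y.1 ∈ (extChartAt (𝓡 3) p.1).target) (v : E3 × E3) :
    (contactForm g).inChart p y ![v] = metricCoord g p.1 y.1 y.2 v.1 := by
  have h1 : (contactForm g).inChart p y ![v] =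
      metricAt g ((extChartAt (𝓡 3).tangent p).symm y).1 ((extChartAt (𝓡 3).tangent p).symm y).2
        (tmap (𝓡 3).tangent (𝓡 3) (proj (M := M)) ((extChartAt (𝓡 3).tangent p).symm y)
          (chartD (𝓡 3).tangent p y v)) := rfl
  rw [h1, tmap_proj_chartD p y hy, tangent_chart_symm p y hy]
  rfl

theorem contactForm_val (g : Metric M) (p : TM M) (v : E3 × E3) :
    (contactForm g).val p ![v] = metricAt g p.1 (fib p) v.1 := by
  have h1 : (contactForm g).val p ![v] = metricAt g p.1 (fib p)
        (tmap (𝓡 3).tangent (𝓡 3) (proj (M := M)) p v) := rfl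
  rw [h1, tmap_proj]

theorem lagrangianArea_inChart (vol : DForm (𝓡 3) M 3) (p : TM M) (y : E3 × E3)
    (hy : y.1 ∈ (extChartAt (𝓡 3) p.1).target) (u v : E3 × E3) :
    (lagrangianArea vol).inChart p y ![u, v] = vol.inChart p.1 y.1 ![y.2, u.1, v.1] := by
  -- The fibre vector lives over the base point, so the two have to be replaced together.
  have h0 : ∀ q q' : TM M, q = q' → ∀ L : Fin 2 → E3,
      vol.val q.1 (Matrix.vecCons (α := E3) q.2 L) =
        vol.val q'.1 (Matrix.vecCons (α := E3) q'.2 L) := by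
    rintro q _ rfl L
    rfl
  have h1 : (lagrangianArea vol).inChart p y ![u, v] =
      vol.val ((extChartAt (𝓡 3).tangent p).symm y).1
        (Matrix.vecCons (α := E3) ((extChartAt (𝓡 3).tangent p).symm y).2
          (fun i => tmap (𝓡 3).tangent (𝓡 3) (proj (M := M)) ((extChartAt (𝓡 3).tangent p).symm y)
          (chartD (𝓡 3).tangent p y (![u, v] i)))) := rfl
  rw [h1]
  simp only [tmap_proj_chartD p y hy]
  rw [h0 _ _ (tangent_chart_symm p y hy), DForm.inChart_eq,
    ContinuousAlternatingMap.compContinuousLinearMap_apply]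
  congr 1
  funext i
  fin_cases i <;> rfl

theorem lagrangianArea_val (vol : DForm (𝓡 3) M 3) (p : TM M) (u v : E3 × E3) :
    (lagrangianArea vol).val p ![u, v] = vol.val p.1 ![fib p, u.1, v.1] := by
  have h := lagrangianArea_inChart vol p (extChartAt (𝓡 3).tangent p p)
    (by rw [tangent_chart_self]; exact mem_extChartAt_target _) u v
  rw [DForm.inChart_self, tangent_chart_self, ctr_fst, ctr_snd, DForm.inChart_self] at h
  exact h

theorem normSq_symm (g : Metric M) (p : TM M) (y : E3 × E3)
    (hy : y.1 ∈ (extChartAt (𝓡 3) p.1).target) :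
    normSq g ((extChartAt (𝓡 3).tangent p).symm y) = metricCoord g p.1 y.1 y.2 y.2 := by
  rw [tangent_chart_symm p y hy]
  rfl

theorem contract_extension_lagrangianArea_inChart (vol : DForm (𝓡 3) M 3) (S : (x : M) → T3 x)
    (p : TM M) (y : E3 × E3) (hy : y.1 ∈ (extChartAt (𝓡 3) p.1).target) (v : E3 × E3) :
    (DForm.contract (extension S) (lagrangianArea vol)).inChart p y ![v] =
      vol.inChart p.1 y.1 ![y.2, fieldCoord S p.1 y.1, v.1] := by
  set q := (extChartAt (𝓡 3).tangent p).symm y with hq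
  have h1 : (DForm.contract (extension S) (lagrangianArea vol)).inChart p y ![v] =
      (lagrangianArea vol).val q (Matrix.vecCons (extensionVec S q)
        (fun i => chartD (𝓡 3).tangent p y (![v] i))) := rfl
  have h2 : (Matrix.vecCons (extensionVec S q) (fun i => chartD (𝓡 3).tangent p y (![v] i))) =
      ![extensionVec S q, chartD (𝓡 3).tangent p y v] := by
    funext i
    fin_cases i <;> rfl
  have h3 : (chartD (𝓡 3).tangent p y v).1 = chartD (𝓡 3) p.1 y.1 v.1 := by
    rw [← tmap_proj_chartD p y hy, tmap_proj]
  have h4 : (extensionVec S q).1 = fieldAt S q.1 := rfl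
  rw [h1, h2, lagrangianArea_val, h3, h4, hq, tangent_chart_symm p y hy, DForm.inChart_eq,
    ContinuousAlternatingMap.compContinuousLinearMap_apply]
  congr 1
  funext i
  fin_cases i
  · rfl
  · exact (chartD_fieldCoord S hy).symm
  · rfl

/-! ### Smoothness -/

theorem contDiffAt_metricCoord_apply (g : Metric M) (x₀ : M) {F : Type*} [NormedAddCommGroup F]
    [NormedSpace ℝ F] {z b c : F → E3} {y : F} (hy : z y ∈ (extChartAt (𝓡 3) x₀).target)
    (hz : ContDiffAt ℝ ∞ z y) (hb : ContDiffAt ℝ ∞ b y) (hc : ContDiffAt ℝ ∞ c y) :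
    ContDiffAt ℝ ∞ (fun q => metricCoord g x₀ (z q) (b q) (c q)) y :=
  (((contDiffAt_metricCoord g x₀ hy).comp y hz).clm_apply hb).clm_apply hc

theorem contDiffAt_vol_apply {vol : DForm (𝓡 3) M 3} (hvol : vol.IsSmooth) (x₀ : M) {F : Type*}
    [NormedAddCommGroup F] [NormedSpace ℝ F] {z a b c : F → E3} {y : F}
    (hy : z y ∈ (extChartAt (𝓡 3) x₀).target) (hz : ContDiffAt ℝ ∞ z y)
    (ha : ContDiffAt ℝ ∞ a y) (hb : ContDiffAt ℝ ∞ b y) (hc : ContDiffAt ℝ ∞ c y) :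
    ContDiffAt ℝ ∞ (fun q => vol.inChart x₀ (z q) ![a q, b q, c q]) y := by
  refine contDiffAt_alt_apply (v := fun q => ![a q, b q, c q])
    (ContDiffAt.comp (g := vol.inChart x₀) y (hvol.contDiffAt hy) hz) fun i => ?_
  fin_cases i
  exacts [ha, hb, hc]

theorem vec_one_eta {α : Type*} (v : Fin 1 → α) : v = ![v 0] := by
  funext i; fin_cases i; rfl

theorem vec_two_eta {α : Type*} (v : Fin 2 → α) : v = ![v 0, v 1] := by
  funext i; fin_cases i <;> rfl

theorem vec_three_eta {α : Type*} (v : Fin 3 → α) : v = ![v 0, v 1, v 2] := by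
  funext i; fin_cases i <;> rfl

theorem contactForm_isSmooth (g : Metric M) : (contactForm g).IsSmooth := by
  refine DForm.isSmooth_of_contDiffAt fun p y hy => contDiffAt_alt_of_apply fun v => ?_
  rw [vec_one_eta v]
  have hy' := (tangent_chart_target p y).1 hy
  refine (contDiffAt_metricCoord_apply g p.1 hy' contDiffAt_fst contDiffAt_snd
    (contDiffAt_const (c := (v 0).1))).congr_of_eventuallyEq ?_
  filter_upwards [eventually_fst_mem p y hy'] with z hz
  exact contactForm_inChart g p z hz (v 0)

theorem lagrangianArea_isSmooth {vol : DForm (𝓡 3) M 3} (hvol : vol.IsSmooth) :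
    (lagrangianArea vol).IsSmooth := by
  refine DForm.isSmooth_of_contDiffAt fun p y hy => contDiffAt_alt_of_apply fun v => ?_
  rw [vec_two_eta v]
  have hy' := (tangent_chart_target p y).1 hy
  refine (contDiffAt_vol_apply hvol p.1 hy' contDiffAt_fst contDiffAt_snd
    (contDiffAt_const (c := (v 0).1)) (contDiffAt_const (c := (v 1).1))).congr_of_eventuallyEq ?_
  filter_upwards [eventually_fst_mem p y hy'] with z hz
  exact lagrangianArea_inChart vol p z hz (v 0) (v 1)

theorem contract_extension_lagrangianArea_isSmooth {vol : DForm (𝓡 3) M 3} (hvol : vol.IsSmooth)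
    {S : (x : M) → T3 x} (hS : IsSmoothField S) :
    (DForm.contract (extension S) (lagrangianArea vol)).IsSmooth := by
  refine DForm.isSmooth_of_contDiffAt fun p y hy => contDiffAt_alt_of_apply fun v => ?_
  rw [vec_one_eta v]
  have hy' := (tangent_chart_target p y).1 hy
  refine (contDiffAt_vol_apply hvol p.1 hy' contDiffAt_fst contDiffAt_snd
    ((hS.contDiffAt_fieldCoord p.1 hy').comp y contDiffAt_fst)
    (contDiffAt_const (c := (v 0).1))).congr_of_eventuallyEq ?_
  filter_upwards [eventually_fst_mem p y hy'] with z hz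
  exact contract_extension_lagrangianArea_inChart vol S p z hz (v 0)

theorem normSq_isSmoothFun (g : Metric M) : IsSmoothFun (𝓡 3).tangent (normSq g) := by
  refine isSmoothFun_of_contDiffAt fun p => ?_
  have hy' : (extChartAt (𝓡 3).tangent p p).1 ∈ (extChartAt (𝓡 3) p.1).target :=
    (tangent_chart_target p _).1 (mem_extChartAt_target _)
  refine (contDiffAt_metricCoord_apply g p.1 hy' contDiffAt_fst contDiffAt_snd
    contDiffAt_snd).congr_of_eventuallyEq ?_
  filter_upwards [eventually_fst_mem p _ hy'] with z hz
  exact normSq_symm g p z hz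

theorem flat_isSmooth (g : Metric M) {F : (x : M) → T3 x} (hF : IsSmoothField F) :
    (flat g F).IsSmooth := by
  refine DForm.isSmooth_of_contDiffAt fun x y hy => contDiffAt_alt_of_apply fun v => ?_
  refine (contDiffAt_metricCoord_apply g x hy contDiffAt_id (hF.contDiffAt_fieldCoord x hy)
    (contDiffAt_const (c := v 0))).congr_of_eventuallyEq ?_
  filter_upwards [(isOpen_extChartAt_target (I := 𝓡 3) x).mem_nhds hy] with z hz
  rw [metricCoord_apply, id, chartD_fieldCoord F hz]
  rfl

end Coordinates

/-! ### First derivatives at the centre of a chart. -/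

section Derivatives

theorem fderiv_alt_three {F V : Type*} [NormedAddCommGroup F] [NormedSpace ℝ F]
    [NormedAddCommGroup V] [NormedSpace ℝ V] {w : F → V [⋀^Fin 3]→L[ℝ] ℝ} {a b c : F → V} {x : F}
    (hw : DifferentiableAt ℝ w x) (ha : DifferentiableAt ℝ a x) (hb : DifferentiableAt ℝ b x)
    (hc : DifferentiableAt ℝ c x) (u : F) :
    fderiv ℝ (fun z => w z ![a z, b z, c z]) x u =
      fderiv ℝ w x u ![a x, b x, c x] + w x ![fderiv ℝ a x u, b x, c x] +
        w x ![a x, fderiv ℝ b x u, c x] + w x ![a x, b x, fderiv ℝ c x u] := by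
  have hv : ∀ i, DifferentiableAt ℝ (fun z => ![a z, b z, c z] i) x := by
    intro i
    fin_cases i
    exacts [ha, hb, hc]
  rw [fderiv_continuousAlternatingMap_apply_apply hw hv]
  have h0 : Function.update ![a x, b x, c x] 0 (fderiv ℝ a x u) = ![fderiv ℝ a x u, b x, c x] := by
    funext i; fin_cases i <;> rfl
  have h1 : Function.update ![a x, b x, c x] 1 (fderiv ℝ b x u) = ![a x, fderiv ℝ b x u, c x] := by
    funext i; fin_cases i <;> rfl
  have h2 : Function.update ![a x, b x, c x] 2 (fderiv ℝ c x u) = ![a x, b x, fderiv ℝ c x u] := by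
    funext i; fin_cases i <;> rfl
  rw [Fin.sum_univ_three, ← h0, ← h1, ← h2]
  simp only [add_assoc]
  rfl

theorem fderiv_bilin {F V : Type*} [NormedAddCommGroup F] [NormedSpace ℝ F]
    [NormedAddCommGroup V] [NormedSpace ℝ V] {G : F → V →L[ℝ] V →L[ℝ] ℝ} {b c : F → V} {x : F}
    (hG : DifferentiableAt ℝ G x) (hb : DifferentiableAt ℝ b x) (hc : DifferentiableAt ℝ c x)
    (u : F) :
    fderiv ℝ (fun z => G z (b z) (c z)) x u =
      fderiv ℝ G x u (b x) (c x) + G x (fderiv ℝ b x u) (c x) + G x (b x) (fderiv ℝ c x u) := by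
  have h := ((hG.hasFDerivAt.clm_apply hb.hasFDerivAt).clm_apply hc.hasFDerivAt).fderiv
  rw [h]
  simp
  ring

variable {M : Type*} [TopologicalSpace M] [ChartedSpace (EuclideanSpace ℝ (Fin 3)) M]
  [IsManifold (𝓡 3) ∞ M]

/-- The derivative at `x` of the metric in the preferred chart at `x`. -/
def metricD (g : Metric M) (x : M) (a : E3) : E3 →L[ℝ] E3 →L[ℝ] ℝ :=
  fderiv ℝ (metricCoord g x) (extChartAt (𝓡 3) x x) a

/-- The derivative at `x` of the form `vol` in the preferred chart at `x`. -/
def volD (vol : DForm (𝓡 3) M 3) (x : M) : E3 →L[ℝ] E3 [⋀^Fin 3]→L[ℝ] ℝ :=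
  fderiv ℝ (vol.inChart x) (extChartAt (𝓡 3) x x)

/-- The derivative at `x` of a vector field in the preferred chart at `x`. -/
def fieldD (S : (x : M) → T3 x) (x : M) : E3 →L[ℝ] E3 :=
  fderiv ℝ (fieldCoord S x) (extChartAt (𝓡 3) x x)

theorem differentiableAt_metricCoord (g : Metric M) (x : M) :
    DifferentiableAt ℝ (metricCoord g x) (extChartAt (𝓡 3) x x) :=
  (contDiffAt_metricCoord g x (chart_mem_target x)).differentiableAt (by simp)

theorem IsSmoothField.differentiableAt_fieldCoord {S : (x : M) → T3 x} (hS : IsSmoothField S)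
    (x : M) : DifferentiableAt ℝ (fieldCoord S x) (extChartAt (𝓡 3) x x) :=
  (hS.contDiffAt_fieldCoord x (chart_mem_target x)).differentiableAt (by simp)

theorem tangent_chart_self_fst_mem (p : TM M) :
    (ctr p).1 ∈ (extChartAt (𝓡 3) p.1).target := chart_mem_target p.1

theorem metricD_apply (g : Metric M) (x : M) (a b c : E3) :
    fderiv ℝ (fun z => metricCoord g x z b c) (extChartAt (𝓡 3) x x) a = metricD g x a b c := by
  rw [fderiv_bilin (differentiableAt_metricCoord g x) (differentiableAt_const b)
    (differentiableAt_const c)]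
  simp [metricD]

theorem fderiv_comp_fst {F : Type*} [NormedAddCommGroup F] [NormedSpace ℝ F] {f : E3 → F}
    {y : E3 × E3} (hf : DifferentiableAt ℝ f y.1) (u : E3 × E3) :
    fderiv ℝ (fun q : E3 × E3 => f q.1) y u = fderiv ℝ f y.1 u.1 := by
  have h := HasFDerivAt.comp y (f := Prod.fst) (g := f) hf.hasFDerivAt hasFDerivAt_fst
  rw [show (fun q : E3 × E3 => f q.1) = f ∘ Prod.fst from rfl, h.fderiv]
  rfl

theorem differentiableAt_comp_fst {F : Type*} [NormedAddCommGroup F] [NormedSpace ℝ F]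
    {f : E3 → F} {y : E3 × E3} (hf : DifferentiableAt ℝ f y.1) :
    DifferentiableAt ℝ (fun q : E3 × E3 => f q.1) y :=
  DifferentiableAt.comp y (f := Prod.fst) (g := f) hf differentiableAt_fst

theorem fderiv_metric_tangent (g : Metric M) (p : TM M) (c : E3) (u : E3 × E3) :
    fderiv ℝ (fun q : E3 × E3 => metricCoord g p.1 q.1 q.2 c) (ctr p) u =
      metricD g p.1 u.1 (fib p) c + metricAt g p.1 u.2 c := by
  have hd : DifferentiableAt ℝ (metricCoord g p.1) (ctr p).1 := differentiableAt_metricCoord g p.1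
  have hd' : DifferentiableAt ℝ (fun q : E3 × E3 => metricCoord g p.1 q.1) (ctr p) :=
    differentiableAt_comp_fst (F := E3 →L[ℝ] E3 →L[ℝ] ℝ) (f := metricCoord g p.1) (y := ctr p) hd
  have hd'' : fderiv ℝ (fun q : E3 × E3 => metricCoord g p.1 q.1) (ctr p) u = metricD g p.1 u.1 :=
    fderiv_comp_fst (F := E3 →L[ℝ] E3 →L[ℝ] ℝ) (f := metricCoord g p.1) (y := ctr p) hd u
  rw [fderiv_bilin (G := fun q : E3 × E3 => metricCoord g p.1 q.1) (b := Prod.snd)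
    (c := fun _ => c) hd' differentiableAt_snd
    (differentiableAt_const c), hd'', fderiv_snd, fderiv_fun_const, ctr_fst, ctr_snd,
    metricCoord_self]
  simp only [Pi.zero_apply, zero_apply, map_zero, add_zero]
  rfl

theorem dFun_normSq (g : Metric M) (p : TM M) (u : E3 × E3) :
    dFun (𝓡 3).tangent (normSq g) p u =
      metricD g p.1 u.1 (fib p) (fib p) + 2 * metricAt g p.1 u.2 (fib p) := by
  rw [dFun_eq_fderiv ((normSq_isSmoothFun g).mdifferentiableAt (by simp)), tangent_chart_self]
  have h : (fun z => normSq g ((extChartAt (𝓡 3).tangent p).symm z)) =ᶠ[𝓝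
      (ctr p)] fun q : E3 × E3 => metricCoord g p.1 q.1 q.2 q.2 := by
    filter_upwards [eventually_fst_mem p _ (tangent_chart_self_fst_mem p)] with z hz
    exact normSq_symm g p z hz
  have hd : DifferentiableAt ℝ (metricCoord g p.1) (ctr p).1 := differentiableAt_metricCoord g p.1
  have hd' : DifferentiableAt ℝ (fun q : E3 × E3 => metricCoord g p.1 q.1) (ctr p) :=
    differentiableAt_comp_fst (F := E3 →L[ℝ] E3 →L[ℝ] ℝ) (f := metricCoord g p.1) (y := ctr p) hd
  have hd'' : fderiv ℝ (fun q : E3 × E3 => metricCoord g p.1 q.1) (ctr p) u = metricD g p.1 u.1 :=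
    fderiv_comp_fst (F := E3 →L[ℝ] E3 →L[ℝ] ℝ) (f := metricCoord g p.1) (y := ctr p) hd u
  rw [h.fderiv_eq, fderiv_bilin (G := fun q : E3 × E3 => metricCoord g p.1 q.1) (b := Prod.snd)
    (c := Prod.snd) hd' differentiableAt_snd differentiableAt_snd,
    hd'', fderiv_snd, ctr_fst, ctr_snd, metricCoord_self]
  simp only [ContinuousLinearMap.coe_snd']
  rw [(isInner_metricAt g p.1).symm (fib p) u.2]
  ring

theorem d_contactForm (g : Metric M) (p : TM M) (u v : E3 × E3) :
    (contactForm g).d.val p ![u, v] =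
      (metricD g p.1 u.1 (fib p) v.1 + metricAt g p.1 u.2 v.1) -
        (metricD g p.1 v.1 (fib p) u.1 + metricAt g p.1 v.2 u.1) := by
  have h : ∀ v : E3 × E3, (fun z => (contactForm g).inChart p z ![v]) =ᶠ[𝓝
      (ctr p)] fun q : E3 × E3 => metricCoord g p.1 q.1 q.2 v.1 := by
    intro v
    filter_upwards [eventually_fst_mem p _ (tangent_chart_self_fst_mem p)] with z hz
    exact contactForm_inChart g p z hz v
  rw [DForm.d_val, extDeriv_one_apply
    ((contactForm_isSmooth g).differentiableAt (chart_mem_target p)), tangent_chart_self,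
    (h u).fderiv_eq, (h v).fderiv_eq, fderiv_metric_tangent, fderiv_metric_tangent]

theorem fderiv_vol_tangent {vol : DForm (𝓡 3) M 3} (hvol : vol.IsSmooth) (p : TM M) (b c : E3)
    (u : E3 × E3) :
    fderiv ℝ (fun q : E3 × E3 => vol.inChart p.1 q.1 ![q.2, b, c])
      (ctr p) u =
      volD vol p.1 u.1 ![fib p, b, c] + vol.val p.1 ![u.2, b, c] := by
  have hd : DifferentiableAt ℝ (vol.inChart p.1) (ctr p).1 :=
    hvol.differentiableAt (chart_mem_target (I := 𝓡 3) p.1)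
  rw [fderiv_alt_three (w := fun q : E3 × E3 => vol.inChart p.1 q.1)
    (differentiableAt_comp_fst hd) differentiableAt_snd (differentiableAt_const b)
    (differentiableAt_const c), fderiv_comp_fst hd, fderiv_snd, ctr_fst, ctr_snd,
    DForm.inChart_self]
  have h1 : vol.val p.1 ![fib p, (0 : E3), c] = 0 := (vol.val p.1).map_coord_zero 1 rfl
  have h2 : vol.val p.1 ![fib p, b, (0 : E3)] = 0 := (vol.val p.1).map_coord_zero 2 rfl
  simp [volD, h1, h2]

theorem d_lagrangianArea {vol : DForm (𝓡 3) M 3} (hvol : vol.IsSmooth) (p : TM M)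
    (u v t : E3 × E3) :
    (lagrangianArea vol).d.val p ![u, v, t] =
      (volD vol p.1 u.1 ![fib p, v.1, t.1] + vol.val p.1 ![u.2, v.1, t.1]) -
      (volD vol p.1 v.1 ![fib p, u.1, t.1] + vol.val p.1 ![v.2, u.1, t.1]) +
      (volD vol p.1 t.1 ![fib p, u.1, v.1] + vol.val p.1 ![t.2, u.1, v.1]) := by
  have h : ∀ u v : E3 × E3, (fun z => (lagrangianArea vol).inChart p z ![u, v]) =ᶠ[𝓝
      (ctr p)]
      fun q : E3 × E3 => vol.inChart p.1 q.1 ![q.2, u.1, v.1] := by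
    intro u v
    filter_upwards [eventually_fst_mem p _ (tangent_chart_self_fst_mem p)] with z hz
    exact lagrangianArea_inChart vol p z hz u v
  rw [DForm.d_val, extDeriv_two_apply
    ((lagrangianArea_isSmooth hvol).differentiableAt (chart_mem_target p)), tangent_chart_self,
    (h v t).fderiv_eq, (h u t).fderiv_eq, (h u v).fderiv_eq, fderiv_vol_tangent hvol,
    fderiv_vol_tangent hvol, fderiv_vol_tangent hvol]

theorem d_contract_extension_lagrangianArea {vol : DForm (𝓡 3) M 3} (hvol : vol.IsSmooth)
    {S : (x : M) → T3 x} (hS : IsSmoothField S) (p : TM M) (u v : E3 × E3) :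
    (DForm.contract (extension S) (lagrangianArea vol)).d.val p ![u, v] =
      (volD vol p.1 u.1 ![fib p, fieldAt S p.1, v.1] + vol.val p.1 ![u.2, fieldAt S p.1, v.1] +
        vol.val p.1 ![fib p, fieldD S p.1 u.1, v.1]) -
      (volD vol p.1 v.1 ![fib p, fieldAt S p.1, u.1] + vol.val p.1 ![v.2, fieldAt S p.1, u.1] +
        vol.val p.1 ![fib p, fieldD S p.1 v.1, u.1]) := by
  have hd : DifferentiableAt ℝ (vol.inChart p.1) (ctr p).1 :=
    hvol.differentiableAt (chart_mem_target (I := 𝓡 3) p.1)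
  have hf : DifferentiableAt ℝ (fieldCoord S p.1) (ctr p).1 := hS.differentiableAt_fieldCoord p.1
  have h : ∀ v : E3 × E3, (fun z => (DForm.contract (extension S) (lagrangianArea vol)).inChart p z
      ![v]) =ᶠ[𝓝 (ctr p)]
      fun q : E3 × E3 => vol.inChart p.1 q.1 ![q.2, fieldCoord S p.1 q.1, v.1] := by
    intro v
    filter_upwards [eventually_fst_mem p _ (tangent_chart_self_fst_mem p)] with z hz
    exact contract_extension_lagrangianArea_inChart vol S p z hz v
  have h' : ∀ u v : E3 × E3, fderiv ℝ
      (fun q : E3 × E3 => vol.inChart p.1 q.1 ![q.2, fieldCoord S p.1 q.1, v.1])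
      (ctr p) u =
      volD vol p.1 u.1 ![fib p, fieldAt S p.1, v.1] + vol.val p.1 ![u.2, fieldAt S p.1, v.1] +
        vol.val p.1 ![fib p, fieldD S p.1 u.1, v.1] := by
    intro u v
    rw [fderiv_alt_three (w := fun q : E3 × E3 => vol.inChart p.1 q.1)
      (b := fun q : E3 × E3 => fieldCoord S p.1 q.1)
      (differentiableAt_comp_fst hd) differentiableAt_snd (differentiableAt_comp_fst hf)
      (differentiableAt_const v.1), fderiv_comp_fst hd, fderiv_comp_fst hf, fderiv_snd,
      ctr_fst, ctr_snd, DForm.inChart_self, fieldCoord_self]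
    have h2 : vol.val p.1 ![fib p, fieldAt S p.1, (0 : E3)] = 0 := (vol.val p.1).map_coord_zero 2 rfl
    simp [volD, fieldD, h2]
  rw [DForm.d_val, extDeriv_one_apply
    ((contract_extension_lagrangianArea_isSmooth hvol hS).differentiableAt (chart_mem_target p)),
    tangent_chart_self, (h u).fderiv_eq, (h v).fderiv_eq, h', h']

theorem d_contract_vol {vol : DForm (𝓡 3) M 3} (hvol : vol.IsSmooth)
    {S : (x : M) → T3 x} (hS : IsSmoothField S) (x : M) (a b c : E3) :
    (DForm.contract S vol).d.val x ![a, b, c] =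
      (volD vol x a ![fieldAt S x, b, c] + vol.val x ![fieldD S x a, b, c]) -
      (volD vol x b ![fieldAt S x, a, c] + vol.val x ![fieldD S x b, a, c]) +
      (volD vol x c ![fieldAt S x, a, b] + vol.val x ![fieldD S x c, a, b]) := by
  have hd := hvol.differentiableAt (chart_mem_target (I := 𝓡 3) x)
  have hf := hS.differentiableAt_fieldCoord x
  have h : ∀ b c : E3, (fun z => (DForm.contract S vol).inChart x z ![b, c]) =ᶠ[𝓝
      (extChartAt (𝓡 3) x x)] fun z => vol.inChart x z ![fieldCoord S x z, b, c] := by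
    intro b c
    filter_upwards [extChartAt_target_mem_nhds (I := 𝓡 3) x] with z hz
    rw [DForm.inChart_contract S vol hz]
    rfl
  have h' : ∀ a b c : E3, fderiv ℝ (fun z => vol.inChart x z ![fieldCoord S x z, b, c])
      (extChartAt (𝓡 3) x x) a =
      volD vol x a ![fieldAt S x, b, c] + vol.val x ![fieldD S x a, b, c] := by
    intro a b c
    rw [fderiv_alt_three hd hf (differentiableAt_const b) (differentiableAt_const c),
      DForm.inChart_self, fieldCoord_self]
    have h1 : vol.val x ![fieldAt S x, (0 : E3), c] = 0 := (vol.val x).map_coord_zero 1 rfl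
    have h2 : vol.val x ![fieldAt S x, b, (0 : E3)] = 0 := (vol.val x).map_coord_zero 2 rfl
    simp [volD, fieldD, h1, h2]
  have hs : (DForm.contract S vol).IsSmooth :=
    hvol.contract fun x₀ y hy => hS.contDiffAt_fieldCoord x₀ hy
  rw [DForm.d_val, extDeriv_two_apply (hs.differentiableAt (chart_mem_target x)),
    (h _ _).fderiv_eq, (h _ _).fderiv_eq, (h _ _).fderiv_eq, h', h', h']

theorem finrank_E3 : Module.finrank ℝ E3 = 3 := by simp

theorem d_vol (vol : DForm (𝓡 3) M 3) (x : M) : vol.d x = 0 :=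
  alt_eq_zero_of_finrank_lt (V := E3) (by simp) (vol.d.val x)

/-- This is `d vol = 0`, true because a 4-form on a 3-manifold vanishes, written on constant fields.
It trades a derivative along `s` for derivatives along the other arguments. -/
theorem volD_cyclic {vol : DForm (𝓡 3) M 3} (hvol : vol.IsSmooth) (x : M) (s a b c : E3) :
    volD vol x s ![a, b, c] - volD vol x a ![s, b, c] + volD vol x b ![s, a, c] -
      volD vol x c ![s, a, b] = 0 := by
  have h : vol.d.val x ![s, a, b, c] = 0 := by
    have := d_vol vol x
    exact DFunLike.congr_fun (F := E3 [⋀^Fin 4]→L[ℝ] ℝ) this ![s, a, b, c]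
  have hd := hvol.differentiableAt (chart_mem_target (I := 𝓡 3) x)
  have h' : ∀ a b c s : E3, fderiv ℝ (fun z => vol.inChart x z ![a, b, c])
      (extChartAt (𝓡 3) x x) s = volD vol x s ![a, b, c] := by
    intro a b c s
    rw [fderiv_alt_three hd (differentiableAt_const a) (differentiableAt_const b)
      (differentiableAt_const c), DForm.inChart_self]
    have h0 : vol.val x ![(0 : E3), b, c] = 0 := (vol.val x).map_coord_zero 0 rfl
    have h1 : vol.val x ![a, (0 : E3), c] = 0 := (vol.val x).map_coord_zero 1 rfl
    have h2 : vol.val x ![a, b, (0 : E3)] = 0 := (vol.val x).map_coord_zero 2 rfl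
    simp [volD, h0, h1, h2]
  rw [DForm.d_val, extDeriv_three_apply hd, h', h', h', h'] at h
  exact h

end Derivatives

/-! ### The volume form, the differential of Λ, and Killing fields. -/

section Geometry

variable {M : Type*} [TopologicalSpace M] [ChartedSpace (EuclideanSpace ℝ (Fin 3)) M]
  [IsManifold (𝓡 3) ∞ M]

theorem metricD_add (g : Metric M) (x : M) (a b : E3) :
    metricD g x (a + b) = metricD g x a + metricD g x b :=
  map_add (fderiv ℝ (metricCoord g x) (extChartAt (𝓡 3) x x)) a b

theorem metricD_smul (g : Metric M) (x : M) (r : ℝ) (a : E3) :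
    metricD g x (r • a) = r • metricD g x a :=
  map_smul (fderiv ℝ (metricCoord g x) (extChartAt (𝓡 3) x x)) r a

theorem metricD_symm (g : Metric M) (x : M) (a b c : E3) :
    metricD g x a b c = metricD g x a c b := by
  rw [← metricD_apply, ← metricD_apply]
  congr 2
  funext z
  exact g.symm _ _ _

/-- When the outer arguments agree, two of the three metric derivatives cancel by symmetry. The
trace of II involves only these symbols. -/
theorem christoffel_self (g : Metric M) (x : M) (u n : E3) :
    christoffel g x u n u = metricD g x n u u / 2 := by
  unfold christoffel
  rw [metricDeriv_eq, metricDeriv_eq, metricDeriv_eq, metricD_apply, metricD_apply, metricD_apply,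
    metricD_symm g x u n u]
  ring

/-! ### The volume form -/

variable {g : Metric M} {vol : DForm (𝓡 3) M 3}

theorem IsVolumeForm.val_frame (hvol : IsVolumeForm g vol) (x : M) {e : Fin 3 → E3}
    (he : IsOrthonormal (metricAt g x) e) : vol.val x e = 1 ∨ vol.val x e = -1 :=
  hvol.2 x e he

theorem IsVolumeForm.inChart_frame (hvol : IsVolumeForm g vol) (x₀ : M) (z : E3) {e : Fin 3 → E3}
    (he : IsOrthonormal (metricCoord g x₀ z) e) :
    vol.inChart x₀ z e = 1 ∨ vol.inChart x₀ z e = -1 :=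
  hvol.val_frame ((extChartAt (𝓡 3) x₀).symm z) (e := fun i => chartD (𝓡 3) x₀ z (e i)) he

theorem IsVolumeForm.val_ne_zero (hvol : IsVolumeForm g vol) (x : M) {e : Fin 3 → E3}
    (he : IsOrthonormal (metricAt g x) e) : vol.val x e ≠ 0 := by
  rcases hvol.val_frame x he with h | h <;> rw [h] <;> norm_num

/-- On three constant vectors, vol² is the Gram determinant of the metric, near x and not only at x.
Differentiating this at an orthonormal frame gives 2 vol · D vol = trace of Dg. Working with the
square avoids choosing the sign of vol. -/
theorem IsVolumeForm.volD_frame (hvol : IsVolumeForm g vol) (x : M) (a : E3) {b c d : E3}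
    (he : IsOrthonormal (metricAt g x) ![b, c, d]) :
    volD vol x a ![b, c, d] =
      (metricD g x a b b + metricD g x a c c + metricD g x a d d) / 2 * vol.val x ![b, c, d] := by
  set y := extChartAt (𝓡 3) x x with hy
  have hl : HasDerivAt (fun t : ℝ => y + t • a) a 0 := by
    simpa using ((hasDerivAt_id (0 : ℝ)).smul_const a).const_add y
  have hm : ∀ u v : E3, HasDerivAt (fun t : ℝ => metricCoord g x (y + t • a) u v)
      (metricD g x a u v) 0 := by
    intro u v
    have h1 : DifferentiableAt ℝ (fun z => metricCoord g x z u v) (y + (0 : ℝ) • a) := by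
      rw [zero_smul, add_zero]
      exact ((contDiffAt_metricCoord_apply g x (z := id) (b := fun _ => u) (c := fun _ => v)
        (chart_mem_target x) contDiffAt_id contDiffAt_const
        contDiffAt_const)).differentiableAt (by simp)
    have h2 := h1.hasFDerivAt.comp_hasDerivAt (0 : ℝ) hl
    rw [zero_smul, add_zero, metricD_apply] at h2
    exact h2
  have hd := hvol.1.differentiableAt (chart_mem_target (I := 𝓡 3) x)
  have hw : HasDerivAt (fun t : ℝ => vol.inChart x (y + t • a) ![b, c, d])
      (volD vol x a ![b, c, d]) 0 := by
    have h1 : DifferentiableAt ℝ (fun z => vol.inChart x z ![b, c, d]) (y + (0 : ℝ) • a) := by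
      rw [zero_smul, add_zero]
      exact (contDiffAt_vol_apply hvol.1 x (z := id) (a := fun _ => b) (b := fun _ => c)
        (c := fun _ => d) (chart_mem_target x) contDiffAt_id contDiffAt_const
        contDiffAt_const contDiffAt_const).differentiableAt (by simp)
    have h2 := h1.hasFDerivAt.comp_hasDerivAt (0 : ℝ) hl
    rw [zero_smul, add_zero, fderiv_alt_three hd (differentiableAt_const b)
      (differentiableAt_const c) (differentiableAt_const d), DForm.inChart_self] at h2
    have h3 : vol.val x ![(0 : E3), c, d] = 0 := (vol.val x).map_coord_zero 0 rfl
    have h4 : vol.val x ![b, (0 : E3), d] = 0 := (vol.val x).map_coord_zero 1 rfl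
    have h5 : vol.val x ![b, c, (0 : E3)] = 0 := (vol.val x).map_coord_zero 2 rfl
    simp only [fderiv_fun_const, Pi.zero_apply, zero_apply, h3, h4, h5, add_zero] at h2
    exact h2
  have hsq : (fun t : ℝ => vol.inChart x (y + t • a) ![b, c, d] ^ 2) =ᶠ[𝓝 0] fun t : ℝ =>
      (fun B : E3 →L[ℝ] E3 →L[ℝ] ℝ =>
        B b b * B c c * B d d - B b b * B c d * B d c - B b c * B c b * B d d
          + B b c * B c d * B d b + B b d * B c b * B d c - B b d * B c c * B d b)
      (metricCoord g x (y + t • a)) := by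
    have hc : ContinuousAt (fun t : ℝ => y + t • a) 0 := hl.continuousAt
    have ht : ∀ᶠ t : ℝ in 𝓝 0, y + t • a ∈ (extChartAt (𝓡 3) x).target := by
      refine hc.eventually_mem ?_
      simp only [zero_smul, add_zero]
      exact extChartAt_target_mem_nhds x
    filter_upwards [ht] with t ht
    exact alt_sq_three (isInner_metricCoord g x ht) finrank_E3 _
      (fun e he => hvol.inChart_frame x _ he) b c d
  have hL := hw.pow 2
  have hR := ((((((hm b b).mul (hm c c)).mul (hm d d)).sub (((hm b b).mul (hm c d)).mul (hm d c))).sub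
    (((hm b c).mul (hm c b)).mul (hm d d))).add (((hm b c).mul (hm c d)).mul (hm d b))).add
    (((hm b d).mul (hm c b)).mul (hm d c)) |>.sub (((hm b d).mul (hm c c)).mul (hm d b))
  have h := hL.unique (hR.congr_of_eventuallyEq hsq)
  have e00 := he 0 0
  have e01 := he 0 1
  have e02 := he 0 2
  have e10 := he 1 0
  have e11 := he 1 1
  have e12 := he 1 2
  have e20 := he 2 0
  have e21 := he 2 1
  have e22 := he 2 2
  simp at e00 e01 e02 e10 e11 e12 e20 e21 e22
  have hw0 := hvol.val_ne_zero x he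
  have hw1 : vol.val x ![b, c, d] ^ 2 = 1 := by
    rcases hvol.val_frame x he with h | h <;> rw [h] <;> norm_num
  have hv0 : vol.inChart x (y + (0 : ℝ) • a) = vol.val x := by
    rw [zero_smul, add_zero, hy, DForm.inChart_self]
  have hm0 : metricCoord g x (y + (0 : ℝ) • a) = metricAt g x := by
    rw [zero_smul, add_zero, hy, metricCoord_self]
  simp only [hv0, hm0, Pi.mul_apply, e00, e01, e02, e10, e11, e12, e20, e21, e22] at h
  have h' : 2 * vol.val x ![b, c, d] * volD vol x a ![b, c, d] =
      metricD g x a b b + metricD g x a c c + metricD g x a d d := by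
    norm_num at h
    linarith
  -- Since vol = ±1 on the frame, multiplying by vol amounts to dividing by it.
  linear_combination (vol.val x ![b, c, d] / 2) * h' - volD vol x a ![b, c, d] * hw1

theorem IsVolumeField.d_contract {Ξ : (x : M) → T3 x} (hΞ : IsVolumeField vol Ξ) (x : M) :
    (DForm.contract Ξ vol).d x = vol x := by
  have h := hΞ.2 x
  have h0 : DForm.contract Ξ vol.d x = 0 := by
    have h1 := d_vol vol x
    unfold DForm.contract
    rw [h1]
    rfl
  unfold DForm.lieDeriv at h
  rwa [h0, add_zero] at h

theorem IsSmoothField.contract_isSmooth {S : (x : M) → T3 x} (hS : IsSmoothField S) {k : ℕ}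
    {α : DForm (𝓡 3) M (k + 1)} (hα : α.IsSmooth) : (DForm.contract S α).IsSmooth :=
  hα.contract fun x₀ _ hy => hS.contDiffAt_fieldCoord x₀ hy

/-! ### The differential of the lagrangian -/

/-- Pullback commutes with d and d(Ξ ⌟ vol) = vol, so the choice of the volume field disappears from
dΛ. -/
theorem d_lagrangian (hvol : vol.IsSmooth) {Ξ : (x : M) → T3 x}
    (hΞ : IsVolumeField vol Ξ) (H : ℝ) (p : TM M) (u v t : E3 × E3) :
    (lagrangian vol Ξ H).d.val p ![u, v, t] =
      (lagrangianArea vol).d.val p ![u, v, t] + 2 * H * vol.val p.1 ![u.1, v.1, t.1] := by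
  have hs := hΞ.1.contract_isSmooth hvol
  have hp := hs.pullback (I := (𝓡 3).tangent) contMDiff_tangent_proj
  have h1 : (lagrangian vol Ξ H).d p = (lagrangianArea vol).d p +
      (2 * H) • (DForm.pullback (I := (𝓡 3).tangent) (proj (M := M)) (DForm.contract Ξ vol)).d p := by
    rw [← DForm.d_const_smul]
    exact (lagrangianArea_isSmooth hvol).d_add (hp.const_smul (2 * H)) p
  rw [hs.d_pullback contMDiff_tangent_proj] at h1
  have h2 : (DForm.contract Ξ vol).d = vol := funext fun x => hΞ.d_contract x
  rw [h2] at h1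
  have h3 := DFunLike.congr_fun (F := (E3 × E3) [⋀^Fin 3]→L[ℝ] ℝ) h1 ![u, v, t]
  refine h3.trans ?_
  have h4 : (DForm.pullback (I := (𝓡 3).tangent) (proj (M := M)) vol).val p ![u, v, t] =
      vol.val p.1 ![u.1, v.1, t.1] := by
    rw [pullback_proj_val]
    congr 1
    funext i
    fin_cases i <;> rfl
  rw [← h4]
  rfl

/-- The differential of the lagrangian of a surface of mean curvature `H` vanishes on triples of
vectors two of which are tangent to its legendrian lift. -/
theorem IsVolumeForm.d_lagrangian_eq_zero (hvol : IsVolumeForm g vol) {Ξ : (x : M) → T3 x}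
    (hΞ : IsVolumeField vol Ξ) {H : ℝ} {p : TM M} {W u v : E3 × E3}
    (he : IsOrthonormal (metricAt g p.1) ![fib p, u.1, v.1])
    (hW : dFun (𝓡 3).tangent (normSq g) p W = 0) (hu : dFun (𝓡 3).tangent (normSq g) p u = 0)
    (hv : dFun (𝓡 3).tangent (normSq g) p v = 0)
    (hH : -(metricAt g p.1 u.2 u.1 + christoffel g p.1 u.1 (fib p) u.1) +
      -(metricAt g p.1 v.2 v.1 + christoffel g p.1 v.1 (fib p) v.1) = 2 * H) :
    (lagrangian vol Ξ H).d.val p ![W, u, v] = 0 := by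
  rw [d_lagrangian hvol.1 hΞ, d_lagrangianArea hvol.1]
  rw [dFun_normSq] at hW hu hv
  rw [christoffel_self, christoffel_self] at hH
  obtain ⟨a, a'⟩ := W
  obtain ⟨b, b'⟩ := u
  obtain ⟨c, c'⟩ := v
  simp only at he hW hu hv hH ⊢
  generalize fib p = n at *
  generalize p.1 = x at *
  have hf := finrank_E3
  -- The projection of W is split into its normal component `r` and its tangential components `s`,
  -- `t`.
  have ha := he.sum_eq hf a
  rw [Fin.sum_univ_three] at ha
  simp only [Matrix.cons_val_zero, Matrix.cons_val_one, Matrix.cons_val] at ha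
  generalize metricAt g x a n = r at ha
  generalize metricAt g x a b = s at ha
  generalize metricAt g x a c = t at ha
  subst ha
  have hDn := hvol.volD_frame x n he
  have hw1 := he.alt_first hf (vol.val x) a'
  have hw2 := he.alt_second hf (vol.val x) b'
  have hw3 := he.alt_third hf (vol.val x) c'
  have hw4 := he.alt_first hf (vol.val x) b'
  have hw5 := he.alt_first hf (vol.val x) c'
  set w := vol.val x with hw
  have e1 : w ![b', n, c] = -w ![n, b', c] := alt_three_swap₀₁ _ _ _ _
  have e2 : w ![c', n, b] = w ![n, b, c'] := by
    rw [alt_three_swap₀₁, alt_three_swap₁₂, neg_neg]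
  have e3 : w ![c', c, b] = -w ![c', b, c] := alt_three_swap₁₂ _ _ _ _
  have e4 : ∀ w' : E3 [⋀^Fin 3]→L[ℝ] ℝ, w' ![n, c, b] = -w' ![n, b, c] := fun w' =>
    alt_three_swap₁₂ _ _ _ _
  simp only [alt_three_comb₀, alt_three_comb₁, alt_three_self₀₁, alt_three_self₁₂, alt_three_self₀₂,
    map_add, map_smul, add_apply, smul_apply, ContinuousAlternatingMap.add_apply,
    ContinuousAlternatingMap.smul_apply, metricD_add, metricD_smul, smul_eq_mul, e1, e2, e3, e4,
    hw1, hw2, hw3, hw4, hw5, hDn] at hW ⊢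
  -- Tangency to 𝒞 determines ⟨a', n⟩, ⟨b', n⟩ and ⟨c', n⟩ through metric derivatives, which removes
  -- everything tangential. The coefficient of `r` that remains is the mean curvature equation.
  linear_combination (w ![n, b, c] / 2) * hW - (s * w ![n, b, c] / 2) * hu -
    (t * w ![n, b, c] / 2) * hv - r * w ![n, b, c] * hH

/-! ### Killing fields -/

theorem IsKilling.metricD_eq {S : (x : M) → T3 x} (hS : IsKilling g S) (x : M) (e : E3) :
    metricD g x (fieldAt S x) e e + 2 * metricAt g x (fieldD S x e) e = 0 := by
  have h := hS.2 ⟨x, e⟩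
  have h1 := dFun_normSq g ⟨x, e⟩ (extensionVec S ⟨x, e⟩)
  rw [extension_snd hS.1, extension_fst] at h1
  exact h1.symm.trans h

/-- As `d vol = 0`, the left side is ℒ_S vol; the right side is the coordinate formula for that Lie
derivative. -/
theorem d_contract_vol_eq (hvol : vol.IsSmooth) {S : (x : M) → T3 x} (hS : IsSmoothField S) (x : M)
    (a b c : E3) : (DForm.contract S vol).d.val x ![a, b, c] =
      volD vol x (fieldAt S x) ![a, b, c] + vol.val x ![fieldD S x a, b, c] +
        vol.val x ![a, fieldD S x b, c] + vol.val x ![a, b, fieldD S x c] := by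
  have h := volD_cyclic hvol x (fieldAt S x) a b c
  have h1 : vol.val x ![fieldD S x b, a, c] = -vol.val x ![a, fieldD S x b, c] :=
    alt_three_swap₀₁ _ _ _ _
  have h2 : vol.val x ![fieldD S x c, a, b] = vol.val x ![a, b, fieldD S x c] := by
    rw [alt_three_swap₀₁, alt_three_swap₁₂, neg_neg]
  rw [d_contract_vol hvol hS, h1, h2]
  linarith

/-- Killing fields preserve the volume. -/
theorem IsKilling.d_contract_vol (hvol : IsVolumeForm g vol) {S : (x : M) → T3 x}
    (hS : IsKilling g S) (x : M) : (DForm.contract S vol).d.val x = 0 := by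
  obtain ⟨e, he⟩ := (isInner_metricAt g x).exists_isOrthonormal finrank_E3
  refine he.alt_eq_zero finrank_E3 _ ?_
  rw [vec_three_eta e] at he ⊢
  rw [d_contract_vol_eq hvol.1 hS.1, hvol.volD_frame x _ he]
  have g0 := he.alt_first finrank_E3 (vol.val x) (fieldD S x (e 0))
  have g1 := he.alt_second finrank_E3 (vol.val x) (fieldD S x (e 1))
  have g2 := he.alt_third finrank_E3 (vol.val x) (fieldD S x (e 2))
  have h0 := hS.metricD_eq x (e 0)
  have h1 := hS.metricD_eq x (e 1)
  have h2 := hS.metricD_eq x (e 2)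
  -- The derivative of vol along S gives half the trace of the derivative of g along S, and the
  -- three substitutions give the trace of DS. The Killing equation on the frame vectors makes them
  -- cancel.
  linear_combination (vol.val x ![e 0, e 1, e 2] / 2) * (h0 + h1 + h2) + g0 + g1 + g2

/-- The lifted flow of a Killing field preserves the area lagrangian. -/
theorem IsKilling.lieDeriv_lagrangianArea (hvol : IsVolumeForm g vol) {S : (x : M) → T3 x}
    (hS : IsKilling g S) (p : TM M) :
    DForm.lieDeriv (extension S) (lagrangianArea vol) p = 0 := by
  suffices h : ∀ u v : E3 × E3,
      (DForm.contract (extension S) (lagrangianArea vol)).d.val p ![u, v] +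
        (lagrangianArea vol).d.val p ![extensionVec S p, u, v] = 0 by
    refine ContinuousAlternatingMap.ext (M := E3 × E3) fun v => ?_
    rw [vec_two_eta v]
    exact h (v 0) (v 1)
  intro u v
  -- The terms in `u.2` and `v.2` cancel in Cartan's formula, and the fibre part DS(e) of the
  -- extension supplies the missing substitution: what remains is ℒ_S vol on (e, u.1, v.1).
  have h := DFunLike.congr_fun (hS.d_contract_vol hvol p.1) ![fib p, u.1, v.1]
  rw [d_contract_vol_eq hvol.1 hS.1] at h
  change _ = (0 : ℝ) at h
  rw [d_contract_extension_lagrangianArea hvol.1 hS.1, d_lagrangianArea hvol.1, extension_fst,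
    extension_snd hS.1]
  have h1 : vol.val p.1 ![fib p, fieldD S p.1 v.1, u.1] =
      -vol.val p.1 ![fib p, u.1, fieldD S p.1 v.1] := alt_three_swap₁₂ _ _ _ _
  have h2 : fderiv ℝ (fieldCoord S p.1) (extChartAt (𝓡 3) p.1 p.1) (fib p) =
      fieldD S p.1 (fib p) := rfl
  rw [h1, h2]
  linarith

end Geometry

/-! ### The Noether form given by a potential vector. -/

section Noether

variable {M : Type*} [TopologicalSpace M] [ChartedSpace (EuclideanSpace ℝ (Fin 3)) M]
  [IsManifold (𝓡 3) ∞ M]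

theorem contract_extension_pullback_proj {k : ℕ} (S : (x : M) → T3 x)
    (β : DForm (𝓡 3) M (k + 1)) (p : TM M) :
    (DForm.contract (extension S) (DForm.pullback (I := (𝓡 3).tangent) (proj (M := M)) β)).val p =
      (DForm.pullback (I := (𝓡 3).tangent) (proj (M := M)) (DForm.contract S β)).val p := by
  ext v
  rw [pullback_proj_val]
  have h1 : (DForm.contract (extension S)
      (DForm.pullback (I := (𝓡 3).tangent) (proj (M := M)) β)).val p v =
      (DForm.pullback (I := (𝓡 3).tangent) (proj (M := M)) β).val p
        (Matrix.vecCons (extensionVec S p) v) := rfl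
  have h2 : (DForm.contract S β).val p.1 (fun i => (v i).1) =
      β.val p.1 (Matrix.vecCons (fieldAt S p.1) fun i => (v i).1) := rfl
  rw [h1, h2, pullback_proj_val]
  congr 1
  funext i
  refine Fin.cases ?_ (fun i => ?_) i
  · exact extension_fst S p
  · rfl

variable {g : Metric M} {vol : DForm (𝓡 3) M 3} {H : ℝ} {Ξ S F : (x : M) → T3 x}

/-- The pullback to the tangent bundle of `S ⌟ Ξ ⌟ vol`. -/
def liftedContraction (vol : DForm (𝓡 3) M 3) (Ξ S : (x : M) → T3 x) :
    DForm (𝓡 3).tangent (TM M) 1 :=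
  DForm.pullback (proj (M := M)) (DForm.contract S (DForm.contract Ξ vol))

theorem liftedContraction_isSmooth (hvol : vol.IsSmooth) (hΞ : IsSmoothField Ξ)
    (hS : IsSmoothField S) : (liftedContraction vol Ξ S).IsSmooth :=
  (hS.contract_isSmooth (hΞ.contract_isSmooth hvol)).pullback contMDiff_tangent_proj

theorem contract_extension_lagrangian (p : TM M) :
    DForm.contract (extension S) (lagrangian vol Ξ H) p =
      DForm.contract (extension S) (lagrangianArea vol) p +
        (2 * H) • liftedContraction vol Ξ S p := by
  have h := contract_extension_pullback_proj S (DForm.contract Ξ vol) p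
  have h1 : (DForm.contract (extension S) (lagrangian vol Ξ H)).val p =
      (DForm.contract (extension S) (lagrangianArea vol)).val p +
        (2 * H) • (DForm.contract (extension S) (DForm.pullback (I := (𝓡 3).tangent)
          (proj (M := M)) (DForm.contract Ξ vol))).val p := rfl
  rw [h] at h1
  exact h1

theorem contract_extension_lagrangian_isSmooth (hvol : vol.IsSmooth) (hΞ : IsSmoothField Ξ)
    (hS : IsSmoothField S) : (DForm.contract (extension S) (lagrangian vol Ξ H)).IsSmooth := by
  have h := (contract_extension_lagrangianArea_isSmooth hvol hS).add
    ((liftedContraction_isSmooth hvol hΞ hS).const_smul (2 * H))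
  have h1 : DForm.contract (extension S) (lagrangian vol Ξ H) = fun p =>
      DForm.contract (extension S) (lagrangianArea vol) p +
        (2 * H) • liftedContraction vol Ξ S p := funext fun p => contract_extension_lagrangian p
  rw [h1]
  exact h

theorem DForm.lieDeriv_val {k : ℕ} (V : (p : TM M) → TangentSpace (𝓡 3).tangent p)
    (α : DForm (𝓡 3).tangent (TM M) (k + 1)) (p : TM M) (v : Fin (k + 1) → E3 × E3) :
    (DForm.lieDeriv V α).val p v =
      (DForm.contract V α).d.val p v + α.d.val p (Matrix.vecCons (fieldAt V p) v) := rfl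

/-- The form `φ` with `ℒ_S Λ = dφ` given by a potential vector of a Killing field. -/
def noetherPotential (g : Metric M) (vol : DForm (𝓡 3) M 3) (Ξ S F : (x : M) → T3 x) (H : ℝ) :
    DForm (𝓡 3).tangent (TM M) 1 := fun p =>
  (2 * H) • (fun q => liftedContraction vol Ξ S q +
    DForm.pullback (proj (M := M)) (flat g F) q : DForm (𝓡 3).tangent (TM M) 1) p

theorem pullback_flat_isSmooth (hF : IsSmoothField F) :
    (DForm.pullback (I := (𝓡 3).tangent) (proj (M := M)) (flat g F)).IsSmooth :=
  (flat_isSmooth g hF).pullback contMDiff_tangent_proj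

theorem noetherPotential_isSmooth (hvol : vol.IsSmooth) (hΞ : IsSmoothField Ξ)
    (hS : IsSmoothField S) (hF : IsSmoothField F) :
    (noetherPotential g vol Ξ S F H).IsSmooth :=
  ((liftedContraction_isSmooth hvol hΞ hS).add (pullback_flat_isSmooth hF)).const_smul (2 * H)

/-- The representative `S ⌟ Λ₀ - 2H F^♭` of the Noether form. -/
def noetherForm (g : Metric M) (vol : DForm (𝓡 3) M 3) (S F : (x : M) → T3 x) (H : ℝ) :
    DForm (𝓡 3).tangent (TM M) 1 := fun p =>
  DForm.contract (extension S) (lagrangianArea vol) p -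
    (2 * H) • DForm.pullback (proj (M := M)) (flat g F) p

theorem noetherForm_isSmooth (hvol : vol.IsSmooth) (hS : IsSmoothField S) (hF : IsSmoothField F) :
    (noetherForm g vol S F H).IsSmooth :=
  (contract_extension_lagrangianArea_isSmooth hvol hS).sub
    ((pullback_flat_isSmooth hF).const_smul (2 * H))

/-- Cartan's formula for the term π^*(Ξ ⌟ vol), where S ⌟ d(Ξ ⌟ vol) = S ⌟ vol. No Killing equation
is needed for this part. -/
theorem lieDeriv_lagrangian_val (hvol : vol.IsSmooth) (hΞ : IsVolumeField vol Ξ)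
    (hS : IsSmoothField S) (p : TM M) (v : Fin 2 → E3 × E3) :
    (DForm.lieDeriv (extension S) (lagrangian vol Ξ H)).val p v =
      (DForm.lieDeriv (extension S) (lagrangianArea vol)).val p v +
        2 * H * ((liftedContraction vol Ξ S).d.val p v +
          (DForm.pullback (I := (𝓡 3).tangent) (proj (M := M)) (DForm.contract S vol)).val p v) := by
  have hsc := liftedContraction_isSmooth hvol hΞ.1 hS
  have h1 : DForm.contract (extension S) (lagrangian vol Ξ H) = fun p =>
      DForm.contract (extension S) (lagrangianArea vol) p +
        (fun q => (2 * H) • liftedContraction vol Ξ S q : DForm (𝓡 3).tangent (TM M) 1) p :=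
    funext fun p => contract_extension_lagrangian p
  have h2 : (DForm.contract (extension S) (lagrangian vol Ξ H)).d p =
      (DForm.contract (extension S) (lagrangianArea vol)).d p +
        (2 * H) • (liftedContraction vol Ξ S).d p := by
    rw [h1, (contract_extension_lagrangianArea_isSmooth hvol hS).d_add (hsc.const_smul (2 * H)),
      DForm.d_const_smul]
  have h3 := DFunLike.congr_fun (F := (E3 × E3) [⋀^Fin 2]→L[ℝ] ℝ) h2 v
  have h3' : (DForm.contract (extension S) (lagrangian vol Ξ H)).d.val p v =
      (DForm.contract (extension S) (lagrangianArea vol)).d.val p v +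
        (2 * H) * (liftedContraction vol Ξ S).d.val p v := h3
  have h4 := d_lagrangian hvol hΞ H p (extensionVec S p) (v 0) (v 1)
  have h5 : Matrix.vecCons (fieldAt (extension S) p) v = ![extensionVec S p, v 0, v 1] := by
    funext i
    fin_cases i <;> rfl
  have h6 : (DForm.pullback (I := (𝓡 3).tangent) (proj (M := M)) (DForm.contract S vol)).val p v =
      vol.val p.1 ![(extensionVec S p).1, (v 0).1, (v 1).1] := by
    rw [pullback_proj_val, extension_fst]
    have : (DForm.contract S vol).val p.1 (fun i => (v i).1) =
      vol.val p.1 (Matrix.vecCons (fieldAt S p.1) fun i => (v i).1) := rfl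
    rw [this]
    congr 1
    funext i
    fin_cases i <;> rfl
  rw [DForm.lieDeriv_val, DForm.lieDeriv_val, h3', h5, h4, h6]
  ring

theorem d_noetherPotential_val (hvol : vol.IsSmooth) (hΞ : IsSmoothField Ξ)
    (hS : IsSmoothField S) (hF : IsPotentialVector g vol S F) (p : TM M) (v : Fin 2 → E3 × E3) :
    (noetherPotential g vol Ξ S F H).d.val p v =
      2 * H * ((liftedContraction vol Ξ S).d.val p v +
          (DForm.pullback (I := (𝓡 3).tangent) (proj (M := M)) (DForm.contract S vol)).val p v) := by
  have h1 : (noetherPotential g vol Ξ S F H).d p =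
      (2 * H) • ((liftedContraction vol Ξ S).d p +
        DForm.pullback (I := (𝓡 3).tangent) (proj (M := M)) (DForm.contract S vol) p) := by
    have hd : (flat g F).d = DForm.contract S vol := funext hF.2
    unfold noetherPotential
    rw [DForm.d_const_smul, (liftedContraction_isSmooth hvol hΞ hS).d_add
      (pullback_flat_isSmooth hF.1), (flat_isSmooth g hF.1).d_pullback contMDiff_tangent_proj, hd]
  exact DFunLike.congr_fun (F := (E3 × E3) [⋀^Fin 2]→L[ℝ] ℝ) h1 v

/-- The Λ₀ part has zero Lie derivative, and dF^♭ = S ⌟ vol makes the other part exact. The equality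
holds on all of TM, not only modulo the contact ideal on 𝒞. -/
theorem lieDeriv_lagrangian_eq_d_noetherPotential (hvol : IsVolumeForm g vol)
    (hΞ : IsVolumeField vol Ξ) (hS : IsKilling g S) (hF : IsPotentialVector g vol S F) (p : TM M) :
    DForm.lieDeriv (extension S) (lagrangian vol Ξ H) p =
      (noetherPotential g vol Ξ S F H).d p := by
  refine ContinuousAlternatingMap.ext (M := E3 × E3) fun v => ?_
  have h1 := lieDeriv_lagrangian_val (H := H) hvol.1 hΞ hS.1 p v
  have h2 := d_noetherPotential_val (H := H) hvol.1 hΞ.1 hS.1 hF p v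
  have h3 : (DForm.lieDeriv (extension S) (lagrangianArea vol)).val p v = 0 :=
    DFunLike.congr_fun (F := (E3 × E3) [⋀^Fin 2]→L[ℝ] ℝ) (hS.lieDeriv_lagrangianArea hvol p) v
  rw [h3, zero_add, ← h2] at h1
  exact h1

theorem DForm.zero_isSmooth {k : ℕ} :
    DForm.IsSmooth (I := (𝓡 3).tangent) (X := TM M) (k := k) (fun _ => 0) := by
  intro x₀
  have h : DForm.inChart (I := (𝓡 3).tangent) (X := TM M) (k := k) (fun _ => 0) x₀ = fun _ => 0 := by
    funext y
    rfl
  rw [h]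
  exact contDiffOn_const

theorem noetherForm_eq (p : TM M) : noetherForm g vol S F H p =
    DForm.contract (extension S) (lagrangian vol Ξ H) p - noetherPotential g vol Ξ S F H p := by
  rw [contract_extension_lagrangian]
  unfold noetherForm noetherPotential
  rw [smul_add]
  abel

/-- A potential vector `F` of a Killing field gives the Noether form `S ⌟ Λ₀ - 2H F^♭`. -/
theorem isNoetherForm_noetherForm (hvol : IsVolumeForm g vol)
    (hΞ : IsVolumeField vol Ξ) (hS : IsKilling g S) (hF : IsPotentialVector g vol S F) :
    IsNoetherForm g (lagrangian vol Ξ H) S (noetherForm g vol S F H) := by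
  -- Both congruences hold as equalities, so every coefficient in the contact ideal and in
  -- `SameClass` is zero.
  refine ⟨noetherForm_isSmooth hvol.1 hS.1 hF.1, noetherPotential g vol Ξ S F H,
    noetherPotential_isSmooth hvol.1 hΞ.1 hS.1 hF.1, ⟨fun _ => 0, fun _ => 0,
      DForm.zero_isSmooth, contMDiff_const, ?_⟩, ⟨fun _ => 0, fun _ => 0, contMDiff_const,
      contMDiff_const, ?_⟩⟩
  · intro p _ u _ v _
    have h := lieDeriv_lagrangian_eq_d_noetherPotential (H := H) hvol hΞ hS hF p
    simp only [h, sub_self]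
    have h0 : ∀ w : Fin 1 → E3 × E3, (0 : (E3 × E3) [⋀^Fin 1]→L[ℝ] ℝ) w = 0 := fun _ => rfl
    have h1 : ∀ w : Fin 2 → E3 × E3, (0 : (E3 × E3) [⋀^Fin 2]→L[ℝ] ℝ) w = 0 := fun _ => rfl
    refine (h1 _).trans ?_
    have e1 := h0 ![u]
    have e2 := h0 ![v]
    simp only [zero_mul, add_zero]
    symm
    calc _ = (0 : ℝ) * contactForm g p ![v] - 0 * contactForm g p ![u] := rfl
      _ = 0 := by simp
  · intro p _ w _
    have h1 := noetherForm_eq (g := g) (vol := vol) (S := S) (F := F) (H := H) (Ξ := Ξ) p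
    have h2 : dFun (𝓡 3).tangent (fun _ : TM M => (0 : ℝ)) p w = 0 := by
      unfold dFun
      rw [mfderiv_const]
      rfl
    rw [h1, h2]
    simp

end Noether

/-- The model space of the surfaces. -/
abbrev E2 : Type := EuclideanSpace ℝ (Fin 2)

theorem finrank_E2 : Module.finrank ℝ E2 = 2 := by simp

/-! ### The Legendrian lift and the forms that vanish on it. -/

section Surface

variable {M : Type*} [TopologicalSpace M] [ChartedSpace (EuclideanSpace ℝ (Fin 3)) M]
  [IsManifold (𝓡 3) ∞ M]
  {Sg : Type*} [TopologicalSpace Sg] [ChartedSpace (EuclideanSpace ℝ (Fin 2)) Sg]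

/-- The differential of `f : Σ → M` on the model spaces. -/
def immD (f : Sg → M) (s : Sg) : E2 →L[ℝ] E3 := tmap (𝓡 2) (𝓡 3) f s

/-- The differential of the Legendrian lift on the model spaces. -/
def liftD (f : Sg → M) (n : (s : Sg) → T3 (f s)) (s : Sg) : E2 →L[ℝ] E3 × E3 :=
  tmap (𝓡 2) (𝓡 3).tangent (lift f n) s

/-- The metric induced on the surface. -/
def inducedMetric (g : Metric M) (f : Sg → M) (s : Sg) : E2 →L[ℝ] E2 →L[ℝ] ℝ :=
  (metricAt g (f s)).bilinearComp (immD f s) (immD f s)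

variable {g : Metric M} {vol : DForm (𝓡 3) M 3} {f : Sg → M} {n : (s : Sg) → T3 (f s)}

theorem fib_lift (s : Sg) : fib (lift f n s) = n s := rfl

theorem IsImmersion.isInner_inducedMetric (hf : IsImmersion f) (s : Sg) :
    IsInner (inducedMetric g f s) := by
  refine ⟨fun v w => (isInner_metricAt g (f s)).symm _ _, fun v hv => ?_⟩
  refine (isInner_metricAt g (f s)).pos _ fun h => hv ?_
  exact hf.2 s (h.trans (map_zero (immD f s)).symm)

theorem IsUnitNormal.liftD_fst (hn : IsUnitNormal g f n) (s : Sg) (u : E2) :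
    (liftD f n s u).1 = immD f s u := by
  have h := mfderiv_comp (I := 𝓡 2) (I' := (𝓡 3).tangent) (I'' := 𝓡 3) s
    (g := proj (M := M)) (f := lift f n)
    (contMDiff_tangent_proj.contMDiffAt.mdifferentiableAt (by simp))
    (hn.1.contMDiffAt.mdifferentiableAt (by simp))
  have h1 : immD f s = (tmap (𝓡 3).tangent (𝓡 3) (proj (M := M)) (lift f n s)).comp
      (liftD f n s) := h
  rw [h1, ContinuousLinearMap.comp_apply, tmap_proj]

theorem IsUnitNormal.metricAt_normal_self (hn : IsUnitNormal g f n) (s : Sg) :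
    metricAt g (f s) (n s) (n s) = 1 := hn.2.1 s

theorem IsUnitNormal.metricAt_normal (hn : IsUnitNormal g f n) (s : Sg) (u : E2) :
    metricAt g (f s) (n s) (immD f s u) = 0 := hn.2.2 s u

theorem IsUnitNormal.exists_frame (hf : IsImmersion f) (hn : IsUnitNormal g f n) (s : Sg) :
    ∃ a b : E2, IsOrthonormal (inducedMetric g f s) ![a, b] ∧
      IsOrthonormal (metricAt g (f s)) ![n s, immD f s a, immD f s b] := by
  obtain ⟨e, he⟩ := (hf.isInner_inducedMetric (g := g) s).exists_isOrthonormal finrank_E2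
  have he' : ![e 0, e 1] = e := (vec_two_eta e).symm
  refine ⟨e 0, e 1, by rwa [he'], ?_⟩
  exact IsOrthonormal.three (isInner_metricAt g (f s)) (hn.metricAt_normal_self s) (he 0 0) (he 1 1)
    (hn.metricAt_normal s _) (hn.metricAt_normal s _) (he 0 1)

theorem pullback_lift_val {k : ℕ} (α : DForm (𝓡 3).tangent (TM M) k) (s : Sg) (v : Fin k → E2) :
    (DForm.pullback (I := 𝓡 2) (lift f n) α).val s v =
      α.val (lift f n s) (fun i => liftD f n s (v i)) := rfl

theorem pullback_lift_one (α : DForm (𝓡 3).tangent (TM M) 1) (s : Sg) (u : E2) :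
    (DForm.pullback (I := 𝓡 2) (lift f n) α).val s ![u] =
      α.val (lift f n s) ![liftD f n s u] := by
  rw [pullback_lift_val]
  congr 1
  funext i
  fin_cases i
  rfl

theorem pullback_lift_two (α : DForm (𝓡 3).tangent (TM M) 2) (s : Sg) (u v : E2) :
    (DForm.pullback (I := 𝓡 2) (lift f n) α).val s ![u, v] =
      α.val (lift f n s) ![liftD f n s u, liftD f n s v] := by
  rw [pullback_lift_val]
  congr 1
  funext i
  fin_cases i <;> rfl

theorem IsUnitNormal.contactForm_liftD (hn : IsUnitNormal g f n) (s : Sg) (u : E2) :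
    (contactForm g).val (lift f n s) ![liftD f n s u] = 0 := by
  rw [contactForm_val, hn.liftD_fst]
  exact hn.metricAt_normal s u

variable [IsManifold (𝓡 2) ∞ Sg]

theorem IsUnitNormal.dFun_liftD (hn : IsUnitNormal g f n) (s : Sg) (u : E2) :
    dFun (𝓡 3).tangent (normSq g) (lift f n s) (liftD f n s u) = 0 := by
  have h := (normSq_isSmoothFun g).dFun_comp hn.1 s u
  have h1 : (fun z => normSq g (lift f n z)) = fun _ => (1 : ℝ) := funext hn.2.1
  rw [h1] at h
  refine h.symm.trans ?_
  unfold dFun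
  rw [mfderiv_const]
  rfl

/-- Since N^*θ = 0 identically on the surface, N^*dθ = d(N^*θ) = 0. -/
theorem IsUnitNormal.d_contactForm_liftD (hn : IsUnitNormal g f n) (s : Sg) (u v : E2) :
    (contactForm g).d.val (lift f n s) ![liftD f n s u, liftD f n s v] = 0 := by
  -- Writing the vanishing form as 0 times itself lets the linearity of d conclude.
  have h0 : DForm.pullback (I := 𝓡 2) (lift f n) (contactForm g) = fun s =>
      (0 : ℝ) • DForm.pullback (I := 𝓡 2) (lift f n) (contactForm g) s := by
    funext s
    refine ContinuousAlternatingMap.ext (M := E2) fun w => ?_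
    have h1 : (DForm.pullback (I := 𝓡 2) (lift f n) (contactForm g)).val s w = 0 := by
      rw [vec_one_eta w, pullback_lift_one, hn.contactForm_liftD]
    refine h1.trans ?_
    have h2 : ∀ β : E2 [⋀^Fin 1]→L[ℝ] ℝ, ((0 : ℝ) • β) w = 0 := fun β => zero_mul _
    exact (h2 _).symm
  have h := (contactForm_isSmooth g).d_pullback hn.1 s
  rw [h0, DForm.d_const_smul] at h
  have h3 := DFunLike.congr_fun (F := E2 [⋀^Fin 2]→L[ℝ] ℝ) h ![u, v]
  have h4 := (pullback_lift_two (f := f) (n := n) (contactForm g).d s u v).symm.trans h3.symm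
  exact h4.trans (zero_mul _)

/-- For fixed W this is a 2-form in (u, v) on a plane, so it is enough that it vanish on one
orthonormal basis, where `IsVolumeForm.d_lagrangian_eq_zero` applies. -/
theorem IsCMC.d_lagrangian_eq_zero {Ξ : (x : M) → T3 x} {H : ℝ} (hvol : IsVolumeForm g vol)
    (hΞ : IsVolumeField vol Ξ) (hf : IsImmersion f) (hn : IsUnitNormal g f n)
    (hH : IsCMC g f n H) (s : Sg) {W : E3 × E3}
    (hW : dFun (𝓡 3).tangent (normSq g) (lift f n s) W = 0) (u v : E2) :
    (lagrangian vol Ξ H).d.val (lift f n s) ![W, liftD f n s u, liftD f n s v] = 0 := by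
  obtain ⟨a, b, hab, he⟩ := hn.exists_frame hf s
  let w : E2 [⋀^Fin 2]→L[ℝ] ℝ := (((lagrangian vol Ξ H).d.val (lift f n s)).curryLeft
    W).compContinuousLinearMap (liftD f n s)
  have hw : ∀ u v, w ![u, v] =
      (lagrangian vol Ξ H).d.val (lift f n s) ![W, liftD f n s u, liftD f n s v] := by
    intro u v
    change (lagrangian vol Ξ H).d.val (lift f n s) (Matrix.vecCons W _) = _
    congr 1
    funext i
    fin_cases i <;> rfl
  rw [← hw, hab.alt_eq_zero finrank_E2 w]
  · rfl
  rw [hw]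
  refine hvol.d_lagrangian_eq_zero hΞ ?_ hW (hn.dFun_liftD s a) (hn.dFun_liftD s b) ?_
  · rw [hn.liftD_fst, hn.liftD_fst]
    exact he
  · rw [hn.liftD_fst, hn.liftD_fst]
    exact hH s a b (hab 0 0) (hab 1 1) (hab 0 1)

/-- N^*θ = 0 removes the multiple of θ, and N^*db = d(b ∘ N). -/
theorem SameClass.cohomologous (hn : IsUnitNormal g f n)
    {μ ν : DForm (𝓡 3).tangent (TM M) 1} (h : SameClass g μ ν) :
    DForm.Cohomologous (DForm.pullback (I := 𝓡 2) (lift f n) μ) (DForm.pullback (lift f n) ν) := by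
  obtain ⟨a, b, ha, hb, h⟩ := h
  have key : ∀ (s : Sg) (u : E2), (DForm.pullback (I := 𝓡 2) (lift f n) μ).val s ![u] -
      (DForm.pullback (I := 𝓡 2) (lift f n) ν).val s ![u] =
      dFun (𝓡 2) (fun s => b (lift f n s)) s u := by
    intro s u
    have h2 : μ.val (lift f n s) ![liftD f n s u] - ν.val (lift f n s) ![liftD f n s u] =
      a (lift f n s) * (contactForm g).val (lift f n s) ![liftD f n s u] +
        dFun (𝓡 3).tangent b (lift f n s) (liftD f n s u) :=
      h (lift f n s) (hn.2.1 s) (liftD f n s u) (hn.dFun_liftD s u)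
    rw [hn.contactForm_liftD, mul_zero, zero_add] at h2
    rw [pullback_lift_one, pullback_lift_one, h2]
    exact (hb.dFun_comp hn.1 s u).symm
  exact ⟨fun s => b (lift f n s), hb.comp hn.1, key⟩

end Surface

/-- The standard basis of the model space of the surfaces. -/
def baseVec (i : Fin 2) : E2 := EuclideanSpace.single i (1 : ℝ)

/-! ### The pullbacks ⟨S, *df⟩ and ⟨F, df⟩. -/

section Surface

variable {M : Type*} [TopologicalSpace M] [ChartedSpace (EuclideanSpace ℝ (Fin 3)) M]
  [IsManifold (𝓡 3) ∞ M]
  {Sg : Type*} [TopologicalSpace Sg] [ChartedSpace (EuclideanSpace ℝ (Fin 2)) Sg]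
  {g : Metric M} {vol : DForm (𝓡 3) M 3} {f : Sg → M} {n : (s : Sg) → T3 (f s)}

theorem IsVolumeForm.val_mul_val (hvol : IsVolumeForm g vol) (x : M) (v v' : Fin 3 → E3) :
    vol.val x v * vol.val x v' = (Matrix.of fun i j => metricAt g x (v i) (v' j)).det := by
  obtain ⟨e, he⟩ := (isInner_metricAt g x).exists_isOrthonormal finrank_E3
  exact he.alt_mul finrank_E3 _ (hvol.val_frame x he) v v'

/-- A 2-form on a plane that vanishes on a basis is zero, whereas the area form is ±1 on an adapted
orthonormal frame. This makes the division in `rotation` legitimate. -/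
theorem IsUnitNormal.areaForm_coordVec_ne_zero (hvol : IsVolumeForm g vol) (hf : IsImmersion f)
    (hn : IsUnitNormal g f n) (s : Sg) : areaForm vol f n s (coordVec s 0) (coordVec s 1) ≠ 0 := by
  intro h
  obtain ⟨a, b, hab, he⟩ := hn.exists_frame hf s
  let w : E2 [⋀^Fin 2]→L[ℝ] ℝ :=
    ((vol.val (f s)).curryLeft (n s)).compContinuousLinearMap (immD f s)
  have hw : ∀ u v, w ![u, v] = vol.val (f s) ![n s, immD f s u, immD f s v] := by
    intro u v
    change vol.val (f s) (Matrix.vecCons (n s) _) = _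
    congr 1
    funext i
    fin_cases i <;> rfl
  -- The coordinate basis is orthonormal for the Euclidean product of the model plane, which need
  -- not be the induced metric.
  have hc : IsOrthonormal (innerSL ℝ (E := E2))
      ![baseVec 0, baseVec 1] := by
    intro i j
    have hi : ∀ i j : Fin 2, inner ℝ (baseVec i) (baseVec j) = if i = j then (1 : ℝ) else 0 := by
      exact orthonormal_iff_ite.1 EuclideanSpace.orthonormal_single
    fin_cases i <;> fin_cases j <;> exact hi _ _
  have h0 : w = 0 := hc.alt_eq_zero finrank_E2 w ((hw _ _).trans h)
  refine hvol.val_ne_zero (f s) he ?_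
  rw [← hw, h0]
  rfl

theorem minimalPart_val (S : (x : M) → T3 x) (s : Sg) (u : E2) :
    (minimalPart g vol f n S).val s ![u] =
      -((areaForm vol f n s (coordVec s 0) (coordVec s 1))⁻¹ *
        (metricAt g (f s) (immD f s (baseVec 0)) (immD f s u) *
          metricAt g (f s) (fieldAt S (f s)) (immD f s (baseVec 1)) -
        metricAt g (f s) (immD f s (baseVec 1)) (immD f s u) *
          metricAt g (f s) (fieldAt S (f s)) (immD f s (baseVec 0)))) := by
  have h : (minimalPart g vol f n S).val s ![u] = metricAt g (f s) (fieldAt S (f s))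
      (-(immD f s ((areaForm vol f n s (coordVec s 0) (coordVec s 1))⁻¹ •
        ((metricAt g (f s) (immD f s (baseVec 0)) (immD f s u)) • baseVec 1 -
          (metricAt g (f s) (immD f s (baseVec 1)) (immD f s u)) • baseVec 0)))) := rfl
  rw [h, map_neg, map_smul, map_smul]
  have h1 : ∀ (r t : ℝ) (x y : E2), metricAt g (f s) (fieldAt S (f s))
      (immD f s (r • x - t • y)) = r * metricAt g (f s) (fieldAt S (f s)) (immD f s x) -
        t * metricAt g (f s) (fieldAt S (f s)) (immD f s y) := by
    intro r t x y
    rw [map_sub, map_smul, map_smul, map_sub, map_smul, map_smul]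
    rfl
  exact congrArg (fun t => -((areaForm vol f n s (coordVec s 0) (coordVec s 1))⁻¹ * t)) (h1 _ _ _ _)

variable [IsManifold (𝓡 2) ∞ Sg]

/-- At s the left side is vol(n, S, df u). Its product with the area of the coordinate basis (b₀,
b₁) is the Gram determinant of (n, df b₀, df b₁) against (n, S, df u). Since n is unit and normal,
this reduces to the 2 × 2 determinant defining ⟨S, *df⟩. -/
theorem IsUnitNormal.pullback_contract_lagrangianArea (hvol : IsVolumeForm g vol)
    (hf : IsImmersion f) (hn : IsUnitNormal g f n) (S : (x : M) → T3 x) :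
    DForm.pullback (I := 𝓡 2) (lift f n)
      (DForm.contract (extension S) (lagrangianArea vol)) = minimalPart g vol f n S := by
  funext s
  refine ContinuousAlternatingMap.ext (M := E2) fun w => ?_
  have key : ∀ u : E2, (DForm.pullback (I := 𝓡 2) (lift f n)
      (DForm.contract (extension S) (lagrangianArea vol))).val s ![u] =
      (minimalPart g vol f n S).val s ![u] := by
    intro u
    rw [pullback_lift_one, minimalPart_val]
    have h1 : (DForm.contract (extension S) (lagrangianArea vol)).val (lift f n s)
        ![liftD f n s u] = (lagrangianArea vol).val (lift f n s)
          ![extensionVec S (lift f n s), liftD f n s u] := rfl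
    rw [h1, lagrangianArea_val, extension_fst, hn.liftD_fst]
    have h2 := hvol.val_mul_val (f s)
      ![n s, immD f s (baseVec 0), immD f s (baseVec 1)]
      ![n s, fieldAt S (f s), immD f s u]
    have hA := hn.areaForm_coordVec_ne_zero hvol hf s
    have h3 : areaForm vol f n s (coordVec s 0) (coordVec s 1) = vol.val (f s)
      ![n s, immD f s (baseVec 0), immD f s (baseVec 1)] := rfl
    rw [h3] at hA ⊢
    rw [Matrix.det_fin_three] at h2
    have e1 := hn.metricAt_normal_self s
    have e2 := hn.metricAt_normal s u
    have e3 := (isInner_metricAt g (f s)).symm (immD f s (baseVec 0)) (n s)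
    have e4 := (isInner_metricAt g (f s)).symm (immD f s (baseVec 1)) (n s)
    rw [hn.metricAt_normal] at e3 e4
    have e5 := (isInner_metricAt g (f s)).symm (immD f s (baseVec 0)) (fieldAt S (f s))
    have e6 := (isInner_metricAt g (f s)).symm (immD f s (baseVec 1)) (fieldAt S (f s))
    have h4 : vol.val (f s) ![n s, immD f s (baseVec 0), immD f s (baseVec 1)] *
        vol.val (f s) ![n s, fieldAt S (f s), immD f s u] =
        metricAt g (f s) (immD f s (baseVec 0)) (fieldAt S (f s)) *
          metricAt g (f s) (immD f s (baseVec 1)) (immD f s u) -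
        metricAt g (f s) (immD f s (baseVec 0)) (immD f s u) *
          metricAt g (f s) (immD f s (baseVec 1)) (fieldAt S (f s)) := by
      refine h2.trans ?_
      change metricAt g (f s) (n s) (n s) * _ * _ - metricAt g (f s) (n s) (n s) * _ * _ -
        _ * metricAt g (f s) (immD f s (baseVec 0)) (n s) * _ +
        _ * _ * metricAt g (f s) (immD f s (baseVec 1)) (n s) +
        metricAt g (f s) (n s) (immD f s u) * _ * _ -
        metricAt g (f s) (n s) (immD f s u) * _ * _ = _
      rw [e1, e2, e3, e4]
      simp only [one_mul, mul_zero, zero_mul, add_zero, sub_zero]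
      rfl
    rw [e5, e6] at h4
    -- Multiply by the nonzero area of the coordinate basis to reach the Gram identity.
    rw [eq_comm, ← neg_mul, ← mul_right_inj' hA, fib_lift]
    refine Eq.trans ?_ h4.symm
    have h5 := mul_inv_cancel₀ hA
    linear_combination (-1 : ℝ) * (metricAt g (f s) (immD f s (baseVec 0)) (immD f s u) *
          metricAt g (f s) (fieldAt S (f s)) (immD f s (baseVec 1)) -
        metricAt g (f s) (immD f s (baseVec 1)) (immD f s u) *
          metricAt g (f s) (fieldAt S (f s)) (immD f s (baseVec 0))) * h5
  have hw := vec_one_eta w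
  have h := key (w 0)
  rw [← hw] at h
  exact h

theorem IsUnitNormal.pullback_flat (hn : IsUnitNormal g f n) (F : (x : M) → T3 x) :
    DForm.pullback (I := 𝓡 2) (lift f n)
      (DForm.pullback (I := (𝓡 3).tangent) (proj (M := M)) (flat g F)) = cmcPart g f F := by
  funext s
  refine ContinuousAlternatingMap.ext (M := E2) fun w => ?_
  have key : (DForm.pullback (I := 𝓡 2) (lift f n)
      (DForm.pullback (I := (𝓡 3).tangent) (proj (M := M)) (flat g F))).val s w =
      metricAt g (f s) (fieldAt F (f s)) (immD f s (w 0)) := by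
    rw [pullback_lift_val, pullback_proj_val, ← hn.liftD_fst]
    rfl
  exact key

end Surface

/-! ### Closedness of the pullbacks of Noether forms. -/

section Surface

variable {M : Type*} [TopologicalSpace M] [ChartedSpace (EuclideanSpace ℝ (Fin 3)) M]
  [IsManifold (𝓡 3) ∞ M]
  {Sg : Type*} [TopologicalSpace Sg] [ChartedSpace (EuclideanSpace ℝ (Fin 2)) Sg]
  [IsManifold (𝓡 2) ∞ Sg]
  {g : Metric M} {vol : DForm (𝓡 3) M 3} {f : Sg → M} {n : (s : Sg) → T3 (f s)}
  {Ξ S : (x : M) → T3 x} {H : ℝ}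

theorem SameClass.isClosed_pullback (hn : IsUnitNormal g f n)
    {μ ν : DForm (𝓡 3).tangent (TM M) 1} (h : SameClass g μ ν) (hμ : μ.IsSmooth) (hν : ν.IsSmooth)
    (hd : ∀ s (u v : E2), ν.d.val (lift f n s) ![liftD f n s u, liftD f n s v] = 0) :
    (DForm.pullback (I := 𝓡 2) (lift f n) μ).IsClosed := by
  obtain ⟨b, hb, h⟩ := h.cohomologous hn
  refine ⟨hμ.pullback hn.1, fun s => ?_⟩
  have h1 : DForm.pullback (I := 𝓡 2) (lift f n) μ = fun s =>
      DForm.pullback (I := 𝓡 2) (lift f n) ν s + (DForm.ofFun (𝓡 2) b).d s := by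
    funext s
    refine ContinuousAlternatingMap.ext (M := E2) fun w => ?_
    have key : ∀ u : E2, (DForm.pullback (I := 𝓡 2) (lift f n) μ).val s ![u] =
        (DForm.pullback (I := 𝓡 2) (lift f n) ν).val s ![u] +
          (DForm.ofFun (𝓡 2) b).d.val s ![u] := by
      intro u
      rw [hb.d_ofFun]
      exact sub_eq_iff_eq_add'.1 (h s u)
    have h2 := key (w 0)
    rw [← vec_one_eta w] at h2
    exact h2
  rw [h1, (hν.pullback hn.1).d_add hb.ofFun.d, hb.ofFun.d_d, hν.d_pullback hn.1]
  refine ContinuousAlternatingMap.ext (M := E2) fun w => ?_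
  have h3 : (DForm.pullback (I := 𝓡 2) (lift f n) ν.d).val s w = 0 := by
    rw [vec_two_eta w, pullback_lift_two, hd]
  refine Eq.trans ?_ h3
  exact add_zero _

theorem IsUnitNormal.inContactIdeal_liftD (hn : IsUnitNormal g f n)
    {β : DForm (𝓡 3).tangent (TM M) 2} (h : InContactIdeal g β) (s : Sg) (u v : E2) :
    β.val (lift f n s) ![liftD f n s u, liftD f n s v] = 0 := by
  obtain ⟨α, b, -, -, h⟩ := h
  have h1 : β.val (lift f n s) ![liftD f n s u, liftD f n s v] =
      (α.val (lift f n s) ![liftD f n s u] * (contactForm g).val (lift f n s) ![liftD f n s v] -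
        α.val (lift f n s) ![liftD f n s v] * (contactForm g).val (lift f n s) ![liftD f n s u]) +
      b (lift f n s) * (contactForm g).d.val (lift f n s) ![liftD f n s u, liftD f n s v] :=
    h _ (hn.2.1 s) _ (hn.dFun_liftD s u) _ (hn.dFun_liftD s v)
  rw [h1, hn.d_contactForm_liftD, hn.contactForm_liftD, hn.contactForm_liftD]
  ring

/-- A vector tangent to the unit tangent bundle and projecting to `e` at `(x, e)`. -/
theorem exists_tangent_fst_eq_fib (g : Metric M) {p : TM M} (hp : p ∈ UM g) :
    ∃ w : E3 × E3, w.1 = fib p ∧ dFun (𝓡 3).tangent (normSq g) p w = 0 := by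
  -- The fibre component λe must satisfy Dg(e; e, e) + 2λ⟨e, e⟩ = 0 with ⟨e, e⟩ = 1.
  refine ⟨(fib p, (-(metricD g p.1 (fib p) (fib p) (fib p)) / 2) • fib p), rfl, ?_⟩
  have h : metricAt g p.1 (fib p) (fib p) = 1 := hp
  rw [dFun_normSq, map_smul, smul_apply, h]
  simp only [smul_eq_mul]
  ring

/-- Evaluate dΛ = θ ∧ Ψ on (w, dN u, dN v) with θ(w) = 1: θ vanishes on the last two vectors, so
Ψ(dN u, dN v) equals the value of dΛ, which is zero. -/
theorem IsEulerLagrangeOperator.liftD_eq_zero (hvol : IsVolumeForm g vol)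
    (hΞ : IsVolumeField vol Ξ) (hf : IsImmersion f) (hn : IsUnitNormal g f n)
    (hH : IsCMC g f n H) {Ψ : DForm (𝓡 3).tangent (TM M) 2}
    (hΨ : IsEulerLagrangeOperator g (lagrangian vol Ξ H) Ψ) (s : Sg) (u v : E2) :
    Ψ.val (lift f n s) ![liftD f n s u, liftD f n s v] = 0 := by
  obtain ⟨w, hw, hw'⟩ := exists_tangent_fst_eq_fib g (hn.2.1 s)
  have h1 : (lagrangian vol Ξ H).d.val (lift f n s) ![w, liftD f n s u, liftD f n s v] =
      (contactForm g).val (lift f n s) ![w] *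
        Ψ.val (lift f n s) ![liftD f n s u, liftD f n s v] -
      (contactForm g).val (lift f n s) ![liftD f n s u] *
        Ψ.val (lift f n s) ![w, liftD f n s v] +
      (contactForm g).val (lift f n s) ![liftD f n s v] *
        Ψ.val (lift f n s) ![w, liftD f n s u] :=
    hΨ.2 _ (hn.2.1 s) _ hw' _ (hn.dFun_liftD s u) _ (hn.dFun_liftD s v)
  have h2 : (contactForm g).val (lift f n s) ![w] = 1 := by
    rw [contactForm_val, hw]
    exact hn.metricAt_normal_self s
  rw [hH.d_lagrangian_eq_zero hvol hΞ hf hn s hw', hn.contactForm_liftD, hn.contactForm_liftD,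
    h2] at h1
  linarith

theorem IsUnitNormal.inEulerLagrangeSystem_liftD (hvol : IsVolumeForm g vol)
    (hΞ : IsVolumeField vol Ξ) (hf : IsImmersion f) (hn : IsUnitNormal g f n)
    (hH : IsCMC g f n H) {β : DForm (𝓡 3).tangent (TM M) 2}
    (h : InEulerLagrangeSystem g (lagrangian vol Ξ H) β) (s : Sg) (u v : E2) :
    β.val (lift f n s) ![liftD f n s u, liftD f n s v] = 0 := by
  obtain ⟨Ψ, c, hΨ, -, h⟩ := h
  have h1 : β.val (lift f n s) ![liftD f n s u, liftD f n s v] -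
      c (lift f n s) * Ψ.val (lift f n s) ![liftD f n s u, liftD f n s v] = 0 :=
    hn.inContactIdeal_liftD h s u v
  rw [hΨ.liftD_eq_zero hvol hΞ hf hn hH] at h1
  linarith

/-- By Cartan's formula d(S ⌟ Λ) = ℒ_S Λ - S ⌟ dΛ, and S ⌟ dΛ vanishes along the lift because the
Killing condition `hS.2` says that the extension of S is tangent to 𝒞. What is asked of ℒ_S Λ - dφ
is kept to its vanishing along the lift, which both kinds of Noether form supply. -/
theorem isClosed_pullback_of_lieDeriv (hvol : IsVolumeForm g vol)
    (hΞ : IsVolumeField vol Ξ) (hS : IsKilling g S) (hf : IsImmersion f) (hn : IsUnitNormal g f n)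
    (hH : IsCMC g f n H) {μ φ : DForm (𝓡 3).tangent (TM M) 1} (hμ : μ.IsSmooth) (hφ : φ.IsSmooth)
    (hd : ∀ s (u v : E2), (DForm.lieDeriv (extension S) (lagrangian vol Ξ H)).val (lift f n s)
        ![liftD f n s u, liftD f n s v] = φ.d.val (lift f n s) ![liftD f n s u, liftD f n s v])
    (h : SameClass g μ (fun p => DForm.contract (extension S) (lagrangian vol Ξ H) p - φ p)) :
    (DForm.pullback (I := 𝓡 2) (lift f n) μ).IsClosed := by
  have hc := contract_extension_lagrangian_isSmooth (H := H) hvol.1 hΞ.1 hS.1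
  refine h.isClosed_pullback hn hμ (hc.sub hφ) fun s u v => ?_
  have h1 := DFunLike.congr_fun (F := (E3 × E3) [⋀^Fin 2]→L[ℝ] ℝ) (hc.d_sub hφ (lift f n s))
    ![liftD f n s u, liftD f n s v]
  refine h1.trans ?_
  have h2 := hd s u v
  have h4 : Matrix.vecCons (fieldAt (extension S) (lift f n s))
      ![liftD f n s u, liftD f n s v] =
      ![extensionVec S (lift f n s), liftD f n s u, liftD f n s v] := rfl
  rw [DForm.lieDeriv_val, h4,
    hH.d_lagrangian_eq_zero (W := extensionVec S (lift f n s)) hvol hΞ hf hn s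
      (hS.2 (lift f n s)), add_zero] at h2
  exact sub_eq_zero.2 h2

theorem IsWeakNoetherForm.isClosed_pullback (hvol : IsVolumeForm g vol)
    (hΞ : IsVolumeField vol Ξ) (hS : IsKilling g S) (hf : IsImmersion f) (hn : IsUnitNormal g f n)
    (hH : IsCMC g f n H) {μ : DForm (𝓡 3).tangent (TM M) 1}
    (hμ : IsWeakNoetherForm g (lagrangian vol Ξ H) S μ) :
    (DForm.pullback (I := 𝓡 2) (lift f n) μ).IsClosed := by
  obtain ⟨hμ, φ, hφ, h1, h2⟩ := hμ
  exact isClosed_pullback_of_lieDeriv hvol hΞ hS hf hn hH hμ hφ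
    (fun s u v => sub_eq_zero.1 (hn.inEulerLagrangeSystem_liftD hvol hΞ hf hH h1 s u v)) h2

/-- This is not read off from the wide sense: `InEulerLagrangeSystem` carries an operator Ψ, whose
existence is thus not needed here. -/
theorem IsNoetherForm.isClosed_pullback (hvol : IsVolumeForm g vol)
    (hΞ : IsVolumeField vol Ξ) (hS : IsKilling g S) (hf : IsImmersion f) (hn : IsUnitNormal g f n)
    (hH : IsCMC g f n H) {μ : DForm (𝓡 3).tangent (TM M) 1}
    (hμ : IsNoetherForm g (lagrangian vol Ξ H) S μ) :
    (DForm.pullback (I := 𝓡 2) (lift f n) μ).IsClosed := by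
  obtain ⟨hμ, φ, hφ, h1, h2⟩ := hμ
  exact isClosed_pullback_of_lieDeriv hvol hΞ hS hf hn hH hμ hφ
    (fun s u v => sub_eq_zero.1 (hn.inContactIdeal_liftD h1 s u v)) h2

theorem IsUnitNormal.pullback_noetherForm (hvol : IsVolumeForm g vol) (hf : IsImmersion f)
    (hn : IsUnitNormal g f n) (S F : (x : M) → T3 x) (H : ℝ) :
    DForm.pullback (I := 𝓡 2) (lift f n) (noetherForm g vol S F H) = fun s =>
      minimalPart g vol f n S s - (2 * H) • cmcPart g f F s := by
  rw [← hn.pullback_contract_lagrangianArea hvol hf, ← hn.pullback_flat]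
  rfl

end Surface

/-! ### Consequences of dψ = a ∧ t in a vector space. -/

section Wedge

variable {V : Type*} [NormedAddCommGroup V] [NormedSpace ℝ V] [FiniteDimensional ℝ V]

/-- From d(dψ) = 0 one gets da ∧ t = a ∧ dt, and the left side vanishes on vectors of ker t. -/
theorem extDeriv_eq_wedge {ψ a t : V → V [⋀^Fin 1]→L[ℝ] ℝ} {y₀ : V}
    (hψ : ContDiffAt ℝ ∞ ψ y₀) (ha : ContDiffAt ℝ ∞ a y₀) (ht : ContDiffAt ℝ ∞ t y₀)
    (h : ∀ᶠ y in 𝓝 y₀, ∀ u v, extDeriv ψ y ![u, v] =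
      a y ![u] * t y ![v] - a y ![v] * t y ![u]) {u v w : V}
    (hu : t y₀ ![u] = 0) (hv : t y₀ ![v] = 0) (hw : t y₀ ![w] = 0) :
    a y₀ ![u] * extDeriv t y₀ ![v, w] - a y₀ ![v] * extDeriv t y₀ ![u, w] +
      a y₀ ![w] * extDeriv t y₀ ![u, v] = 0 := by
  have hdd : extDeriv (extDeriv ψ) y₀ = 0 := extDeriv_extDeriv_apply hψ two_le_infty
  have ha' : ∀ x, DifferentiableAt ℝ (fun y => a y ![x]) y₀ := fun x =>
    (contDiffAt_alt_apply (v := fun _ => ![x]) ha fun _ => contDiffAt_const).differentiableAt (by simp)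
  have ht' : ∀ x, DifferentiableAt ℝ (fun y => t y ![x]) y₀ := fun x =>
    (contDiffAt_alt_apply (v := fun _ => ![x]) ht fun _ => contDiffAt_const).differentiableAt (by simp)
  -- The derivatives of `a` are multiplied by values of `t` that vanish at `y₀`.
  have hD : ∀ x y z : V, t y₀ ![x] = 0 → t y₀ ![y] = 0 →
      fderiv ℝ (fun q => extDeriv ψ q ![x, y]) y₀ z =
        a y₀ ![x] * fderiv ℝ (fun q => t q ![y]) y₀ z -
          a y₀ ![y] * fderiv ℝ (fun q => t q ![x]) y₀ z := by
    intro x y z hx hy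
    have h1 : (fun q => extDeriv ψ q ![x, y]) =ᶠ[𝓝 y₀] fun q =>
        a q ![x] * t q ![y] - a q ![y] * t q ![x] := h.mono fun q hq => hq x y
    rw [h1.fderiv_eq, fderiv_fun_sub ((ha' x).fun_mul (ht' y)) ((ha' y).fun_mul (ht' x)),
      fderiv_fun_mul (ha' x) (ht' y), fderiv_fun_mul (ha' y) (ht' x), hx, hy]
    simp
  have hψ' : DifferentiableAt ℝ (extDeriv ψ) y₀ := by
    have h1 : ContDiffAt ℝ ∞ (extDeriv ψ) y₀ := by
      refine contDiffAt_alt_of_apply fun x => ?_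
      have h2 : (fun q => extDeriv ψ q x) =ᶠ[𝓝 y₀] fun q =>
          a q ![x 0] * t q ![x 1] - a q ![x 1] * t q ![x 0] := by
        filter_upwards [h] with q hq
        rw [← hq, ← vec_two_eta x]
      have ha'' : ∀ x, ContDiffAt ℝ ∞ (fun y => a y ![x]) y₀ := fun x =>
        contDiffAt_alt_apply (v := fun _ => ![x]) ha fun _ => contDiffAt_const
      have ht'' : ∀ x, ContDiffAt ℝ ∞ (fun y => t y ![x]) y₀ := fun x =>
        contDiffAt_alt_apply (v := fun _ => ![x]) ht fun _ => contDiffAt_const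
      exact (((ha'' _).mul (ht'' _)).sub ((ha'' _).mul (ht'' _))).congr_of_eventuallyEq h2
    exact h1.differentiableAt (by simp)
  have h0 : extDeriv (extDeriv ψ) y₀ ![u, v, w] = 0 := by rw [hdd]; rfl
  rw [extDeriv_two_apply hψ', hD v w u hv hw, hD u w v hu hw, hD u v w hu hv] at h0
  rw [extDeriv_one_apply (ht.differentiableAt (by simp)),
    extDeriv_one_apply (ht.differentiableAt (by simp)),
    extDeriv_one_apply (ht.differentiableAt (by simp))]
  linear_combination -h0

/-- The relation `a ∧ dt = 0` on `ker t`, when `dψ = a ∧ t` on the image of `R`. -/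
theorem extDeriv_eq_wedge_of_retraction {ψ a t : V → V [⋀^Fin 1]→L[ℝ] ℝ} {R : V → V} {y₀ : V}
    (hR₀ : R y₀ = y₀) (hR : ContDiffAt ℝ ∞ R y₀)
    (hψ : ContDiffAt ℝ ∞ ψ y₀) (ha : ContDiffAt ℝ ∞ a y₀) (ht : ContDiffAt ℝ ∞ t y₀)
    (h : ∀ᶠ y in 𝓝 y₀, ∀ u v, extDeriv ψ (R y) ![fderiv ℝ R y u, fderiv ℝ R y v] =
      a (R y) ![fderiv ℝ R y u] * t (R y) ![fderiv ℝ R y v] -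
        a (R y) ![fderiv ℝ R y v] * t (R y) ![fderiv ℝ R y u]) {u v w : V}
    (hu : t y₀ ![u] = 0) (hv : t y₀ ![v] = 0) (hw : t y₀ ![w] = 0)
    (hu' : fderiv ℝ R y₀ u = u) (hv' : fderiv ℝ R y₀ v = v) (hw' : fderiv ℝ R y₀ w = w) :
    a y₀ ![u] * extDeriv t y₀ ![v, w] - a y₀ ![v] * extDeriv t y₀ ![u, w] +
      a y₀ ![w] * extDeriv t y₀ ![u, v] = 0 := by
  have hfR : ContDiffAt ℝ ∞ (fderiv ℝ R) y₀ := hR.fderiv_right (by simp)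
  have hpull : ∀ b : V → V [⋀^Fin 1]→L[ℝ] ℝ, ContDiffAt ℝ ∞ b y₀ → ContDiffAt ℝ ∞
      (fun y => (b (R y)).compContinuousLinearMap (fderiv ℝ R y)) y₀ := fun b hb =>
    contDiffAt_compContinuousLinearMap (ContDiffAt.comp y₀ (hR₀.symm ▸ hb) hR) hfR
  have h1 : ∀ (b : V [⋀^Fin 1]→L[ℝ] ℝ) (L : V →L[ℝ] V) (x : V),
      b.compContinuousLinearMap L ![x] = b ![L x] := by
    intro b L x
    change b _ = _
    congr 1
    funext i
    fin_cases i
    rfl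
  have h2 : ∀ (b : V [⋀^Fin 2]→L[ℝ] ℝ) (L : V →L[ℝ] V) (x y : V),
      b.compContinuousLinearMap L ![x, y] = b ![L x, L y] := by
    intro b L x y
    change b _ = _
    congr 1
    funext i
    fin_cases i <;> rfl
  have hcont : Tendsto R (𝓝 y₀) (𝓝 y₀) := by
    have := hR.continuousAt
    unfold ContinuousAt at this
    rwa [hR₀] at this
  have hψe : ∀ᶠ y in 𝓝 y₀, DifferentiableAt ℝ ψ (R y) := by
    refine hcont.eventually ?_
    filter_upwards [(hψ.of_le (m := 1) (by simp)).eventually (by simp)] with y hy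
    exact hy.differentiableAt (by simp)
  -- Smoothness of order ∞ at a point gives a neighbourhood only for each finite order; order two is
  -- enough for R^* to commute with d.
  have hRe : ∀ᶠ y in 𝓝 y₀, ContDiffAt ℝ 2 R y := (hR.of_le (m := 2) (by
    exact WithTop.coe_le_coe.2 le_top)).eventually (by simp)
  have htd : extDeriv (fun y => (t (R y)).compContinuousLinearMap (fderiv ℝ R y)) y₀ =
      (extDeriv t (R y₀)).compContinuousLinearMap (fderiv ℝ R y₀) :=
    extDeriv_pullback (r := ∞) (hR₀.symm ▸ ht.differentiableAt (by simp)) hR two_le_infty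
  -- The pullbacks by R satisfy the wedge relation on all vectors near `y₀`, and at `y₀` the
  -- derivative of R fixes u, v and w.
  have key := extDeriv_eq_wedge (u := u) (v := v) (w := w) (hpull ψ hψ) (hpull a ha) (hpull t ht)
    (by
      filter_upwards [h, hψe, hRe] with y hy hψy hRy u v
      rw [extDeriv_pullback (r := 2) hψy hRy (by rw [minSmoothness_of_isRCLikeNormedField]), h2,
        h1, h1, h1, h1]
      exact hy u v)
    (by rw [h1, hR₀, hu', hu]) (by rw [h1, hR₀, hv', hv]) (by rw [h1, hR₀, hw', hw])
  rwa [htd, h1, h1, h1, h2, h2, h2, hR₀, hu', hv', hw'] at key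

end Wedge

/-! ### Retraction onto the unit tangent bundle. -/

section Contact

variable {M : Type*} [TopologicalSpace M] [ChartedSpace (EuclideanSpace ℝ (Fin 3)) M]
  [IsManifold (𝓡 3) ∞ M] {g : Metric M}

/-- The function `⟨e, e⟩` in the chart of `TM` at `p`. -/
def normSqCoord (g : Metric M) (p : TM M) (y : E3 × E3) : ℝ :=
  normSq g ((extChartAt (𝓡 3).tangent p).symm y)

theorem normSqCoord_eq (p : TM M) {y : E3 × E3} (hy : y.1 ∈ (extChartAt (𝓡 3) p.1).target) :
    normSqCoord g p y = metricCoord g p.1 y.1 y.2 y.2 := normSq_symm g p y hy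

theorem mem_tangent_target {p : TM M} {y : E3 × E3} :
    y ∈ (extChartAt (𝓡 3).tangent p).target ↔ y.1 ∈ (extChartAt (𝓡 3) p.1).target := by
  rw [tangent_chart_target]

theorem contDiffAt_normSqCoord (p : TM M) {y : E3 × E3}
    (hy : y.1 ∈ (extChartAt (𝓡 3) p.1).target) : ContDiffAt ℝ ∞ (normSqCoord g p) y :=
  (normSq_isSmoothFun g).contDiffAt (mem_tangent_target.2 hy)

theorem normSqCoord_ctr {p : TM M} (hp : p ∈ UM g) : normSqCoord g p (ctr p) = 1 := by
  unfold normSqCoord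
  rw [← tangent_chart_self, extChartAt_to_inv]
  exact hp

theorem fderiv_normSqCoord (p : TM M) {y : E3 × E3}
    (hy : y.1 ∈ (extChartAt (𝓡 3) p.1).target) (u : E3 × E3) :
    fderiv ℝ (normSqCoord g p) y u =
      dFun (𝓡 3).tangent (normSq g) ((extChartAt (𝓡 3).tangent p).symm y)
        (chartD (𝓡 3).tangent p y u) := by
  have h := mfderiv_comp (I := 𝓘(ℝ, E3 × E3)) (I' := (𝓡 3).tangent) (I'' := 𝓘(ℝ, ℝ)) y
    (g := normSq g) (f := (extChartAt (𝓡 3).tangent p).symm)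
    ((normSq_isSmoothFun g).mdifferentiableAt (by simp))
    (mdifferentiableAt_chart_symm (mem_tangent_target.2 hy))
  rw [mfderiv_eq_fderiv] at h
  exact DFunLike.congr_fun h u

theorem fderiv_normSqCoord_ctr (p : TM M) (u : E3 × E3) :
    fderiv ℝ (normSqCoord g p) (ctr p) u = dFun (𝓡 3).tangent (normSq g) p u := by
  have h := dFun_eq_fderiv (I := (𝓡 3).tangent)
    ((normSq_isSmoothFun g).mdifferentiableAt (by simp) (x := p)) u
  rw [tangent_chart_self] at h
  exact h.symm

/-- The normalization `(z, e) ↦ (z, e / |e|)` in the chart of `TM` at `p`. -/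
def normalize (g : Metric M) (p : TM M) (y : E3 × E3) : E3 × E3 :=
  (y.1, (Real.sqrt (normSqCoord g p y))⁻¹ • y.2)

theorem normalize_ctr {p : TM M} (hp : p ∈ UM g) : normalize g p (ctr p) = ctr p := by
  unfold normalize
  rw [normSqCoord_ctr hp]
  simp

theorem contDiffAt_inv_sqrt_normSqCoord {p : TM M} (hp : p ∈ UM g) :
    ContDiffAt ℝ ∞ (fun y => (Real.sqrt (normSqCoord g p y))⁻¹) (ctr p) := by
  have h1 := contDiffAt_normSqCoord (g := g) p (tangent_chart_self_fst_mem p)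
  have h2 := normSqCoord_ctr hp
  exact (h1.sqrt (by rw [h2]; exact one_ne_zero)).inv (by rw [h2]; simp)

theorem contDiffAt_normalize {p : TM M} (hp : p ∈ UM g) :
    ContDiffAt ℝ ∞ (normalize g p) (ctr p) :=
  contDiffAt_fst.prodMk ((contDiffAt_inv_sqrt_normSqCoord hp).smul contDiffAt_snd)

/-- At a point of 𝒞 the scaling factor is 1, and its derivative along a vector tangent to 𝒞 is zero
because |e| is constant to first order. -/
theorem fderiv_normalize {p : TM M} (hp : p ∈ UM g) {u : E3 × E3}
    (hu : dFun (𝓡 3).tangent (normSq g) p u = 0) : fderiv ℝ (normalize g p) (ctr p) u = u := by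
  have h1 := (contDiffAt_inv_sqrt_normSqCoord hp).differentiableAt (by simp)
  have h2 := normSqCoord_ctr hp
  have h3 : DifferentiableAt ℝ (normSqCoord g p) (ctr p) :=
    (contDiffAt_normSqCoord (g := g) p (tangent_chart_self_fst_mem p)).differentiableAt (by simp)
  have h4 : fderiv ℝ (fun y => (Real.sqrt (normSqCoord g p y))⁻¹) (ctr p) u = 0 := by
    have h5 : DifferentiableAt ℝ (fun t : ℝ => (Real.sqrt t)⁻¹) (normSqCoord g p (ctr p)) := by
      rw [h2]
      exact (DifferentiableAt.sqrt differentiableAt_id one_ne_zero).inv (by simp)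
    have h6 := fderiv_comp (ctr p) h5 h3
    have h7 : ((fun t : ℝ => (Real.sqrt t)⁻¹) ∘ normSqCoord g p) =
      fun y => (Real.sqrt (normSqCoord g p y))⁻¹ := rfl
    rw [h7] at h6
    rw [h6, ContinuousLinearMap.comp_apply, fderiv_normSqCoord_ctr, hu, map_zero]
  have h8 : fderiv ℝ (normalize g p) (ctr p) = (ContinuousLinearMap.fst ℝ E3 E3).prod
      (fderiv ℝ (fun y : E3 × E3 => (Real.sqrt (normSqCoord g p y))⁻¹ • y.2) (ctr p)) := by
    unfold normalize
    rw [DifferentiableAt.fderiv_prodMk differentiableAt_fst (h1.fun_smul differentiableAt_snd),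
      fderiv_fst]
  rw [h8, ContinuousLinearMap.prod_apply, fderiv_fun_smul h1 differentiableAt_snd]
  simp only [add_apply, smul_apply, ContinuousLinearMap.smulRight_apply, h4, fderiv_snd,
    ContinuousLinearMap.coe_fst', ContinuousLinearMap.coe_snd', h2]
  simp

theorem eventually_normalize {p : TM M} (hp : p ∈ UM g) :
    ∀ᶠ y in 𝓝 (ctr p), (normalize g p y).1 ∈ (extChartAt (𝓡 3) p.1).target ∧
      (extChartAt (𝓡 3).tangent p).symm (normalize g p y) ∈ UM g ∧
      normSqCoord g p (normalize g p y) = 1 ∧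
      DifferentiableAt ℝ (normalize g p) y := by
  have hc := (contDiffAt_normSqCoord (g := g) p (tangent_chart_self_fst_mem p)).continuousAt
  have h1 : ∀ᶠ y in 𝓝 (ctr p), 0 < normSqCoord g p y :=
    hc.eventually (lt_mem_nhds (by rw [normSqCoord_ctr hp]; exact one_pos))
  have h2 : ∀ᶠ y in 𝓝 (ctr p), DifferentiableAt ℝ (normalize g p) y := by
    filter_upwards [((contDiffAt_normalize hp).of_le (m := 1) (by simp)).eventually (by simp)]
      with y hy
    exact hy.differentiableAt (by simp)
  filter_upwards [eventually_fst_mem p (ctr p) (tangent_chart_self_fst_mem p), h1, h2]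
    with y hy hy1 hy2
  have h3 : normSqCoord g p (normalize g p y) = 1 := by
    have h4 : (normalize g p y).1 ∈ (extChartAt (𝓡 3) p.1).target := hy
    rw [normSqCoord_eq p h4]
    have h5 : metricCoord g p.1 y.1 y.2 y.2 = normSqCoord g p y := (normSqCoord_eq p hy).symm
    unfold normalize
    simp only [map_smul, smul_apply, smul_eq_mul, h5]
    have h6 := Real.mul_self_sqrt hy1.le
    have h7 := (Real.sqrt_pos.2 hy1).ne'
    field_simp
    nlinarith
  exact ⟨hy, h3, h3, hy2⟩

/-- The image of the derivative of the normalization is tangent to the unit tangent bundle. -/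
theorem eventually_dFun_normalize {p : TM M} (hp : p ∈ UM g) :
    ∀ᶠ y in 𝓝 (ctr p), ∀ u, dFun (𝓡 3).tangent (normSq g)
      ((extChartAt (𝓡 3).tangent p).symm (normalize g p y))
        (chartD (𝓡 3).tangent p (normalize g p y) (fderiv ℝ (normalize g p) y u)) = 0 := by
  filter_upwards [(eventually_normalize hp).eventually_nhds] with y hy u
  have hy0 := hy.self_of_nhds
  rw [← fderiv_normSqCoord p hy0.1]
  have h1 := fderiv_comp y ((contDiffAt_normSqCoord (g := g) p hy0.1).differentiableAt (by simp))
    hy0.2.2.2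
  have h2 : normSqCoord g p ∘ normalize g p =ᶠ[𝓝 y] fun _ => (1 : ℝ) :=
    hy.mono fun z hz => hz.2.2.1
  rw [h2.fderiv_eq] at h1
  have h3 := DFunLike.congr_fun h1 u
  rw [ContinuousLinearMap.comp_apply] at h3
  rw [← h3]
  simp

theorem DForm.inChart_one (α : DForm (𝓡 3).tangent (TM M) 1) (p : TM M) (y u : E3 × E3) :
    α.inChart p y ![u] = α.val ((extChartAt (𝓡 3).tangent p).symm y)
      ![chartD (𝓡 3).tangent p y u] := by
  rw [DForm.inChart_eq]
  change α.val _ _ = _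
  congr 1
  funext i
  fin_cases i
  rfl

theorem DForm.inChart_two (α : DForm (𝓡 3).tangent (TM M) 2) (p : TM M) (y u v : E3 × E3) :
    α.inChart p y ![u, v] = α.val ((extChartAt (𝓡 3).tangent p).symm y)
      ![chartD (𝓡 3).tangent p y u, chartD (𝓡 3).tangent p y v] := by
  rw [DForm.inChart_eq]
  change α.val _ _ = _
  congr 1
  funext i
  fin_cases i <;> rfl

/-- If `dψ = α ∧ θ` on the unit tangent bundle then `α ∧ dθ = 0` on the contact planes. -/
theorem wedge_d_contactForm_eq_zero {ψ α : DForm (𝓡 3).tangent (TM M) 1} (hψ : ψ.IsSmooth)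
    (hα : α.IsSmooth)
    (h : ∀ q ∈ UM g, ∀ u v : E3 × E3, dFun (𝓡 3).tangent (normSq g) q u = 0 →
      dFun (𝓡 3).tangent (normSq g) q v = 0 → ψ.d.val q ![u, v] =
        α.val q ![u] * (contactForm g).val q ![v] - α.val q ![v] * (contactForm g).val q ![u])
    {p : TM M} (hp : p ∈ UM g) {u v w : E3 × E3}
    (hu : dFun (𝓡 3).tangent (normSq g) p u = 0) (hv : dFun (𝓡 3).tangent (normSq g) p v = 0)
    (hw : dFun (𝓡 3).tangent (normSq g) p w = 0) (hu' : (contactForm g).val p ![u] = 0)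
    (hv' : (contactForm g).val p ![v] = 0) (hw' : (contactForm g).val p ![w] = 0) :
    α.val p ![u] * (contactForm g).d.val p ![v, w] - α.val p ![v] * (contactForm g).d.val p ![u, w] +
      α.val p ![w] * (contactForm g).d.val p ![u, v] = 0 := by
  have hy : ctr p ∈ (extChartAt (𝓡 3).tangent p).target :=
    mem_tangent_target.2 (tangent_chart_self_fst_mem p)
  have hval : ∀ β : DForm (𝓡 3).tangent (TM M) 1, β.inChart p (ctr p) = β.val p := fun β => by
    rw [← tangent_chart_self, DForm.inChart_self]
  have hd : (contactForm g).d.val p = extDeriv ((contactForm g).inChart p) (ctr p) := by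
    rw [← tangent_chart_self, DForm.d_val]
  have key := extDeriv_eq_wedge_of_retraction (u := u) (v := v) (w := w) (normalize_ctr hp)
    (contDiffAt_normalize hp) (hψ.contDiffAt hy) (hα.contDiffAt hy)
    ((contactForm_isSmooth g).contDiffAt hy) ?_ (by rw [hval, hu']) (by rw [hval, hv'])
    (by rw [hval, hw']) (fderiv_normalize hp hu) (fderiv_normalize hp hv) (fderiv_normalize hp hw)
  · rwa [hval, ← hd] at key
  -- After normalization the points lie in 𝒞 and the image vectors are tangent to it, so the
  -- hypothesis on 𝒞 applies on a full neighbourhood in TM.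
  · filter_upwards [eventually_normalize hp, eventually_dFun_normalize hp] with y hy1 hy2 u v
    rw [← hψ.inChart_d (mem_tangent_target.2 hy1.1), DForm.inChart_two, DForm.inChart_one,
      DForm.inChart_one, DForm.inChart_one, DForm.inChart_one]
    exact h _ hy1.2.1 _ _ (hy2 u) (hy2 v)

end Contact

/-- In dimension three there is a non-zero vector orthogonal to two given ones. -/
theorem exists_orthogonal (B : E3 →L[ℝ] E3 →L[ℝ] ℝ) (a b : E3) :
    ∃ c, c ≠ 0 ∧ B a c = 0 ∧ B b c = 0 := by
  have h : LinearMap.ker (((B a).prod (B b)).toLinearMap) ≠ ⊥ := by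
    refine LinearMap.ker_ne_bot_of_finrank_lt ?_
    rw [finrank_E3, Module.finrank_prod, Module.finrank_self]
    norm_num
  obtain ⟨c, hc, hc0⟩ := (Submodule.ne_bot_iff _).1 h
  have h1 : (B a c, B b c) = (0 : ℝ × ℝ) := hc
  exact ⟨c, hc0, congrArg Prod.fst h1, congrArg Prod.snd h1⟩

/-! ### Nondegeneracy of dθ on the contact planes. -/

section Contact

variable {M : Type*} [TopologicalSpace M] [ChartedSpace (EuclideanSpace ℝ (Fin 3)) M]
  [IsManifold (𝓡 3) ∞ M] {g : Metric M}

/-- The lift of a vector at `x` to a vector tangent to the unit tangent bundle at `(x, e)`. -/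
def tangentLift (g : Metric M) (p : TM M) (a : E3) : E3 × E3 :=
  (a, (-(metricD g p.1 a (fib p) (fib p)) / 2) • fib p)

theorem dFun_tangentLift {p : TM M} (hp : p ∈ UM g) (a : E3) :
    dFun (𝓡 3).tangent (normSq g) p (tangentLift g p a) = 0 := by
  have h : metricAt g p.1 (fib p) (fib p) = 1 := hp
  rw [dFun_normSq]
  unfold tangentLift
  rw [map_smul, smul_apply, h, smul_eq_mul]
  ring

theorem metricD_zero (g : Metric M) (x : M) : metricD g x 0 = 0 :=
  map_zero (fderiv ℝ (metricCoord g x) (extChartAt (𝓡 3) x x))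

theorem dFun_vertical (p : TM M) {a : E3} (ha : metricAt g p.1 (fib p) a = 0) :
    dFun (𝓡 3).tangent (normSq g) p ((0, a) : E3 × E3) = 0 := by
  have h := metricD_zero g p.1
  rw [dFun_normSq, (isInner_metricAt g p.1).symm, ha]
  simp only [h]
  simp

theorem d_contactForm_vertical_vertical (p : TM M) (a b : E3) :
    (contactForm g).d.val p ![((0, a) : E3 × E3), (0, b)] = 0 := by
  rw [d_contactForm]
  simp

theorem d_contactForm_vertical_tangentLift (p : TM M) (a b : E3) :
    (contactForm g).d.val p ![((0, a) : E3 × E3), tangentLift g p b] = metricAt g p.1 a b := by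
  have h := metricD_zero g p.1
  rw [d_contactForm]
  simp only [h]
  simp [tangentLift]

/-- A `1`-form with `dψ = α ∧ θ` on the unit tangent bundle is closed there. -/
theorem d_eq_zero_of_d_eq_wedge {ψ α : DForm (𝓡 3).tangent (TM M) 1} (hψ : ψ.IsSmooth)
    (hα : α.IsSmooth)
    (h : ∀ q ∈ UM g, ∀ u v : E3 × E3, dFun (𝓡 3).tangent (normSq g) q u = 0 →
      dFun (𝓡 3).tangent (normSq g) q v = 0 → ψ.d.val q ![u, v] =
        α.val q ![u] * (contactForm g).val q ![v] - α.val q ![v] * (contactForm g).val q ![u])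
    {p : TM M} (hp : p ∈ UM g) {u v : E3 × E3}
    (hu : dFun (𝓡 3).tangent (normSq g) p u = 0) (hv : dFun (𝓡 3).tangent (normSq g) p v = 0) :
    ψ.d.val p ![u, v] = 0 := by
  -- The contact plane is spanned by the vertical vectors (0, a) and the lifts of vectors a, with a
  -- ⟂ e. The form dθ pairs the two kinds by the metric and vanishes on pairs of vertical vectors.
  have hT := fun u v w => wedge_d_contactForm_eq_zero hψ hα h hp (u := u) (v := v) (w := w)
  have hsymm := (isInner_metricAt g p.1).symm
  have he : metricAt g p.1 (fib p) (fib p) = 1 := hp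
  let l : E3 × E3 →L[ℝ] ℝ := (ContinuousAlternatingMap.ofSubsingleton ℝ (E3 × E3) ℝ
    (0 : Fin 1)).symm (α.val p)
  have hl : ∀ w, α.val p ![w] = l w := by
    intro w
    change _ = α.val p _
    congr 1
    funext i
    fin_cases i
    rfl
  have hθV : ∀ a, (contactForm g).val p ![((0, a) : E3 × E3)] = 0 := by
    intro a
    rw [contactForm_val]
    exact map_zero _
  have hθH : ∀ a, metricAt g p.1 (fib p) a = 0 →
      (contactForm g).val p ![tangentLift g p a] = 0 := by
    intro a ha
    rw [contactForm_val]
    exact ha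
  -- With c ⟂ e and c ⟂ a, the triple (0, c), lift of c, (0, a) isolates `l (0, a)` with the nonzero
  -- coefficient ⟨c, c⟩.
  have hV : ∀ a, metricAt g p.1 (fib p) a = 0 → l (0, a) = 0 := by
    intro a ha
    obtain ⟨c, hc, hc1, hc2⟩ := exists_orthogonal (metricAt g p.1) (fib p) a
    have h1 := hT (0, c) (tangentLift g p c) (0, a) (dFun_vertical p hc1)
      (dFun_tangentLift hp c) (dFun_vertical p ha) (hθV c) (hθH c hc1) (hθV a)
    rw [d_contactForm_vertical_vertical, d_contactForm_vertical_tangentLift,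
      alt_two_swap, d_contactForm_vertical_tangentLift, hc2, hl, hl, hl] at h1
    have h2 : l (0, a) * metricAt g p.1 c c = 0 := by linear_combination h1
    exact (mul_eq_zero.1 h2).resolve_right ((isInner_metricAt g p.1).pos c hc).ne'
  -- The value of dθ on two lifts is not computed: it is multiplied by `l (0, c)`, which is zero by
  -- `hV`.
  have hH : ∀ a, metricAt g p.1 (fib p) a = 0 → l (tangentLift g p a) = 0 := by
    intro a ha
    obtain ⟨c, hc, hc1, hc2⟩ := exists_orthogonal (metricAt g p.1) (fib p) a
    have h1 := hT (tangentLift g p a) (0, c) (tangentLift g p c) (dFun_tangentLift hp a)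
      (dFun_vertical p hc1) (dFun_tangentLift hp c) (hθH a ha) (hθV c) (hθH c hc1)
    rw [d_contactForm_vertical_tangentLift, alt_two_swap _ (tangentLift g p a) (0, c),
      d_contactForm_vertical_tangentLift, hsymm c a, hc2, hl, hl, hl, hV c hc1] at h1
    have h2 : l (tangentLift g p a) * metricAt g p.1 c c = 0 := by linear_combination h1
    exact (mul_eq_zero.1 h2).resolve_right ((isInner_metricAt g p.1).pos c hc).ne'
  have hK : ∀ w : E3 × E3, dFun (𝓡 3).tangent (normSq g) p w = 0 →
      metricAt g p.1 (fib p) w.1 = 0 → l w = 0 := by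
    intro w hw hw'
    have h1 : w = tangentLift g p w.1 +
        (0, w.2 - (-(metricD g p.1 w.1 (fib p) (fib p)) / 2) • fib p) := by
      refine Prod.ext ?_ ?_
      · simp [tangentLift]
      · simp only [tangentLift, Prod.mk_add_mk]
        abel
    have h2 : metricAt g p.1 (fib p)
        (w.2 - (-(metricD g p.1 w.1 (fib p) (fib p)) / 2) • fib p) = 0 := by
      rw [dFun_normSq, hsymm w.2] at hw
      rw [map_sub, map_smul, he, smul_eq_mul]
      linarith
    rw [h1, map_add, hH _ hw', hV _ h2, add_zero]
  -- Subtracting θ(w) times the lift of e brings w into the contact plane, where `l` vanishes. Hence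
  -- α is a multiple of θ on 𝒞 and α ∧ θ = 0.
  have hlin : ∀ w : E3 × E3, dFun (𝓡 3).tangent (normSq g) p w = 0 →
      α.val p ![w] = (contactForm g).val p ![w] * l (tangentLift g p (fib p)) := by
    intro w hw
    have h1 : l (w - metricAt g p.1 (fib p) w.1 • tangentLift g p (fib p)) = 0 := by
      refine hK _ ?_ ?_
      · have h2 := dFun_tangentLift hp (fib p)
        rw [dFun_normSq] at hw h2 ⊢
        have h3 : ∀ (r : ℝ) (x : E3 × E3), (w - r • x).1 = w.1 + (-r) • x.1 := fun r x => by
          rw [neg_smul, ← sub_eq_add_neg]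
          rfl
        have h4 : ∀ (r : ℝ) (x : E3 × E3), (w - r • x).2 = w.2 + (-r) • x.2 := fun r x => by
          rw [neg_smul, ← sub_eq_add_neg]
          rfl
        rw [h3, h4, metricD_add, metricD_smul, map_add, map_smul]
        simp only [add_apply, smul_apply, smul_eq_mul]
        linear_combination hw - metricAt g p.1 (fib p) w.1 * h2
      · have h3 : (w - metricAt g p.1 (fib p) w.1 • tangentLift g p (fib p)).1 =
          w.1 - metricAt g p.1 (fib p) w.1 • fib p := rfl
        rw [h3, map_sub, map_smul, he, smul_eq_mul, mul_one, sub_self]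
    rw [map_sub, map_smul, smul_eq_mul, sub_eq_zero] at h1
    rw [hl, h1, contactForm_val]
  rw [h p hp u v hu hv, hlin u hu, hlin v hv]
  ring

end Contact

/-! ### Uniqueness of the Noether class when H¹(𝒞) = 0. -/

section Cohomology

variable {M : Type*} [TopologicalSpace M] [ChartedSpace (EuclideanSpace ℝ (Fin 3)) M]
  [IsManifold (𝓡 3) ∞ M] {g : Metric M} {vol : DForm (𝓡 3) M 3} {H : ℝ} {Ξ S F : (x : M) → T3 x}

/-- When `H¹(𝒞) = 0`, a form whose differential lies in the contact ideal differs from an exact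
form by a multiple of the contact form. -/
theorem FirstCohomologyVanishes.exists_eq (hC : FirstCohomologyVanishes g)
    {η : DForm (𝓡 3).tangent (TM M) 1} (hη : η.IsSmooth) (h : InContactIdeal g η.d) :
    ∃ a b : TM M → ℝ, IsSmoothFun (𝓡 3).tangent a ∧ IsSmoothFun (𝓡 3).tangent b ∧
      ∀ p ∈ UM g, ∀ w : E3 × E3, dFun (𝓡 3).tangent (normSq g) p w = 0 →
        η.val p ![w] = a p * (contactForm g).val p ![w] + dFun (𝓡 3).tangent b p w := by
  obtain ⟨α, b, hα, hb, h⟩ := h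
  have hθ := contactForm_isSmooth g
  have hbθ := hθ.fun_smul hb
  -- Subtracting bθ absorbs the term b dθ and leaves (α - db) ∧ θ, so the form is closed on 𝒞.
  have hψ := hη.sub hbθ
  have hα' := hα.sub hb.ofFun.d
  have hd := fun p (hp : p ∈ UM g) (u v : E3 × E3)
    (hu : dFun (𝓡 3).tangent (normSq g) p u = 0) (hv : dFun (𝓡 3).tangent (normSq g) p v = 0) =>
    d_eq_zero_of_d_eq_wedge hψ hα' (by
      intro q hq u v hu hv
      have h1 : η.d.val q ![u, v] =
          (α.val q ![u] * (contactForm g).val q ![v] - α.val q ![v] * (contactForm g).val q ![u]) +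
            b q * (contactForm g).d.val q ![u, v] := h q hq u hu v hv
      have h2 := hθ.d_fun_smul_one hb q u v
      have h3 : DForm.val (DForm.d (I := (𝓡 3).tangent)
          (fun x => η x - (fun x => b x • contactForm g x : DForm (𝓡 3).tangent (TM M) 1) x)) q
          ![u, v] = η.d.val q ![u, v] - DForm.val (DForm.d (I := (𝓡 3).tangent)
            (fun x => b x • contactForm g x)) q ![u, v] :=
        DFunLike.congr_fun (F := (E3 × E3) [⋀^Fin 2]→L[ℝ] ℝ) (hη.d_sub hbθ q) ![u, v]
      have h4 : ∀ x : E3 × E3, DForm.val (I := (𝓡 3).tangent)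
          (fun x => α x - (DForm.ofFun (𝓡 3).tangent b).d x) q ![x] =
          α.val q ![x] - dFun (𝓡 3).tangent b q x := by
        intro x
        rw [← hb.d_ofFun]
        rfl
      refine h3.trans ?_
      rw [h1, h2, h4, h4]
      ring) hp hu hv
  obtain ⟨c, hc, h'⟩ := hC _ hψ fun p hp u hu v hv => hd p hp u v hu hv
  refine ⟨b, c, hb, hc, fun p hp w hw => ?_⟩
  have h1 : η.val p ![w] - b p * (contactForm g).val p ![w] = dFun (𝓡 3).tangent c p w :=
    h' p hp w hw
  linarith

/-- When `H¹(𝒞) = 0`, the Noether forms of `S` are all in the same class. -/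
theorem IsNoetherForm.sameClass_noetherForm (hC : FirstCohomologyVanishes g)
    (hvol : IsVolumeForm g vol) (hΞ : IsVolumeField vol Ξ) (hS : IsKilling g S)
    (hF : IsPotentialVector g vol S F) {μ : DForm (𝓡 3).tangent (TM M) 1}
    (hμ : IsNoetherForm g (lagrangian vol Ξ H) S μ) :
    SameClass g μ (noetherForm g vol S F H) := by
  obtain ⟨-, φ, hφ, h1, a₀, b₀, ha₀, hb₀, h2⟩ := hμ
  have hφ' := noetherPotential_isSmooth (g := g) (H := H) hvol.1 hΞ.1 hS.1 hF.1
  have h3 : (DForm.d (I := (𝓡 3).tangent) fun p => noetherPotential g vol Ξ S F H p - φ p) =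
      fun p => DForm.lieDeriv (extension S) (lagrangian vol Ξ H) p - φ.d p := by
    funext p
    rw [hφ'.d_sub hφ, lieDeriv_lagrangian_eq_d_noetherPotential hvol hΞ hS hF]
  -- The difference of the two potentials has differential ℒ_S Λ - dφ, which lies in the contact
  -- ideal; up to the class of `μ`, it is also the difference of the two Noether forms.
  obtain ⟨a, b, ha, hb, h⟩ := hC.exists_eq (hφ'.sub hφ) (by rw [h3]; exact h1)
  have key : ∀ p ∈ UM g, ∀ w : E3 × E3, dFun (𝓡 3).tangent (normSq g) p w = 0 →
      μ.val p ![w] - (noetherForm g vol S F H).val p ![w] =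
        (a₀ p + a p) * (contactForm g).val p ![w] +
          dFun (𝓡 3).tangent (fun q => b₀ q + b q) p w := by
    intro p hp w hw
    have e1 : μ.val p ![w] - ((DForm.contract (extension S) (lagrangian vol Ξ H)).val p ![w] -
        φ.val p ![w]) = a₀ p * (contactForm g).val p ![w] + dFun (𝓡 3).tangent b₀ p w :=
      h2 p hp w hw
    have e2 : (noetherPotential g vol Ξ S F H).val p ![w] - φ.val p ![w] =
        a p * (contactForm g).val p ![w] + dFun (𝓡 3).tangent b p w := h p hp w hw
    have e3 : (noetherForm g vol S F H).val p ![w] =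
        (DForm.contract (extension S) (lagrangian vol Ξ H)).val p ![w] -
          (noetherPotential g vol Ξ S F H).val p ![w] :=
      DFunLike.congr_fun (F := (E3 × E3) [⋀^Fin 1]→L[ℝ] ℝ) (noetherForm_eq (Ξ := Ξ) p) ![w]
    have e4 : dFun (𝓡 3).tangent (fun q => b₀ q + b q) p w =
        dFun (𝓡 3).tangent b₀ p w + dFun (𝓡 3).tangent b p w := by
      have hm := mfderiv_add (I := (𝓡 3).tangent) (hb₀.mdifferentiableAt (by simp) (x := p))
        (hb.mdifferentiableAt (by simp) (x := p))
      exact DFunLike.congr_fun hm w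
    rw [e4, e3]
    linear_combination e1 + e2
  exact ⟨fun q => a₀ q + a q, fun q => b₀ q + b q, ha₀.add ha, hb₀.add hb, key⟩

end Cohomology

end CMC

end

/-! ### The proposition. -/

theorem mainTheorem2
    {M : Type*} [TopologicalSpace M] [ChartedSpace (EuclideanSpace ℝ (Fin 3)) M]
    [IsManifold (𝓡 3) ∞ M]
    (g : CMC.Metric M) (vol : CMC.DForm (𝓡 3) M 3) (hvol : CMC.IsVolumeForm g vol)
    (H : ℝ)
    (Ξ : (x : M) → CMC.T3 x) (hΞ : CMC.IsVolumeField vol Ξ)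
    (S : (x : M) → CMC.T3 x) (hS : CMC.IsKilling g S)
    {Sg : Type*} [TopologicalSpace Sg] [ChartedSpace (EuclideanSpace ℝ (Fin 2)) Sg]
    [IsManifold (𝓡 2) ∞ Sg]
    (f : Sg → M) (hf : CMC.IsImmersion f)
    (n : (s : Sg) → CMC.T3 (f s)) (hn : CMC.IsUnitNormal g f n) (hH : CMC.IsCMC g f n H) :
    -- the pullback of every representative, even in the wide sense, is a closed form
    (∀ μ, CMC.IsWeakNoetherForm g (CMC.lagrangian vol Ξ H) S μ →
      (CMC.DForm.pullback (I := 𝓡 2) (CMC.lift f n) μ).IsClosed) ∧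
    -- the class of the pullback depends only on the class of the representative
    (∀ μ ν : CMC.DForm (𝓡 3).tangent (CMC.TM M) 1, CMC.SameClass g μ ν →
      CMC.DForm.Cohomologous (CMC.DForm.pullback (I := 𝓡 2) (CMC.lift f n) μ)
        (CMC.DForm.pullback (CMC.lift f n) ν)) ∧
    ∀ F : (x : M) → CMC.T3 x, CMC.IsPotentialVector g vol S F →
      -- `S ⌟ Λ₀ - 2H F^♭` represents `μ_S`
      CMC.IsNoetherForm g (CMC.lagrangian vol Ξ H) S (fun p =>
        CMC.DForm.contract (CMC.extension S) (CMC.lagrangianArea vol) p -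
          (2 * H) • CMC.DForm.pullback CMC.proj (CMC.flat g F) p) ∧
      -- the pullbacks of its two parts are `⟨S, *df⟩` and `⟨F, df⟩`
      CMC.DForm.pullback (CMC.lift f n)
          (CMC.DForm.contract (CMC.extension S) (CMC.lagrangianArea vol)) =
        CMC.minimalPart g vol f n S ∧
      CMC.DForm.pullback (CMC.lift f n)
          (CMC.DForm.pullback (I := (𝓡 3).tangent) CMC.proj (CMC.flat g F)) =
        CMC.cmcPart g f F ∧
      -- that form is closed
      CMC.DForm.IsClosed (fun s =>
        CMC.minimalPart g vol f n S s - (2 * H) • CMC.cmcPart g f F s) ∧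
      -- `N^* μ_S` is well defined in `H¹(Σ)` and is the class of `⟨S, *df⟩ - 2H ⟨F, df⟩`
      (CMC.FirstCohomologyVanishes g →
        ∀ μ, CMC.IsNoetherForm g (CMC.lagrangian vol Ξ H) S μ →
          CMC.DForm.Cohomologous (CMC.DForm.pullback (CMC.lift f n) μ)
            (fun s => CMC.minimalPart g vol f n S s - (2 * H) • CMC.cmcPart g f F s)) := by
  refine ⟨fun μ hμ => hμ.isClosed_pullback hvol hΞ hS hf hn hH, fun μ ν h => h.cohomologous hn,
    fun F hF => ?_⟩
  have hN : CMC.IsNoetherForm g (CMC.lagrangian vol Ξ H) S (CMC.noetherForm g vol S F H) :=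
    CMC.isNoetherForm_noetherForm hvol hΞ hS hF
  have hp := hn.pullback_noetherForm hvol hf S F H
  refine ⟨hN, hn.pullback_contract_lagrangianArea hvol hf S, hn.pullback_flat F, ?_,
    fun hC μ hμ => ?_⟩
  · rw [← hp]
    exact hN.isClosed_pullback hvol hΞ hS hf hn hH
  · rw [← hp]
    exact (hμ.sameClass_noetherForm hC hvol hΞ hS hF).cohomologous hn
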